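/- Let $d\ge 1$ be an integer, $\gamma>0$, and let $V\in C^\infty(\mathbb{R}^d;\mathbb{R})$ have bounded derivatives of every order $\ge 2$ and satisfy $e^{-V}\in L^1(\mathbb{R}^d)$. Put $\mu_\infty(v)=(2\pi)^{-d/2}e^{-|v|^2/2}$, $\rho_\infty(x)=e^{-V(x)}/\int e^{-V}$, $\mathcal M(x,v)=\rho_\infty(x)\mu_\infty(v)$. On functions of $(x,v)\in\mathbb{R}^{2d}$ let $$K=X_0+\gamma(\mathrm{Id}-\Pi_1),\qquad X_0=v\cdot\partial_x-\partial_xV(x)\cdot\partial_v,\qquad \Pi_1u(x,v)=\Big(\int u(x,v')\mu_\infty^{1/2}(v')\,dv'\Big)\mu_\infty^{1/2}(v),$$ $$a_j=\gamma^{1/2}\big(\partial_{x_j}+\tfrac12\partial_{x_j}V\big),\qquad b_j=\gamma^{1/2}\big(\partial_{v_j}+\tfrac12 v_j\big),$$ with formal adjoints $a_j^*=\gamma^{1/2}(-\partial_{x_j}+\tfrac12\partial_{x_j}V)$, $b_j^*=\gamma^{1/2}(-\partial_{v_j}+\tfrac12v_j)$. Let $\Lambda^2=\sum_j a_j^*a_j+\sum_j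 b_j^*b_j+1$, regarded as an operator in $L^2(\mathbb{R}^{2d};\mathbb{C})$ by closure from the Schwartz space $\mathcal S(\mathbb{R}^{2d})$. Assume that $\Lambda^2-1$ has a spectral gap $\alpha>0$, that is, the infimum of its spectrum with the lowest eigenvalue $0$ removed is $\alpha>0$. Then $\Lambda^2$ has a bounded inverse $\Lambda^{-2}$ on $L^2(\mathbb{R}^{2d})$, the operator $L=\Lambda^{-2}\sum_j a_j^*b_j$, defined on $\mathcal S(\mathbb{R}^{2d})$, extends to a bounded operator $L$ on $L^2(\mathbb{R}^{2d})$, and there are $\varepsilon,A>0$ with $\|\varepsilon L\|\le1$ such that for every $u\in\mathcal S(\mathbb{R}^{2d})$ with $u\perp\mathcal M^{1/2}$ one has $Ku\in L^2(\mathbb{R}^{2d})$ and $$\mathrm{Re}\,\big(Ku,(\mathrm{Id}+\varepsilon(L+L^*))u\big)_{L^2}\ \ge\ \frac{\alpha^2}{A}\,\|u\|_{L^2}^2 .$$ Moreover $A$ can be chosen to depend only on $d$, on $\gamma$ and on upper bounds $M_2\ge\sup_x\|D^2V(x)\|$, $M_3\ge\sup_x\|D^3V(x)\|$ for the second and third derivatives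 of $V$: given $d,\gamma,M_2,M_3$, one $A>0$ works for all such $V$ and $\alpha$. -/

import Mathlib

open MeasureTheory
open scoped SchwartzMap ContDiff InnerProductSpace

noncomputable section

namespace RelaxationBoltzmann

/-- Position (or velocity) space `ℝᵈ` with its Euclidean norm. -/
abbrev Pos (d : ℕ) : Type := EuclideanSpace ℝ (Fin d)

/-- Phase space `ℝ²ᵈ`; a point is `z = (x, v)`. -/
abbrev Phase (d : ℕ) : Type := Pos d × Pos d

/-- The complex Hilbert space `L²(ℝ²ᵈ, dx dv)`. -/
abbrev H (d : ℕ) : Type := Lp ℂ 2 (volume : Measure (Phase d))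

instance instIsAddHaarMeasurePhase (d : ℕ) :
    (volume : Measure (Phase d)).IsAddHaarMeasure :=
  inferInstanceAs ((volume : Measure (Pos d)).prod (volume : Measure (Pos d))).IsAddHaarMeasure

variable {d : ℕ}

/-- A confining potential: `V` is smooth, its derivatives of every order `≥ 2` are bounded,
and `e^{-V}` is integrable. -/
structure IsConfining (V : Pos d → ℝ) : Prop where
  smooth : ContDiff ℝ ∞ V
  bounded_deriv : ∀ n : ℕ, 2 ≤ n → ∃ C : ℝ, ∀ x, ‖iteratedFDeriv ℝ n V x‖ ≤ C
  integrable_exp : Integrable (fun x => Real.exp (-V x)) volume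

/-- The velocity Maxwellian `μ_∞(v) = e^{-|v|²/2} / (2π)^{d/2}`. -/
def muInf (v : Pos d) : ℝ :=
  Real.exp (-‖v‖ ^ 2 / 2) / (2 * Real.pi) ^ ((d : ℝ) / 2)

/-- The spatial Maxwellian `ρ_∞(x) = e^{-V(x)} / ∫ e^{-V}`. -/
def rhoInf (V : Pos d → ℝ) (x : Pos d) : ℝ :=
  Real.exp (-V x) / ∫ y, Real.exp (-V y)

/-- The global Maxwellian `𝓜(x, v) = ρ_∞(x) μ_∞(v)`. -/
def maxwellian (V : Pos d → ℝ) (z : Phase d) : ℝ := rhoInf V z.1 * muInf z.2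

/-- `∂_{x_j} u`. -/
def dx (j : Fin d) (u : Phase d → ℂ) (z : Phase d) : ℂ :=
  fderiv ℝ u z (EuclideanSpace.single j 1, 0)

/-- `∂_{v_j} u`. -/
def dv (j : Fin d) (u : Phase d → ℂ) (z : Phase d) : ℂ :=
  fderiv ℝ u z (0, EuclideanSpace.single j 1)

/-- `∂_{x_j} V`. -/
def dV (V : Pos d → ℝ) (j : Fin d) (x : Pos d) : ℝ :=
  fderiv ℝ V x (EuclideanSpace.single j 1)

/-- `X₀ = v · ∂_x - ∂_x V(x) · ∂_v`. -/
def opX0 (V : Pos d → ℝ) (u : Phase d → ℂ) (z : Phase d) : ℂ :=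
  ∑ j, ((z.2 j : ℂ) * dx j u z - (dV V j z.1 : ℂ) * dv j u z)

/-- `Π₁ u(x, v) = (∫ u(x, v') μ_∞(v')^{1/2} dv') μ_∞(v)^{1/2}`. -/
def opPi1 (u : Phase d → ℂ) (z : Phase d) : ℂ :=
  (∫ w : Pos d, u (z.1, w) * (Real.sqrt (muInf w) : ℂ)) * (Real.sqrt (muInf z.2) : ℂ)

/-- `K = X₀ + γ (Id - Π₁)`. -/
def opK (γ : ℝ) (V : Pos d → ℝ) (u : Phase d → ℂ) (z : Phase d) : ℂ :=
  opX0 V u z + (γ : ℂ) * (u z - opPi1 u z)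

/-- `a_j = γ^{1/2} (∂_{x_j} + ∂_{x_j} V / 2)`. -/
def opA (γ : ℝ) (V : Pos d → ℝ) (j : Fin d) (u : Phase d → ℂ) (z : Phase d) : ℂ :=
  (Real.sqrt γ : ℂ) * (dx j u z + (dV V j z.1 : ℂ) / 2 * u z)

/-- `a_j^* = γ^{1/2} (-∂_{x_j} + ∂_{x_j} V / 2)`. -/
def opAStar (γ : ℝ) (V : Pos d → ℝ) (j : Fin d) (u : Phase d → ℂ) (z : Phase d) : ℂ :=
  (Real.sqrt γ : ℂ) * (-dx j u z + (dV V j z.1 : ℂ) / 2 * u z)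

/-- `b_j = γ^{1/2} (∂_{v_j} + v_j / 2)`. -/
def opB (γ : ℝ) (j : Fin d) (u : Phase d → ℂ) (z : Phase d) : ℂ :=
  (Real.sqrt γ : ℂ) * (dv j u z + (z.2 j : ℂ) / 2 * u z)

/-- `b_j^* = γ^{1/2} (-∂_{v_j} + v_j / 2)`. -/
def opBStar (γ : ℝ) (j : Fin d) (u : Phase d → ℂ) (z : Phase d) : ℂ :=
  (Real.sqrt γ : ℂ) * (-dv j u z + (z.2 j : ℂ) / 2 * u z)

/-- `Λ² - 1 = a^* a + b^* b`, as a differential expression. -/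
def lambdaSqSubOne (γ : ℝ) (V : Pos d → ℝ) (u : Phase d → ℂ) (z : Phase d) : ℂ :=
  ∑ j, opAStar γ V j (opA γ V j u) z + ∑ j, opBStar γ j (opB γ j u) z

/-- `Λ² = a^* a + b^* b + 1`, as a differential expression. -/
def lambdaSq (γ : ℝ) (V : Pos d → ℝ) (u : Phase d → ℂ) (z : Phase d) : ℂ :=
  lambdaSqSubOne γ V u z + u z

/-- `a^* b = ∑_j a_j^* b_j`, as a differential expression. -/
def opAStarB (γ : ℝ) (V : Pos d → ℝ) (u : Phase d → ℂ) (z : Phase d) : ℂ :=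
  ∑ j, opAStar γ V j (opB γ j u) z

/-- The graph of the closure in `L²` of an operator `T` given on the Schwartz space:
the closure in `L² × L²` of `{(u, T u) : u ∈ 𝓢}`. -/
def closedGraph (T : (Phase d → ℂ) → (Phase d → ℂ)) : Set (H d × H d) :=
  closure {p | ∃ u : 𝓢(Phase d, ℂ), p.1 =ᵐ[volume] u ∧ p.2 =ᵐ[volume] T u}

/-- `R` is the bounded inverse `(T - ζ)⁻¹` of the operator `T - ζ`, where `T` is the operator
with graph `G`: for all `f, g`, one has `f ∈ D(T)` and `T f = g` iff `R (g - ζ f) = f`. -/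
def IsResolvent (G : Set (H d × H d)) (ζ : ℂ) (R : H d →L[ℂ] H d) : Prop :=
  ∀ f g : H d, (f, g) ∈ G ↔ R (g - ζ • f) = f

/-- The spectrum of the (possibly unbounded) operator with graph `G`: the complex numbers `ζ`
for which `T - ζ` has no bounded everywhere defined inverse. -/
def graphSpectrum (G : Set (H d × H d)) : Set ℂ :=
  {ζ | ¬ ∃ R : H d →L[ℂ] H d, IsResolvent G ζ R}

/-- `α` is the spectral gap of (the closure of) `Λ² - 1`, and it is positive: `α > 0` is the
infimum of the spectrum with the lowest eigenvalue `0` removed. -/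
def HasSpectralGap (γ : ℝ) (V : Pos d → ℝ) (α : ℝ) : Prop :=
  0 < α ∧ IsGLB {t : ℝ | (t : ℂ) ∈ graphSpectrum (closedGraph (lambdaSqSubOne γ V)) ∧ t ≠ 0} α

/-- `L` is the bounded operator `Λ⁻² a^* b` on `L²`: the (necessarily unique) bounded operator
with `L u = Λ⁻² (a^* b u)` for Schwartz `u`, where `Λ⁻²` is the bounded inverse of the closure
of `Λ²`. -/
def IsAuxiliaryOperator (γ : ℝ) (V : Pos d → ℝ) (L : H d →L[ℂ] H d) : Prop :=
  ∃ R : H d →L[ℂ] H d, IsResolvent (closedGraph (lambdaSq γ V)) 0 R ∧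
    ∀ u : 𝓢(Phase d, ℂ), ∃ g : H d, g =ᵐ[volume] opAStarB γ V u ∧ L (u.toLp 2) = R g

/-- `u ⊥ 𝓜^{1/2}` in `L²`. -/
def OrthoMaxwellian (V : Pos d → ℝ) (u : Phase d → ℂ) : Prop :=
  ∫ z, u z * (Real.sqrt (maxwellian V z) : ℂ) = 0

end RelaxationBoltzmann

end

open RelaxationBoltzmann

/-! On Schwartz functions `X₀ = γ⁻¹ ∑ (b* a - a* b)` is antisymmetric, so with `f = Π₁ u` and `w = u
- f` one has `Re (Ku, u) = γ ‖w‖²`: the unmodified form controls only the microscopic part `w`. The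
correction `ε (L + L*)` recovers `f`. On the kernel of all `b_j`, `L` vanishes and `L X₀ = Λ⁻² ∑ a*
a = 1 - Λ⁻²`, so the form of `X₀` against `L + L*` is exactly `(f, (1 - Λ⁻²) f)` there
(`inner_X0_of_b_eq_zero`). Since `f ⊥ 𝓜^{1/2}`, the spectral gap bounds this below by `α/(1+α)
‖f‖²`.

The remaining terms involve `w` and are harmless because `[X₀, L]` is bounded (`exists_auxiliary`).
The reason is that `[X₀, Λ²]` and `[X₀, ∑ b* a]` are second-order expressions in the `a`, `b` and
their adjoints, with coefficients from the Hessian of `V`, and these are bounded relative to `Λ²`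
(`norm_c'c_le`). Only second and third derivatives of `V` enter. Taking `ε = r α`, with `r`
depending on `d, γ, M₂, M₃` only, the cross terms are absorbed (`hypocoercive_combination`) and a
multiple of `α² ‖u‖²` is left. Uniformity in `α` rests on `α ≤ γ` (`gap_le`), seen by testing the
gap on `b_j*` of a cut-off ground state.

No separate proof of essential self-adjointness is needed: the gap hypothesis puts `-1` in the
resolvent set of the closure of `Λ² - 1`, which gives both `Λ⁻²` and the density of `Λ² 𝓢`. All
operator identities are then checked on the core and extended by continuity. The gap becomes an
inequality for the bounded operator `Λ⁻²` through the functional calculus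
(`re_inner_le_of_spectrum`). The fixed vectors of `Λ⁻²` are multiples of `𝓜^{1/2}` by a
weak-gradient argument (`exists_eq_smul_groundState`). -/

open RelaxationBoltzmann

/-! ### Elliptic estimates for commuting annihilation operators -/

section Ladder

variable {S H : Type*} [AddCommGroup S] [Module ℂ S] [NormedAddCommGroup H]
  [InnerProductSpace ℂ H]

/-- A finite family of commuting annihilation operators `c i` on a space `S` mapped by `J` into a
Hilbert space, with formal adjoints `c' i` and bounded commutators `[c i, c' k] = W i k`. -/
structure LadderSystem (ι : Type*) [Fintype ι] (M : ℝ) (J : S →ₗ[ℂ] H) where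
  c : ι → Module.End ℂ S
  c' : ι → Module.End ℂ S
  W : ι → ι → Module.End ℂ S
  comm : ∀ i k, c i * c k = c k * c i
  ccr : ∀ i k, c i * c' k = c' k * c i + W i k
  adj : ∀ i u w, ⟪J (c i u), J w⟫_ℂ = ⟪J u, J (c' i w)⟫_ℂ
  bound : ∀ i k u, ‖J (W i k u)‖ ≤ M * ‖J u‖

namespace LadderSystem

variable {ι : Type*} [Fintype ι] {M : ℝ} {J : S →ₗ[ℂ] H} (T : LadderSystem ι M J)

/-- The number operator `∑ c* c`. -/
def num : Module.End ℂ S := ∑ i, T.c' i * T.c i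

/-- The operator `∑ c* c + 1`. -/
def lam : Module.End ℂ S := T.num + 1

lemma num_apply (u : S) : T.num u = ∑ i, T.c' i (T.c i u) := by
  simp [num, LinearMap.sum_apply]

lemma lam_apply (u : S) : T.lam u = T.num u + u := by simp [lam]

lemma adj' (i : ι) (u w : S) : ⟪J (T.c' i u), J w⟫_ℂ = ⟪J u, J (T.c i w)⟫_ℂ := by
  rw [← inner_conj_symm, ← T.adj, inner_conj_symm]

lemma inner_num (u w : S) : ⟪J (T.num u), J w⟫_ℂ = ∑ i, ⟪J (T.c i u), J (T.c i w)⟫_ℂ := by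
  rw [num_apply, map_sum, sum_inner]
  exact Finset.sum_congr rfl fun i _ => T.adj' i _ _

lemma inner_num_right (u w : S) :
    ⟪J u, J (T.num w)⟫_ℂ = ∑ i, ⟪J (T.c i u), J (T.c i w)⟫_ℂ := by
  rw [num_apply, map_sum, inner_sum]
  exact Finset.sum_congr rfl fun i _ => (T.adj i _ _).symm

lemma re_inner_num_self (u : S) :
    (⟪J (T.num u), J u⟫_ℂ).re = ∑ i, ‖J (T.c i u)‖ ^ 2 := by
  rw [inner_num, Complex.re_sum]
  exact Finset.sum_congr rfl fun i _ => inner_self_eq_norm_sq (𝕜 := ℂ) _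

lemma re_inner_lam_self (u : S) :
    (⟪J (T.lam u), J u⟫_ℂ).re = ∑ i, ‖J (T.c i u)‖ ^ 2 + ‖J u‖ ^ 2 := by
  rw [lam_apply, map_add, inner_add_left, Complex.add_re, re_inner_num_self]
  congr 1
  exact inner_self_eq_norm_sq (𝕜 := ℂ) _

/-- The form of `∑ c* c + 1` dominates the squared norm; Cauchy–Schwarz does the rest. -/
lemma norm_le_norm_lam (u : S) : ‖J u‖ ≤ ‖J (T.lam u)‖ := by
  have h1 := T.re_inner_lam_self u
  have h2 : (⟪J (T.lam u), J u⟫_ℂ).re ≤ ‖J (T.lam u)‖ * ‖J u‖ := re_inner_le_norm (𝕜 := ℂ) _ _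
  have h3 : 0 ≤ ∑ i, ‖J (T.c i u)‖ ^ 2 := Finset.sum_nonneg fun i _ => by positivity
  by_contra! h
  nlinarith [norm_nonneg (J u), norm_nonneg (J (T.lam u))]

lemma norm_c_le (i : ι) (u : S) : ‖J (T.c i u)‖ ≤ ‖J (T.lam u)‖ := by
  have h1 := T.re_inner_lam_self u
  have h2 : (⟪J (T.lam u), J u⟫_ℂ).re ≤ ‖J (T.lam u)‖ * ‖J u‖ := re_inner_le_norm (𝕜 := ℂ) _ _
  have h3 : ‖J (T.c i u)‖ ^ 2 ≤ ∑ i, ‖J (T.c i u)‖ ^ 2 :=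
    Finset.single_le_sum (f := fun i => ‖J (T.c i u)‖ ^ 2) (fun i _ => by positivity)
      (Finset.mem_univ i)
  have h4 := T.norm_le_norm_lam u
  refine le_of_sq_le_sq ?_ (norm_nonneg _)
  nlinarith [norm_nonneg (J u), norm_nonneg (J (T.lam u))]

/-- Since `c k` commutes with every `c i`, moving it through `c' i * c i` costs only the commutator
with `c' i`. -/
lemma c_num (k : ι) (u : S) :
    T.num (T.c k u) = T.c k (T.num u) - ∑ i, T.W k i (T.c i u) := by
  rw [num_apply, num_apply, map_sum, ← Finset.sum_sub_distrib]
  refine Finset.sum_congr rfl fun i _ => ?_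
  have h1 := LinearMap.congr_fun (T.ccr k i) (T.c i u)
  have h2 := LinearMap.congr_fun (T.comm i k) u
  simp only [Module.End.mul_apply, LinearMap.add_apply] at h1 h2
  rw [h1, h2]; abel

/-- The elliptic estimate for `c c`. -/
lemma sum_norm_cc_sq_le (hM : 0 ≤ M) (u : S) :
    ∑ k, ∑ i, ‖J (T.c i (T.c k u))‖ ^ 2 ≤
      (4 + (Fintype.card ι : ℝ) ^ 2 * M) * ‖J (T.lam u)‖ ^ 2 := by
  -- The inner sum is the form of the number operator at `c k u`; commuting that operator past `c k`
  -- and summing over `k` produces `‖N u‖²` and bounded lower-order terms.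
  have e1 : ∑ k, ∑ i, ‖J (T.c i (T.c k u))‖ ^ 2 =
      ‖J (T.num u)‖ ^ 2 - ∑ k, ∑ i, (⟪J (T.W k i (T.c i u)), J (T.c k u)⟫_ℂ).re := by
    have : ∀ k, ∑ i, ‖J (T.c i (T.c k u))‖ ^ 2 = (⟪J (T.c k (T.num u)), J (T.c k u)⟫_ℂ).re -
        ∑ i, (⟪J (T.W k i (T.c i u)), J (T.c k u)⟫_ℂ).re := by
      intro k
      rw [← re_inner_num_self, c_num, map_sub, map_sum, inner_sub_left, sum_inner, Complex.sub_re,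
        Complex.re_sum]
    rw [Finset.sum_congr rfl fun k _ => this k, Finset.sum_sub_distrib, ← Complex.re_sum,
      ← T.inner_num_right]
    congr 1
    exact inner_self_eq_norm_sq (𝕜 := ℂ) _
  have e2 : ∀ k i, -(⟪J (T.W k i (T.c i u)), J (T.c k u)⟫_ℂ).re ≤ M * ‖J (T.lam u)‖ ^ 2 := by
    intro k i
    have h1 : -(⟪J (T.W k i (T.c i u)), J (T.c k u)⟫_ℂ).re ≤
        ‖J (T.W k i (T.c i u))‖ * ‖J (T.c k u)‖ :=
      (neg_le_abs _).trans ((Complex.abs_re_le_norm _).trans (norm_inner_le_norm _ _))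
    calc _ ≤ _ := h1
      _ ≤ (M * ‖J (T.lam u)‖) * ‖J (T.lam u)‖ := by
        gcongr
        · exact (T.bound k i _).trans (by gcongr; exact T.norm_c_le i u)
        · exact T.norm_c_le k u
      _ = _ := by ring
  have e3 : -∑ k, ∑ i, (⟪J (T.W k i (T.c i u)), J (T.c k u)⟫_ℂ).re ≤
      (Fintype.card ι : ℝ) ^ 2 * M * ‖J (T.lam u)‖ ^ 2 := by
    simp only [← Finset.sum_neg_distrib]
    refine (Finset.sum_le_sum fun k _ => Finset.sum_le_sum fun i _ => e2 k i).trans (le_of_eq ?_)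
    simp [Finset.sum_const]; ring
  have e4 : ‖J (T.num u)‖ ≤ 2 * ‖J (T.lam u)‖ := by
    have : T.num u = T.lam u - u := by rw [lam_apply]; abel
    rw [this, map_sub]
    linarith [norm_sub_le (J (T.lam u)) (J u), T.norm_le_norm_lam u]
  rw [e1]
  nlinarith [norm_nonneg (J (T.num u)), norm_nonneg (J (T.lam u))]

/-- Expand `‖c* u‖² = ⟪c c* u, u⟫` and exchange `c` and `c*`. This passes from the estimate for `c
c` to the one for `c* c`. -/
lemma norm_c'_sq_le (i : ι) (u : S) :
    ‖J (T.c' i u)‖ ^ 2 ≤ ‖J (T.c i u)‖ ^ 2 + M * ‖J u‖ ^ 2 := by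
  have h1 : ‖J (T.c' i u)‖ ^ 2 = (⟪J (T.c i (T.c' i u)), J u⟫_ℂ).re := by
    rw [T.adj]; exact (inner_self_eq_norm_sq (𝕜 := ℂ) _).symm
  have h2 := LinearMap.congr_fun (T.ccr i i) u
  simp only [Module.End.mul_apply, LinearMap.add_apply] at h2
  have h3 : (⟪J (T.c i u), J (T.c i u)⟫_ℂ).re = ‖J (T.c i u)‖ ^ 2 :=
    inner_self_eq_norm_sq (𝕜 := ℂ) _
  have h4 : (⟪J (T.W i i u), J u⟫_ℂ).re ≤ ‖J (T.W i i u)‖ * ‖J u‖ := re_inner_le_norm (𝕜 := ℂ) _ _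
  rw [h1, h2, map_add, inner_add_left, Complex.add_re, T.adj', h3]
  nlinarith [norm_nonneg (J u), T.bound i i u]

/-- The elliptic estimate for `c* c`. -/
lemma norm_c'c_le (hM : 0 ≤ M) (i k : ι) (u : S) :
    ‖J (T.c' i (T.c k u))‖ ≤ (4 + (Fintype.card ι : ℝ) ^ 2 * M + M) * ‖J (T.lam u)‖ := by
  have h1 : ‖J (T.c i (T.c k u))‖ ^ 2 ≤ ∑ k, ∑ i, ‖J (T.c i (T.c k u))‖ ^ 2 :=
    (Finset.single_le_sum (f := fun i => ‖J (T.c i (T.c k u))‖ ^ 2) (fun i _ => by positivity)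
      (Finset.mem_univ i)).trans
    (Finset.single_le_sum (f := fun k => ∑ i, ‖J (T.c i (T.c k u))‖ ^ 2)
      (fun i _ => Finset.sum_nonneg fun i _ => by positivity) (Finset.mem_univ k))
  have h2 := T.sum_norm_cc_sq_le hM u
  have h3 := T.norm_c'_sq_le i (T.c k u)
  have h4 : ‖J (T.c k u)‖ ^ 2 ≤ ‖J (T.lam u)‖ ^ 2 := by gcongr; exact T.norm_c_le k u
  set C := 4 + (Fintype.card ι : ℝ) ^ 2 * M + M with hC
  have hC1 : 1 ≤ C := by
    have : 0 ≤ (Fintype.card ι : ℝ) ^ 2 * M := by positivity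
    linarith
  refine le_of_sq_le_sq ?_ (by positivity)
  have h5 : ‖J (T.c' i (T.c k u))‖ ^ 2 ≤ C * ‖J (T.lam u)‖ ^ 2 := by nlinarith
  have : C * ‖J (T.lam u)‖ ^ 2 ≤ C ^ 2 * ‖J (T.lam u)‖ ^ 2 := by
    gcongr; nlinarith
  linarith [mul_pow C ‖J (T.lam u)‖ 2]

end LadderSystem

end Ladder

/-! ### Algebra of the `a_j`, `b_j` and their commutators with `X₀` -/

section Kinetic

variable {S H : Type*} [AddCommGroup S] [Module ℂ S] [NormedAddCommGroup H]
  [InnerProductSpace ℂ H]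

/-- The algebraic and metric properties of the operators `a_j`, `b_j`, of their formal adjoints
and of multiplication by the Hessian of the potential, on a core `S` mapped by `J` to `H`. -/
structure KineticSystem (d : ℕ) (γ M M' : ℝ) (J : S →ₗ[ℂ] H) where
  a : Fin d → Module.End ℂ S
  a' : Fin d → Module.End ℂ S
  b : Fin d → Module.End ℂ S
  b' : Fin d → Module.End ℂ S
  V : Fin d → Fin d → Module.End ℂ S
  aa : ∀ j k u, a j (a k u) = a k (a j u)
  a'a' : ∀ j k u, a' j (a' k u) = a' k (a' j u)
  bb : ∀ j k u, b j (b k u) = b k (b j u)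
  b'b' : ∀ j k u, b' j (b' k u) = b' k (b' j u)
  ab : ∀ j k u, a j (b k u) = b k (a j u)
  ab' : ∀ j k u, a j (b' k u) = b' k (a j u)
  a'b : ∀ j k u, a' j (b k u) = b k (a' j u)
  a'b' : ∀ j k u, a' j (b' k u) = b' k (a' j u)
  ccrA : ∀ j k u, a j (a' k u) = a' k (a j u) + (γ : ℂ) • V j k u
  ccrB : ∀ j k u, b j (b' k u) = b' k (b j u) + if j = k then (γ : ℂ) • u else 0
  b'V : ∀ j k l u, b' j (V k l u) = V k l (b' j u)
  adjA : ∀ j u w, ⟪J (a j u), J w⟫_ℂ = ⟪J u, J (a' j w)⟫_ℂ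
  adjB : ∀ j u w, ⟪J (b j u), J w⟫_ℂ = ⟪J u, J (b' j w)⟫_ℂ
  boundV : ∀ j k u, ‖J (V j k u)‖ ≤ M * ‖J u‖
  boundComm : ∀ j k l u, ‖J (a' j (V k l u)) - J (V k l (a' j u))‖ ≤ M' * ‖J u‖

namespace KineticSystem

variable {d : ℕ} {γ M M' : ℝ} {J : S →ₗ[ℂ] H} (T : KineticSystem d γ M M' J)

/-- The ladder system formed by all `a_j` and `b_j`. -/
def ladder (hγ : 0 < γ) (hM : 0 ≤ M) : LadderSystem (Fin d ⊕ Fin d) (γ * (M + 1)) J where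
  c := Sum.elim T.a T.b
  c' := Sum.elim T.a' T.b'
  W := Sum.elim (fun j => Sum.elim (fun k => (γ : ℂ) • T.V j k) fun _ => 0)
    (fun j => Sum.elim (fun _ => 0) fun k => if j = k then (γ : ℂ) • 1 else 0)
  comm := by
    rintro (i | i) (k | k) <;> ext u
    · exact T.aa _ _ _
    · exact T.ab _ _ _
    · exact (T.ab _ _ _).symm
    · exact T.bb _ _ _
  ccr := by
    rintro (i | i) (k | k) <;> ext u
    · exact T.ccrA _ _ _
    · simpa using T.ab' _ _ _
    · simpa using (T.a'b _ _ _).symm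
    · simp only [Sum.elim_inr, Module.End.mul_apply, LinearMap.add_apply, T.ccrB]
      split_ifs <;> simp
  adj := by
    rintro (i | i)
    · exact T.adjA i
    · exact T.adjB i
  -- The constant `γ (M + 1)` covers both kinds of nonzero commutator, `γ` times a Hessian entry and
  -- `γ` times the identity.
  bound := by
    have h0 : ∀ u, 0 ≤ γ * (M + 1) * ‖J u‖ := fun u => by positivity
    rintro (i | i) (k | k) u
    · simp only [Sum.elim_inl, LinearMap.smul_apply, map_smul, norm_smul, Complex.norm_real,
        Real.norm_eq_abs, abs_of_pos hγ]
      nlinarith [T.boundV i k u, norm_nonneg (J u), mul_nonneg hγ.le (norm_nonneg (J u)),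
        mul_le_mul_of_nonneg_left (T.boundV i k u) hγ.le]
    · simpa using h0 u
    · simpa using h0 u
    · simp only [Sum.elim_inr]
      split_ifs
      · simp only [LinearMap.smul_apply, map_smul, norm_smul, Complex.norm_real,
          Real.norm_eq_abs, abs_of_pos hγ, Module.End.one_apply]
        nlinarith [mul_nonneg hγ.le (norm_nonneg (J u)),
          mul_nonneg (mul_nonneg hγ.le hM) (norm_nonneg (J u))]
      · simpa using h0 u

/-- `Λ² = ∑ a* a + ∑ b* b + 1`. -/
def lam : Module.End ℂ S := ∑ j, T.a' j * T.a j + ∑ j, T.b' j * T.b j + 1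

/-- `X₀ = γ⁻¹ ∑ (b* a - a* b)`. -/
noncomputable def X0 : Module.End ℂ S := (γ⁻¹ : ℂ) • ∑ j, (T.b' j * T.a j - T.a' j * T.b j)

/-- `∑ a* b`. -/
def Y : Module.End ℂ S := ∑ j, T.a' j * T.b j

/-- `∑ b* a`. -/
def Y' : Module.End ℂ S := ∑ j, T.b' j * T.a j

lemma lam_apply (u : S) :
    T.lam u = ∑ j, T.a' j (T.a j u) + ∑ j, T.b' j (T.b j u) + u := by
  simp [lam, LinearMap.sum_apply]

lemma X0_apply (u : S) :
    T.X0 u = (γ⁻¹ : ℂ) • ∑ j, (T.b' j (T.a j u) - T.a' j (T.b j u)) := by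
  simp [X0, LinearMap.sum_apply]

lemma Y_apply (u : S) : T.Y u = ∑ j, T.a' j (T.b j u) := by simp [Y, LinearMap.sum_apply]

lemma Y'_apply (u : S) : T.Y' u = ∑ j, T.b' j (T.a j u) := by simp [Y', LinearMap.sum_apply]

lemma X0_eq (u : S) : T.X0 u = (γ⁻¹ : ℂ) • (T.Y' u - T.Y u) := by
  rw [X0_apply, Y_apply, Y'_apply, Finset.sum_sub_distrib]

lemma ladder_lam (hγ : 0 < γ) (hM : 0 ≤ M) : (T.ladder hγ hM).lam = T.lam := by
  simp [LadderSystem.lam, LadderSystem.num, lam, ladder]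

lemma adjA' (j : Fin d) (u w : S) : ⟪J (T.a' j u), J w⟫_ℂ = ⟪J u, J (T.a j w)⟫_ℂ := by
  rw [← inner_conj_symm, ← T.adjA, inner_conj_symm]

lemma adjB' (j : Fin d) (u w : S) : ⟪J (T.b' j u), J w⟫_ℂ = ⟪J u, J (T.b j w)⟫_ℂ := by
  rw [← inner_conj_symm, ← T.adjB, inner_conj_symm]

lemma adjY (u w : S) : ⟪J (T.Y u), J w⟫_ℂ = ⟪J u, J (T.Y' w)⟫_ℂ := by
  simp only [Y_apply, Y'_apply, map_sum, sum_inner, inner_sum]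
  exact Finset.sum_congr rfl fun j _ => by rw [T.adjA', T.adjB]

lemma adjY' (u w : S) : ⟪J (T.Y' u), J w⟫_ℂ = ⟪J u, J (T.Y w)⟫_ℂ := by
  rw [← inner_conj_symm, ← T.adjY, inner_conj_symm]

lemma adjX0 (u w : S) : ⟪J (T.X0 u), J w⟫_ℂ = -⟪J u, J (T.X0 w)⟫_ℂ := by
  simp only [X0_eq, map_smul, map_sub, inner_smul_left, inner_smul_right, inner_sub_left,
    inner_sub_right, adjY, adjY', map_inv₀, Complex.conj_ofReal]
  ring

lemma lam_symm (u w : S) : ⟪J (T.lam u), J w⟫_ℂ = ⟪J u, J (T.lam w)⟫_ℂ := by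
  simp only [lam_apply, map_add, map_sum, inner_add_left, inner_add_right, sum_inner, inner_sum,
    adjA', adjB', adjA, adjB]

lemma re_inner_X0_self (u : S) : (⟪J (T.X0 u), J u⟫_ℂ).re = 0 := by
  have h := congrArg Complex.re (T.adjX0 u u)
  rw [← inner_conj_symm (J u), Complex.neg_re, Complex.conj_re] at h
  linarith

lemma re_inner_lam_self (u : S) :
    (⟪J (T.lam u), J u⟫_ℂ).re =
      ∑ j, ‖J (T.a j u)‖ ^ 2 + ∑ j, ‖J (T.b j u)‖ ^ 2 + ‖J u‖ ^ 2 := by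
  have h : ∀ x : H, (⟪x, x⟫_ℂ).re = ‖x‖ ^ 2 := fun x => inner_self_eq_norm_sq (𝕜 := ℂ) _
  simp only [lam_apply, map_add, map_sum, inner_add_left, sum_inner, adjA', adjB', Complex.add_re,
    Complex.re_sum, h]

section Commutators

variable (hγ : 0 < γ)
include hγ

/-- Among the summands of `X₀` only `a' j * b j` fails to commute with `a k`, and `[a k, a' j]` is a
Hessian entry. -/
lemma X0_a (k : Fin d) (u : S) :
    T.X0 (T.a k u) = T.a k (T.X0 u) + ∑ j, T.V k j (T.b j u) := by
  have hγ' : (γ : ℂ) ≠ 0 := by exact_mod_cast hγ.ne'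
  have h : ∑ j, T.V k j (T.b j u) = (γ⁻¹ : ℂ) • ∑ j, (γ : ℂ) • T.V k j (T.b j u) := by
    rw [← Finset.smul_sum, smul_smul, inv_mul_cancel₀ hγ', one_smul]
  rw [h, X0_apply, X0_apply, map_smul, map_sum, ← smul_add, ← Finset.sum_add_distrib]
  congr 1
  refine Finset.sum_congr rfl fun j _ => ?_
  rw [map_sub, T.aa j k, T.ab' k j, T.ccrA k j, T.ab k j]
  abel

/-- Only `b' k * a k` contributes. The commutator turns velocity derivatives into space derivatives,
which is the source of hypocoercivity. -/
lemma X0_b (k : Fin d) (u : S) : T.X0 (T.b k u) = T.b k (T.X0 u) - T.a k u := by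
  have hγ' : (γ : ℂ) ≠ 0 := by exact_mod_cast hγ.ne'
  have h : T.a k u = (γ⁻¹ : ℂ) • ∑ j, if k = j then (γ : ℂ) • T.a j u else 0 := by
    rw [Finset.sum_ite_eq, if_pos (Finset.mem_univ _), smul_smul, inv_mul_cancel₀ hγ', one_smul]
  rw [h, X0_apply, X0_apply, map_smul, map_sum, ← smul_sub, ← Finset.sum_sub_distrib]
  congr 1
  refine Finset.sum_congr rfl fun j _ => ?_
  rw [map_sub, T.ccrB k j, ← T.a'b j k, T.bb k j, T.ab j k]
  abel

lemma X0_a' (k : Fin d) (u : S) :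
    T.X0 (T.a' k u) = T.a' k (T.X0 u) + ∑ j, T.V j k (T.b' j u) := by
  have hγ' : (γ : ℂ) ≠ 0 := by exact_mod_cast hγ.ne'
  have h : ∑ j, T.V j k (T.b' j u) = (γ⁻¹ : ℂ) • ∑ j, (γ : ℂ) • T.V j k (T.b' j u) := by
    rw [← Finset.smul_sum, smul_smul, inv_mul_cancel₀ hγ', one_smul]
  rw [h, X0_apply, X0_apply, map_smul, map_sum, ← smul_add, ← Finset.sum_add_distrib]
  congr 1
  refine Finset.sum_congr rfl fun j _ => ?_
  rw [map_sub, T.ccrA j k, map_add, map_smul, T.b'V, ← T.a'b k j, T.a'a' j k, T.a'b' k j]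
  abel

lemma X0_b' (k : Fin d) (u : S) : T.X0 (T.b' k u) = T.b' k (T.X0 u) - T.a' k u := by
  have hγ' : (γ : ℂ) ≠ 0 := by exact_mod_cast hγ.ne'
  have h : T.a' k u = (γ⁻¹ : ℂ) • ∑ j, if j = k then (γ : ℂ) • T.a' j u else 0 := by
    rw [Finset.sum_ite_eq', if_pos (Finset.mem_univ _), smul_smul, inv_mul_cancel₀ hγ', one_smul]
  rw [h, X0_apply, X0_apply, map_smul, map_sum, ← smul_sub, ← Finset.sum_sub_distrib]
  congr 1
  refine Finset.sum_congr rfl fun j _ => ?_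
  rw [map_sub, T.ccrB j k, map_add, T.ab' j k, T.b'b' j k, T.a'b' j k]
  split_ifs <;> simp only [map_smul, map_zero] <;> abel

/-- The commutator `[X₀, ∑ b* a]`. -/
lemma X0_Y' (u : S) : T.X0 (T.Y' u) - T.Y' (T.X0 u) =
    ∑ k, ∑ j, T.V k j (T.b' k (T.b j u)) - ∑ k, T.a' k (T.a k u) := by
  rw [Y'_apply, Y'_apply, map_sum, ← Finset.sum_sub_distrib, ← Finset.sum_sub_distrib]
  refine Finset.sum_congr rfl fun k _ => ?_
  rw [T.X0_b' hγ, T.X0_a hγ, map_add, map_sum]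
  simp only [T.b'V]
  abel

/-- The commutator `[X₀, Λ²]`. -/
lemma X0_lam (u : S) : T.X0 (T.lam u) - T.lam (T.X0 u) =
    ∑ k, ∑ j, T.V j k (T.b' j (T.a k u)) + ∑ k, ∑ j, T.a' k (T.V k j (T.b j u))
      - T.Y u - T.Y' u := by
  rw [lam_apply, lam_apply, Y_apply, Y'_apply, map_add, map_add, map_sum, map_sum]
  simp only [T.X0_a' hγ, T.X0_b' hγ, T.X0_a hγ, T.X0_b hγ, map_add, map_sub, map_sum,
    Finset.sum_add_distrib, Finset.sum_sub_distrib]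
  abel

end Commutators

end KineticSystem

end Kinetic

/-! ### Quantitative bounds for the commutators relative to `Λ²` -/

section Kinetic

/-- The constant of the elliptic estimate for the second-order operators. -/
noncomputable def ellipticConst (d : ℕ) (γ M : ℝ) : ℝ :=
  4 + (2 * (d : ℝ)) ^ 2 * (γ * (M + 1)) + γ * (M + 1)

/-- The bound for the commutator of `X₀` with the auxiliary operator. -/
noncomputable def commConst (d : ℕ) (γ M M' : ℝ) : ℝ :=
  ((d : ℝ) ^ 2 * M + d) * ellipticConst d γ M +
    ((d : ℝ) ^ 2 * M * ellipticConst d γ M + (d : ℝ) ^ 2 * (M' + M * ellipticConst d γ M)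
      + d * ellipticConst d γ M + d * ellipticConst d γ M) * (d * ellipticConst d γ M)

lemma ellipticConst_nonneg (d : ℕ) {γ M : ℝ} (hγ : 0 < γ) (hM : 0 ≤ M) :
    0 ≤ ellipticConst d γ M := by
  unfold ellipticConst; positivity

lemma commConst_nonneg (d : ℕ) {γ M M' : ℝ} (hγ : 0 < γ) (hM : 0 ≤ M) (hM' : 0 ≤ M') :
    0 ≤ commConst d γ M M' := by
  have := ellipticConst_nonneg d hγ hM
  unfold commConst; positivity

variable {S H : Type*} [AddCommGroup S] [Module ℂ S] [NormedAddCommGroup H]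
  [InnerProductSpace ℂ H]

omit [InnerProductSpace ℂ H] in
lemma norm_sum_le_card_mul {d : ℕ} (f : Fin d → H) {C : ℝ} (h : ∀ j, ‖f j‖ ≤ C) :
    ‖∑ j, f j‖ ≤ d * C := by
  simpa using norm_sum_le_of_le (Finset.univ : Finset (Fin d)) fun j _ => h j

namespace KineticSystem

variable {d : ℕ} {γ M M' : ℝ} {J : S →ₗ[ℂ] H} (T : KineticSystem d γ M M' J)
variable (hγ : 0 < γ) (hM : 0 ≤ M)
include hγ hM

lemma norm_b_le (j : Fin d) (u : S) : ‖J (T.b j u)‖ ≤ ‖J (T.lam u)‖ := by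
  rw [← T.ladder_lam hγ hM]; exact (T.ladder hγ hM).norm_c_le (Sum.inr j) u

lemma norm_c'c_le (i k : Fin d ⊕ Fin d) (u : S) :
    ‖J ((T.ladder hγ hM).c' i ((T.ladder hγ hM).c k u))‖ ≤
      ellipticConst d γ M * ‖J (T.lam u)‖ := by
  rw [← T.ladder_lam hγ hM]
  convert (T.ladder hγ hM).norm_c'c_le (by positivity) i k u using 2
  simp [ellipticConst, two_mul]

lemma norm_a'a_le (j k : Fin d) (u : S) :
    ‖J (T.a' j (T.a k u))‖ ≤ ellipticConst d γ M * ‖J (T.lam u)‖ :=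
  T.norm_c'c_le hγ hM (Sum.inl j) (Sum.inl k) u

lemma norm_a'b_le (j k : Fin d) (u : S) :
    ‖J (T.a' j (T.b k u))‖ ≤ ellipticConst d γ M * ‖J (T.lam u)‖ :=
  T.norm_c'c_le hγ hM (Sum.inl j) (Sum.inr k) u

lemma norm_b'a_le (j k : Fin d) (u : S) :
    ‖J (T.b' j (T.a k u))‖ ≤ ellipticConst d γ M * ‖J (T.lam u)‖ :=
  T.norm_c'c_le hγ hM (Sum.inr j) (Sum.inl k) u

lemma norm_b'b_le (j k : Fin d) (u : S) :
    ‖J (T.b' j (T.b k u))‖ ≤ ellipticConst d γ M * ‖J (T.lam u)‖ :=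
  T.norm_c'c_le hγ hM (Sum.inr j) (Sum.inr k) u

lemma norm_Y_le (u : S) : ‖J (T.Y u)‖ ≤ d * ellipticConst d γ M * ‖J (T.lam u)‖ := by
  rw [Y_apply, map_sum, mul_assoc]
  exact norm_sum_le_card_mul _ fun j => T.norm_a'b_le hγ hM j j u

lemma norm_Y'_le (u : S) : ‖J (T.Y' u)‖ ≤ d * ellipticConst d γ M * ‖J (T.lam u)‖ := by
  rw [Y'_apply, map_sum, mul_assoc]
  exact norm_sum_le_card_mul _ fun j => T.norm_b'a_le hγ hM j j u

lemma exists_norm_X0_le : ∃ C, ∀ u, ‖J (T.X0 u)‖ ≤ C * ‖J (T.lam u)‖ := by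
  refine ⟨γ⁻¹ * (d * ellipticConst d γ M + d * ellipticConst d γ M), fun u => ?_⟩
  rw [X0_eq, map_smul, norm_smul, map_sub, norm_inv, Complex.norm_real, Real.norm_eq_abs,
    abs_of_pos hγ, mul_assoc, add_mul]
  gcongr
  exact (norm_sub_le _ _).trans (add_le_add (T.norm_Y'_le hγ hM u) (T.norm_Y_le hγ hM u))

lemma norm_comm_Y'_le (u : S) : ‖J (T.X0 (T.Y' u)) - J (T.Y' (T.X0 u))‖ ≤
    ((d : ℝ) ^ 2 * M + d) * ellipticConst d γ M * ‖J (T.lam u)‖ := by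
  rw [← map_sub, T.X0_Y' hγ, map_sub]
  refine (norm_sub_le _ _).trans ?_
  have h1 : ‖J (∑ k, ∑ j, T.V k j (T.b' k (T.b j u)))‖ ≤
      d * (d * (M * (ellipticConst d γ M * ‖J (T.lam u)‖))) := by
    simp only [map_sum]
    refine norm_sum_le_card_mul _ fun k => norm_sum_le_card_mul _ fun j => ?_
    exact (T.boundV _ _ _).trans (by gcongr; exact T.norm_b'b_le hγ hM _ _ _)
  have h2 : ‖J (∑ k, T.a' k (T.a k u))‖ ≤ d * (ellipticConst d γ M * ‖J (T.lam u)‖) := by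
    rw [map_sum]
    exact norm_sum_le_card_mul _ fun k => T.norm_a'a_le hγ hM _ _ _
  refine (add_le_add h1 h2).trans (le_of_eq ?_)
  ring

lemma norm_comm_lam_le (hM' : 0 ≤ M') (u : S) : ‖J (T.X0 (T.lam u)) - J (T.lam (T.X0 u))‖ ≤
    ((d : ℝ) ^ 2 * M * ellipticConst d γ M + (d : ℝ) ^ 2 * (M' + M * ellipticConst d γ M)
      + d * ellipticConst d γ M + d * ellipticConst d γ M) * ‖J (T.lam u)‖ := by
  rw [← map_sub, T.X0_lam hγ, map_sub, map_sub, map_add]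
  have h1 : ‖J (∑ k, ∑ j, T.V j k (T.b' j (T.a k u)))‖ ≤
      d * (d * (M * (ellipticConst d γ M * ‖J (T.lam u)‖))) := by
    simp only [map_sum]
    refine norm_sum_le_card_mul _ fun k => norm_sum_le_card_mul _ fun j => ?_
    exact (T.boundV _ _ _).trans (by gcongr; exact T.norm_b'a_le hγ hM _ _ _)
  have h2 : ‖J (∑ k, ∑ j, T.a' k (T.V k j (T.b j u)))‖ ≤
      d * (d * ((M' + M * ellipticConst d γ M) * ‖J (T.lam u)‖)) := by
    simp only [map_sum]
    refine norm_sum_le_card_mul _ fun k => norm_sum_le_card_mul _ fun j => ?_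
    -- The elliptic estimate applies once `a' k` stands directly before `b j`. Moving it past the
    -- Hessian entry is where third derivatives of the potential enter, through `M'`.
    have e1 := T.boundComm k k j (T.b j u)
    have e2 : M' * ‖J (T.b j u)‖ ≤ M' * ‖J (T.lam u)‖ := by
      gcongr; exact T.norm_b_le hγ hM _ _
    have e3 := T.boundV k j (T.a' k (T.b j u))
    have e4 : M * ‖J (T.a' k (T.b j u))‖ ≤ M * (ellipticConst d γ M * ‖J (T.lam u)‖) := by
      gcongr; exact T.norm_a'b_le hγ hM _ _ _
    have e5 := norm_add_le (J (T.a' k (T.V k j (T.b j u))) - J (T.V k j (T.a' k (T.b j u))))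
      (J (T.V k j (T.a' k (T.b j u))))
    rw [sub_add_cancel] at e5
    linarith
  have h3 := T.norm_Y_le hγ hM u
  have h4 := T.norm_Y'_le hγ hM u
  refine (norm_sub_le _ _).trans ?_
  refine (add_le_add_left (norm_sub_le _ _) _).trans ?_
  refine (add_le_add_left (add_le_add_left (norm_add_le _ _) _) _).trans ?_
  refine (add_le_add (add_le_add (add_le_add h1 h2) h3) h4).trans (le_of_eq ?_)
  ring

end KineticSystem

omit [AddCommGroup S] [Module ℂ S] in
/-- A vector is bounded through its pairings with a dense set. -/
lemma norm_le_of_inner_dense {e : S → H} (he : DenseRange e) {v : H} {C : ℝ} (hC : 0 ≤ C)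
    (h : ∀ u, ‖⟪e u, v⟫_ℂ‖ ≤ C * ‖e u‖) : ‖v‖ ≤ C := by
  have h1 : ‖⟪v, v⟫_ℂ‖ ≤ C * ‖v‖ :=
    he.induction_on (p := fun x => ‖⟪x, v⟫_ℂ‖ ≤ C * ‖x‖) v
      (isClosed_le (by fun_prop) (by fun_prop)) h
  rw [inner_self_eq_norm_sq_to_K, norm_pow] at h1
  simp only [Complex.coe_algebraMap, Complex.norm_real, norm_norm] at h1
  by_contra! hv
  nlinarith

end Kinetic

/-! ### The auxiliary operator and the form of `X₀` against `L + L*` -/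

section Kinetic

variable {S H : Type*} [AddCommGroup S] [Module ℂ S] [NormedAddCommGroup H]
  [InnerProductSpace ℂ H] [CompleteSpace H]

namespace KineticSystem

variable {d : ℕ} {γ M M' : ℝ} {J : S →ₗ[ℂ] H} (T : KineticSystem d γ M M' J)
  {R : H →L[ℂ] H}

open ContinuousLinearMap in
/-- The operator `Λ⁻² ∑ a* b` extends to a bounded operator `L`, and the commutator of `X₀` with
`L` is bounded. -/
theorem exists_auxiliary (hγ : 0 < γ) (hM : 0 ≤ M) (hM' : 0 ≤ M')
    (hR : ∀ u, R (J (T.lam u)) = J u) (hd : DenseRange fun u => J (T.lam u)) :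
    ∃ L : H →L[ℂ] H, ‖L‖ ≤ d * ellipticConst d γ M ∧ (∀ u, L (J u) = R (J (T.Y u))) ∧
      ∀ u w, ‖⟪J (T.X0 u), L (J w)⟫_ℂ + ⟪L.adjoint (J u), J (T.X0 w)⟫_ℂ‖ ≤
        commConst d γ M M' * ‖J u‖ * ‖J w‖ := by
  have hK := ellipticConst_nonneg d hγ hM
  have hd' : DenseRange (J ∘ₗ T.lam) := hd
  have hB0 : ∀ u, ‖(J ∘ₗ T.Y') u‖ ≤ d * ellipticConst d γ M * ‖(J ∘ₗ T.lam) u‖ :=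
    T.norm_Y'_le hγ hM
  obtain ⟨CX, hCX⟩ := T.exists_norm_X0_le hγ hM
  have hZ0 : ∃ C, ∀ u, ‖(J ∘ₗ T.X0) u‖ ≤ C * ‖(J ∘ₗ T.lam) u‖ := ⟨CX, hCX⟩
  -- `B` and `Z` are the bounded extensions of `(∑ b* a) Λ⁻²` and `X₀ Λ⁻²`, defined on the dense set
  -- `Λ² S`. The operator `L` will be the adjoint of `B`.
  set B : H →L[ℂ] H := (J ∘ₗ T.Y').extendOfNorm (J ∘ₗ T.lam) with hBdef
  set Z : H →L[ℂ] H := (J ∘ₗ T.X0).extendOfNorm (J ∘ₗ T.lam) with hZdef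
  have hB : ∀ u, B (J (T.lam u)) = J (T.Y' u) := LinearMap.extendOfNorm_eq hd' ⟨_, hB0⟩
  have hZ : ∀ u, Z (J (T.lam u)) = J (T.X0 u) := LinearMap.extendOfNorm_eq hd' hZ0
  have hRsymm : ∀ u g, ⟪J (T.lam u), R g⟫_ℂ = ⟪J u, g⟫_ℂ := by
    intro u g
    refine hd.induction_on (p := fun g => ⟪J (T.lam u), R g⟫_ℂ = ⟪J u, g⟫_ℂ) g
      (isClosed_eq (by fun_prop) (by fun_prop)) fun φ => ?_
    rw [hR, T.lam_symm]
  have hL : ∀ u, B.adjoint (J u) = R (J (T.Y u)) := by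
    intro u
    refine ext_inner_left ℂ fun g => ?_
    refine hd.induction_on (p := fun g => ⟪g, B.adjoint (J u)⟫_ℂ = ⟪g, R (J (T.Y u))⟫_ℂ) g
      (isClosed_eq (by fun_prop) (by fun_prop)) fun φ => ?_
    rw [adjoint_inner_right, hB, hRsymm, T.adjY']
  have hZR : ∀ u g, ⟪J (T.X0 u), R g⟫_ℂ = -⟪J u, Z g⟫_ℂ := by
    intro u g
    refine hd.induction_on (p := fun g => ⟪J (T.X0 u), R g⟫_ℂ = -⟪J u, Z g⟫_ℂ) g
      (isClosed_eq (by fun_prop) (by fun_prop)) fun φ => ?_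
    rw [hR, hZ, T.adjX0]
  -- Weak form of `[X₀, Λ⁻²] = -Λ⁻² [X₀, Λ²] Λ⁻²`, free of domain questions.
  have hZ2 : ∀ u g, ⟪J (T.lam u), Z g⟫_ℂ + ⟪J (T.X0 (T.lam u)) - J (T.lam (T.X0 u)), R g⟫_ℂ =
      -⟪J (T.X0 u), g⟫_ℂ := by
    intro u g
    refine hd.induction_on (p := fun g => ⟪J (T.lam u), Z g⟫_ℂ +
      ⟪J (T.X0 (T.lam u)) - J (T.lam (T.X0 u)), R g⟫_ℂ = -⟪J (T.X0 u), g⟫_ℂ) g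
      (isClosed_eq (by fun_prop) (by fun_prop)) fun φ => ?_
    rw [hR, hZ, inner_sub_left, T.adjX0 (T.lam u), T.lam_symm (T.X0 u)]
    ring
  have hBn : ‖B‖ ≤ d * ellipticConst d γ M :=
    LinearMap.opNorm_extendOfNorm_le hd' (by positivity) hB0
  have hLn : ‖B.adjoint‖ ≤ d * ellipticConst d γ M := by
    rwa [LinearIsometryEquiv.norm_map]
  refine ⟨B.adjoint, hLn, hL, fun u w => ?_⟩
  -- The vector is `[X₀, L] w`. Paired with `Λ² φ` it becomes `⟪[X₀, Y'] φ, w⟫ - ⟪[X₀, Λ²] φ, L w⟫`,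
  -- and both commutators are bounded by `‖Λ² φ‖`.
  have key : ‖Z (J (T.Y w)) - R (J (T.Y (T.X0 w)))‖ ≤ commConst d γ M M' * ‖J w‖ := by
    refine norm_le_of_inner_dense hd (by have := commConst_nonneg d hγ hM hM'; positivity)
      fun φ => ?_
    have e : ⟪J (T.lam φ), Z (J (T.Y w)) - R (J (T.Y (T.X0 w)))⟫_ℂ =
        ⟪J (T.X0 (T.Y' φ)) - J (T.Y' (T.X0 φ)), J w⟫_ℂ -
          ⟪J (T.X0 (T.lam φ)) - J (T.lam (T.X0 φ)), B.adjoint (J w)⟫_ℂ := by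
      have h1 := hZ2 φ (J (T.Y w))
      rw [inner_sub_right, hRsymm, hL, inner_sub_left (J (T.X0 (T.Y' φ))), T.adjY' (T.X0 φ),
        T.adjX0 (T.Y' φ), T.adjY' φ]
      linear_combination h1
    rw [e]
    have i1 := norm_inner_le_norm (𝕜 := ℂ) (J (T.X0 (T.Y' φ)) - J (T.Y' (T.X0 φ))) (J w)
    have i2 := norm_inner_le_norm (𝕜 := ℂ) (J (T.X0 (T.lam φ)) - J (T.lam (T.X0 φ)))
      (B.adjoint (J w))
    have i3 := T.norm_comm_Y'_le hγ hM φ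
    have i4 := T.norm_comm_lam_le hγ hM hM' φ
    have i5 : ‖B.adjoint (J w)‖ ≤ d * ellipticConst d γ M * ‖J w‖ := le_of_opNorm_le _ hLn _
    calc _ ≤ _ := norm_sub_le _ _
      _ ≤ _ := add_le_add (i1.trans (mul_le_mul_of_nonneg_right i3 (norm_nonneg _)))
          (i2.trans (mul_le_mul i4 i5 (norm_nonneg _) (by positivity)))
      _ = _ := by unfold commConst; ring
  have e : ⟪J (T.X0 u), B.adjoint (J w)⟫_ℂ + ⟪B.adjoint.adjoint (J u), J (T.X0 w)⟫_ℂ =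
      -⟪J u, Z (J (T.Y w)) - R (J (T.Y (T.X0 w)))⟫_ℂ := by
    rw [hL, hZR, adjoint_inner_left, hL, inner_sub_right]
    ring
  rw [e, norm_neg]
  calc _ ≤ _ := norm_inner_le_norm _ _
    _ ≤ ‖J u‖ * (commConst d γ M M' * ‖J w‖) := by gcongr
    _ = _ := by ring

variable {L : H →L[ℂ] H}

/-- On vectors killed by all `b_j` the commutator form is that of `1 - Λ⁻²`. -/
lemma inner_X0_of_b_eq_zero (hγ : 0 < γ) (hR : ∀ u, R (J (T.lam u)) = J u)
    (hL : ∀ u, L (J u) = R (J (T.Y u))) {e : S} (he : ∀ j, T.b j e = 0) :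
    ⟪J (T.X0 e), L (J e)⟫_ℂ + ⟪L.adjoint (J e), J (T.X0 e)⟫_ℂ = ⟪J e, J e - R (J e)⟫_ℂ := by
  have hγ' : (γ : ℂ) ≠ 0 := by exact_mod_cast hγ.ne'
  have h1 : T.Y e = 0 := by simp [Y_apply, he]
  -- On the kernel of all `b k` the canonical relations give `b j (∑ b* a) e = γ a j e`, and there
  -- `Λ² e - e = ∑ a* a e`.
  have h2 : T.Y (T.X0 e) = T.lam e - e := by
    have h3 : T.Y (T.Y' e) = (γ : ℂ) • ∑ j, T.a' j (T.a j e) := by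
      rw [Y_apply, Finset.smul_sum]
      refine Finset.sum_congr rfl fun j _ => ?_
      have : T.b j (T.Y' e) = (γ : ℂ) • T.a j e := by
        rw [Y'_apply, map_sum]
        simp only [T.ccrB, ← T.ab, he, map_zero, zero_add]
        rw [Finset.sum_ite_eq, if_pos (Finset.mem_univ _)]
      rw [this, map_smul]
    rw [X0_eq, h1, sub_zero, map_smul, h3, smul_smul, inv_mul_cancel₀ hγ', one_smul, lam_apply]
    simp [he]
  rw [hL, h1, map_zero, map_zero, inner_zero_right, zero_add, ContinuousLinearMap.adjoint_inner_left,
    hL, h2, map_sub, map_sub, hR]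

/-- The lower bound for the form of `X₀` against `L + L*`. -/
theorem re_inner_X0_ge (hγ : 0 < γ) (hR : ∀ u, R (J (T.lam u)) = J u)
    (hL : ∀ u, L (J u) = R (J (T.Y u))) {C : ℝ}
    (hC : ∀ u w, ‖⟪J (T.X0 u), L (J w)⟫_ℂ + ⟪L.adjoint (J u), J (T.X0 w)⟫_ℂ‖ ≤
      C * ‖J u‖ * ‖J w‖) (u : S) {f : H}
    (hf : f ∈ closure {g | ∃ e : S, (∀ j, T.b j e = 0) ∧ J e = g}) :
    (⟪f, f - R f⟫_ℂ).re - 2 * C * ‖f‖ * ‖J u - f‖ - C * ‖J u - f‖ ^ 2 ≤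
      (⟪J (T.X0 u), L (J u) + L.adjoint (J u)⟫_ℂ).re := by
  refine closure_minimal (t := {f | (⟪f, f - R f⟫_ℂ).re - 2 * C * ‖f‖ * ‖J u - f‖
    - C * ‖J u - f‖ ^ 2 ≤ (⟪J (T.X0 u), L (J u) + L.adjoint (J u)⟫_ℂ).re}) ?_
    (isClosed_le (by fun_prop) (by fun_prop)) hf
  rintro _ ⟨e, he, rfl⟩
  set w := u - e with hw
  have hu : u = e + w := by simp [hw]
  have hJw : J u - J e = J w := by rw [hw, map_sub]
  have h1 := T.inner_X0_of_b_eq_zero hγ hR hL he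
  have h2 := hC e w
  have h3 := hC w e
  have h4 := hC w w
  set β : S → S → ℂ := fun u w => ⟪J (T.X0 u), L (J w)⟫_ℂ + ⟪L.adjoint (J u), J (T.X0 w)⟫_ℂ
    with hβ
  change ‖β e w‖ ≤ _ at h2
  change ‖β w e‖ ≤ _ at h3
  change ‖β w w‖ ≤ _ at h4
  change β e e = _ at h1
  have h5 : (⟪J (T.X0 u), L (J u) + L.adjoint (J u)⟫_ℂ).re = (β u u).re := by
    simp only [hβ, inner_add_right, Complex.add_re]
    rw [← inner_conj_symm (L.adjoint (J u)) (J (T.X0 u)), Complex.conj_re]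
  -- The macroscopic term is known exactly from `h1`; the other three are bounded by the commutator
  -- constant.
  have h6 : β u u = β e e + β e w + β w e + β w w := by
    rw [hu]
    simp only [hβ, map_add, inner_add_left, inner_add_right]
    ring
  have h7 : ∀ z : ℂ, -‖z‖ ≤ z.re := fun z => (abs_le.mp (Complex.abs_re_le_norm z)).1
  simp only [Set.mem_ofPred_eq]
  rw [h5, h6, h1, hJw]
  simp only [Complex.add_re]
  linarith [h7 (β e w), h7 (β w e), h7 (β w w)]

end KineticSystem

/-- The final combination of the microscopic and macroscopic estimates. -/
lemma hypocoercive_combination {γ δ ε C CL nu nf nw X Y : ℝ} (hγ : 0 < γ) (hδ : δ ≤ 1)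
    (hε : 0 < ε) (hC : 0 ≤ C) (hCL : 0 ≤ CL) (hnw : 0 ≤ nw) (hnu : 0 ≤ nu)
    (hpy : nu ^ 2 = nf ^ 2 + nw ^ 2) (hεγ : ε ≤ γ / 2)
    (hεC : ε * (3 * C + 2 * γ * CL) ^ 2 ≤ γ * δ)
    (hX : δ * nf ^ 2 - 2 * C * nf * nw - C * nw ^ 2 ≤ X)
    (hY : -(2 * CL * nw * nu) ≤ Y) :
    ε * δ / 2 * nu ^ 2 ≤ γ * nw ^ 2 + ε * X + ε * γ * Y := by
  have hfu : nf ≤ nu := by nlinarith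
  have hwu : nw ≤ nu := by nlinarith
  set D := 3 * C + 2 * γ * CL with hD
  have hD0 : 0 ≤ D := by positivity
  have h1 : 2 * C * nf * nw + C * nw ^ 2 + γ * (2 * CL * nw * nu) ≤ D * nw * nu := by
    have e1 : C * nw * nf ≤ C * nw * nu := by gcongr
    have e2 : C * nw * nw ≤ C * nw * nu := by gcongr
    rw [hD]; nlinarith
  -- Young's inequality, weighted so that half of the microscopic dissipation absorbs the `nw` part.
  -- The smallness of `ε` in `hεC` keeps the `nu` part below half of `ε δ`.
  have h2 : ε * (D * nw * nu) ≤ γ / 2 * nw ^ 2 + ε ^ 2 * D ^ 2 / (2 * γ) * nu ^ 2 := by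
    have e : γ / 2 * nw ^ 2 + ε ^ 2 * D ^ 2 / (2 * γ) * nu ^ 2 - ε * (D * nw * nu) =
        (γ * nw - ε * D * nu) ^ 2 / (2 * γ) := by
      field_simp; ring
    have : 0 ≤ (γ * nw - ε * D * nu) ^ 2 / (2 * γ) := by positivity
    linarith
  have h3 : ε ^ 2 * D ^ 2 / (2 * γ) ≤ ε * δ / 2 := by
    rw [div_le_iff₀ (by positivity)]
    nlinarith [mul_le_mul_of_nonneg_left hεC hε.le]
  have h4 : ε ^ 2 * D ^ 2 / (2 * γ) * nu ^ 2 ≤ ε * δ / 2 * nu ^ 2 := by gcongr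
  have h5 : ε * δ * nw ^ 2 ≤ γ / 2 * nw ^ 2 := by
    gcongr
    nlinarith
  have h6 : ε * (δ * nf ^ 2 - 2 * C * nf * nw - C * nw ^ 2) ≤ ε * X := by gcongr
  have h7 : ε * γ * (-(2 * CL * nw * nu)) ≤ ε * γ * Y := by gcongr
  have h8 := mul_le_mul_of_nonneg_left h1 hε.le
  rw [hpy] at *
  nlinarith

end Kinetic

/-! ### From the spectral gap to a form inequality for `Λ⁻²` -/

section Resolvent

variable {d : ℕ}

/-- `1 - (1 + t) (N + 1)⁻¹` is invertible if `N - t` has a bounded inverse. -/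
lemma isUnit_one_sub_of_isResolvent {G : Set (H d × H d)} {R Rt : H d →L[ℂ] H d} {t : ℂ}
    (hR : IsResolvent G (-1) R) (hRt : IsResolvent G t Rt) :
    IsUnit (1 - (1 + t) • R) := by
  have h1 : ∀ h, Rt (h - (1 + t) • R h) = R h := by
    intro h
    have : (R h, h - R h) ∈ G := by rw [hR]; congr 1; simp
    rw [hRt] at this
    convert this using 2
    module
  have h2 : ∀ h, R (h + (1 + t) • Rt h) = Rt h := by
    intro h
    have : (Rt h, h + t • Rt h) ∈ G := by rw [hRt]; congr 1; simp
    rw [hR] at this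
    convert this using 2
    module
  -- Formally `1 - (1 + t) R = (N - t)(N + 1)⁻¹`, whose inverse is `(N + 1)(N - t)⁻¹ = 1 + (1 + t)
  -- Rt`.
  refine isUnit_iff_exists.mpr ⟨1 + (1 + t) • Rt, ?_, ?_⟩
  · ext1 h
    have := h2 h
    simp only [mul_apply_eq_comp, sub_apply,
      one_apply_eq_self, smul_apply, add_apply,
      this]
    abel
  · ext1 h
    have := h1 h
    simp only [mul_apply_eq_comp, sub_apply,
      one_apply_eq_self, smul_apply, add_apply,
      this]
    abel

/-- If `N - t` is invertible for all real `t < α` other than `0`, then the spectrum of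
`R = (N + 1)⁻¹` lies in `{1} ∪ (-∞, (1 + α)⁻¹]`. -/
lemma spectrum_le_of_gap {E : Type*} [NormedAddCommGroup E] [InnerProductSpace ℂ E]
    {R : E →L[ℂ] E} {α : ℝ} (hα : 0 < α)
    (hgap : ∀ t : ℝ, t ≠ 0 → t < α → IsUnit (1 - (1 + (t : ℂ)) • R))
    {μ : ℝ} (hμ : μ ∈ spectrum ℝ R) : μ = 1 ∨ μ ≤ (1 + α)⁻¹ := by
  by_contra! h
  obtain ⟨h1, h2⟩ := h
  have hμ0 : 0 < μ := lt_trans (by positivity) h2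
  have h3 : μ⁻¹ < 1 + α := by rwa [inv_lt_comm₀ hμ0 (by positivity)]
  -- The point `μ` of the spectrum of `(N + 1)⁻¹` corresponds to `t = μ⁻¹ - 1` for `N`.
  have h5 := hgap (μ⁻¹ - 1) (fun h0 => h1 (inv_eq_one.mp (by linarith))) (by linarith)
  refine hμ ?_
  have h6 : algebraMap ℝ (E →L[ℂ] E) μ - R =
      algebraMap ℝ (E →L[ℂ] E) μ * (1 - (1 + ((μ⁻¹ - 1 : ℝ) : ℂ)) • R) := by
    have h7 : (1 + ((μ⁻¹ - 1 : ℝ) : ℂ)) • R = μ⁻¹ • R := by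
      rw [← Complex.coe_smul]; congr 1; push_cast; ring
    rw [h7, Algebra.algebraMap_eq_smul_one, smul_mul_assoc, one_mul, smul_sub, smul_smul,
      mul_inv_cancel₀ hμ0.ne', one_smul]
  rw [spectrum.mem_resolventSet_iff, h6]
  exact ((isUnit_iff_ne_zero.mpr hμ0.ne').map _).mul h5

/-- A self-adjoint operator whose spectrum lies in `{1} ∪ (-∞, c]` is at most `c` on the
orthogonal complement of the eigenspace of `1`. -/
lemma re_inner_le_of_spectrum {E : Type*} [NormedAddCommGroup E] [InnerProductSpace ℂ E]
    [CompleteSpace E] {R : E →L[ℂ] E} {c : ℝ} (hsa : IsSelfAdjoint R)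
    (hsp : ∀ μ ∈ spectrum ℝ R, μ = 1 ∨ μ ≤ c) {f : E}
    (hf : ∀ k, R k = k → ⟪k, f⟫_ℂ = 0) : (⟪f, R f⟫_ℂ).re ≤ c * ‖f‖ ^ 2 := by
  -- The double zero at `1` makes the polynomial nonnegative on the spectrum, whatever the sign of
  -- `c - 1`. Written symmetrically, it yields the form of `c - R` on the range of `1 - R`.
  have h1 : 0 ≤ cfc (fun x : ℝ => (1 - x) * (c - x) * (1 - x)) R := by
    refine cfc_nonneg fun x hx => ?_
    rcases hsp x hx with rfl | h
    · simp
    · nlinarith [mul_self_nonneg (1 - x)]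
  have h2 : cfc (fun x : ℝ => (1 - x) * (c - x) * (1 - x)) R =
      (1 - R) * (algebraMap ℝ _ c - R) * (1 - R) := by
    rw [cfc_mul _ _ R, cfc_mul _ _ R, cfc_sub _ _ R, cfc_sub _ _ R, cfc_const _ R, cfc_const _ R,
      cfc_id' ℝ R, map_one]
  rw [h2, ContinuousLinearMap.nonneg_iff_isPositive] at h1
  have hsymm : ∀ x y, ⟪R x, y⟫_ℂ = ⟪x, R y⟫_ℂ := fun x y => hsa.isSymmetric x y
  have h3 : ∀ g, (⟪g - R g, R (g - R g)⟫_ℂ).re ≤ c * ‖g - R g‖ ^ 2 := by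
    intro g
    have h4 := h1.re_inner_nonneg_right g
    have h5 : ⟪g, ((1 - R) * (algebraMap ℝ _ c - R) * (1 - R)) g⟫_ℂ =
        (c : ℂ) * ⟪g - R g, g - R g⟫_ℂ - ⟪g - R g, R (g - R g)⟫_ℂ := by
      have h6 : ((1 - R) * (algebraMap ℝ _ c - R) * (1 - R)) g =
        ((c : ℂ) • (g - R g) - R (g - R g)) - R ((c : ℂ) • (g - R g) - R (g - R g)) := by
        simp [Algebra.algebraMap_eq_smul_one]
      have h7 : ∀ x, ⟪g, x - R x⟫_ℂ = ⟪g - R g, x⟫_ℂ := fun x => by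
        rw [inner_sub_right, inner_sub_left, hsymm]
      rw [h6, h7, inner_sub_right, inner_smul_right]
    rw [h5] at h4
    have h8 : (⟪g - R g, g - R g⟫_ℂ).re = ‖g - R g‖ ^ 2 := inner_self_eq_norm_sq (𝕜 := ℂ) _
    simp only [RCLike.re_eq_complex_re, Complex.sub_re, Complex.re_ofReal_mul, h8] at h4
    linarith
  -- By self-adjointness the closure of the range of `1 - R` is the orthogonal complement of the
  -- fixed vectors.
  have h4 : f ∈ closure (Set.range ⇑(1 - R)) := by
    have : f ∈ (LinearMap.range (1 - R).toLinearMap).topologicalClosure := by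
      rw [← Submodule.orthogonal_orthogonal_eq_closure, Submodule.mem_orthogonal]
      intro k hk
      refine hf k ?_
      rw [Submodule.mem_orthogonal] at hk
      have : ⟪k - R k, k - R k⟫_ℂ = 0 := by
        have := hk _ ⟨k - R k, rfl⟩
        simp only [ContinuousLinearMap.coe_coe, sub_apply,
          one_apply_eq_self] at this
        rw [inner_sub_left, hsymm] at this
        rw [inner_sub_right (k - R k) k, ← hsymm (k - R k), ← inner_sub_left]
        rw [← hsymm, ← inner_sub_left] at this
        exact this
      rw [inner_self_eq_zero, sub_eq_zero] at this
      exact this.symm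
    exact this
  refine closure_minimal (t := {f | (⟪f, R f⟫_ℂ).re ≤ c * ‖f‖ ^ 2}) ?_
    (isClosed_le (by fun_prop) (by fun_prop)) h4
  rintro _ ⟨g, rfl⟩
  exact h3 g

variable {S : Type*} [AddCommGroup S] [Module ℂ S]

/-- The shear `(f, g) ↦ (f, g + f)` is a homeomorphism carrying the graph of `N` to that of `N + 1`,
so it respects closures. -/
lemma closure_graph_add_one (J : S →ₗ[ℂ] H d) (N : S → S) (f g : H d) :
    (f, g) ∈ closure (Set.range fun u => (J u, J (N u + u))) ↔
      (f, g - f) ∈ closure (Set.range fun u => (J u, J (N u))) := by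
  let Φ : (H d × H d) ≃ₜ (H d × H d) :=
    { toFun := fun p => (p.1, p.2 + p.1)
      invFun := fun p => (p.1, p.2 - p.1)
      left_inv := fun p => by simp
      right_inv := fun p => by simp
      continuous_toFun := by fun_prop
      continuous_invFun := by fun_prop }
  have h1 : (Set.range fun u => (J u, J (N u + u))) = Φ '' Set.range fun u => (J u, J (N u)) := by
    rw [← Set.range_comp]
    congr 1
    ext1 u
    simp [Φ]
  have h2 : (f, g) = Φ (f, g - f) := by simp [Φ]
  rw [h1, ← Φ.image_closure, h2, Φ.injective.mem_set_image]

/-- The inverse of `N + 1` inverts on the core, whose image under `N + 1` is dense. -/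
lemma resolvent_core {J : S →ₗ[ℂ] H d} {N : S → S} {R : H d →L[ℂ] H d}
    (hR : IsResolvent (closure (Set.range fun u => (J u, J (N u)))) (-1) R) :
    (∀ u, R (J (N u + u)) = J u) ∧ DenseRange fun u => J (N u + u) := by
  refine ⟨fun u => ?_, fun g => ?_⟩
  · have := (hR (J u) (J (N u))).mp (subset_closure ⟨u, rfl⟩)
    simpa using this
  · have h1 : (R g, g - R g) ∈ closure (Set.range fun u => (J u, J (N u))) := by
      rw [hR]; congr 1; simp
    have h2 := map_mem_closure (f := fun p : H d × H d => p.2 + p.1) (by fun_prop) h1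
      (t := Set.range fun u => J (N u + u)) (by rintro _ ⟨u, rfl⟩; exact ⟨u, by simp⟩)
    simpa using h2

end Resolvent

/-! ### Realization of the operators on Schwartz space -/

section TemperateGrowth

variable {E F : Type*} [NormedAddCommGroup E] [NormedSpace ℝ E] [NormedAddCommGroup F]
  [NormedSpace ℝ F]

lemma hasTemperateGrowth_fderiv {f : E → F} (hf : f.HasTemperateGrowth) :
    (fderiv ℝ f).HasTemperateGrowth := by
  refine ⟨hf.1.fderiv_right (m := ∞) (by simp), fun n => ?_⟩
  obtain ⟨k, C, h⟩ := hf.2 (n + 1)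
  exact ⟨k, C, fun x => by rw [norm_iteratedFDeriv_fderiv]; exact h x⟩

lemma hasTemperateGrowth_fderiv_apply {f : E → F} (hf : f.HasTemperateGrowth) (m : E) :
    (fun x => fderiv ℝ f x m).HasTemperateGrowth :=
  (ContinuousLinearMap.apply ℝ F m).hasTemperateGrowth.comp (hasTemperateGrowth_fderiv hf)

lemma hasTemperateGrowth_of_bounded {f : E → F} (hf : ContDiff ℝ ∞ f)
    (h : ∀ n, ∃ C : ℝ, ∀ x, ‖iteratedFDeriv ℝ n f x‖ ≤ C) : f.HasTemperateGrowth :=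
  ⟨hf, fun n => ⟨0, by simpa using h n⟩⟩

end TemperateGrowth

section SchwartzOperators

open scoped LineDeriv

variable {E : Type*} [NormedAddCommGroup E] [NormedSpace ℝ E]

/-- Directional derivative on Schwartz space. -/
noncomputable def diffOp (m : E) : Module.End ℂ 𝓢(E, ℂ) :=
  (LineDeriv.lineDerivOpCLM ℂ 𝓢(E, ℂ) m).toLinearMap

/-- Multiplication by a real function of temperate growth on Schwartz space. -/
noncomputable def mulOp (g : E → ℝ) : Module.End ℂ 𝓢(E, ℂ) :=
  (SchwartzMap.smulLeftCLM ℂ fun z => (g z : ℂ)).toLinearMap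

lemma diffOp_apply (m : E) (u : 𝓢(E, ℂ)) (z : E) : diffOp m u z = fderiv ℝ u z m := rfl

lemma mulOp_apply {g : E → ℝ} (hg : g.HasTemperateGrowth) (u : 𝓢(E, ℂ)) (z : E) :
    mulOp g u z = (g z : ℂ) * u z := by
  have hg' : (fun z => (g z : ℂ)).HasTemperateGrowth := Complex.ofRealCLM.hasTemperateGrowth.comp hg
  exact SchwartzMap.smulLeftCLM_apply_apply hg' u z

lemma diffOp_comm (m m' : E) (u : 𝓢(E, ℂ)) : diffOp m (diffOp m' u) = diffOp m' (diffOp m u) := by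
  ext z
  have hd : Differentiable ℝ (fderiv ℝ u) := (SchwartzMap.fderivCLM ℝ E ℂ u).differentiable
  have h : ∀ m m' : E, diffOp m (diffOp m' u) z = fderiv ℝ (fderiv ℝ u) z m m' := by
    intro m m'
    rw [diffOp_apply]
    change fderiv ℝ (fun z => fderiv ℝ u z m') z m = _
    rw [fderiv_clm_apply hd.differentiableAt (differentiableAt_const _)]
    simp
  rw [h, h]
  exact ((u.contDiffAt 2).isSymmSndFDerivAt (by simp)).eq _ _

lemma mulOp_comm {g g' : E → ℝ} (hg : g.HasTemperateGrowth) (hg' : g'.HasTemperateGrowth)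
    (u : 𝓢(E, ℂ)) : mulOp g (mulOp g' u) = mulOp g' (mulOp g u) := by
  ext z
  simp only [mulOp_apply hg, mulOp_apply hg']
  ring

lemma diffOp_mulOp {g : E → ℝ} (hg : g.HasTemperateGrowth) (m : E) (u : 𝓢(E, ℂ)) :
    diffOp m (mulOp g u) = mulOp g (diffOp m u) + mulOp (fun z => fderiv ℝ g z m) u := by
  ext z
  have hgd : DifferentiableAt ℝ g z := (hg.1.differentiable (by simp)).differentiableAt
  have h1 : HasFDerivAt (mulOp g u) ((g z : ℂ) • fderiv ℝ u z +
      u z • (Complex.ofRealCLM.comp (fderiv ℝ g z))) z := by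
    have h2 : HasFDerivAt (fun z => (g z : ℂ)) (Complex.ofRealCLM.comp (fderiv ℝ g z)) z :=
      Complex.ofRealCLM.hasFDerivAt.comp z hgd.hasFDerivAt
    refine (h2.mul (u.hasFDerivAt z)).congr_of_eventuallyEq (Filter.Eventually.of_forall fun y => ?_)
    exact mulOp_apply hg u y
  change _ = mulOp g (diffOp m u) z + mulOp (fun z => fderiv ℝ g z m) u z
  rw [diffOp_apply, h1.fderiv, mulOp_apply hg,
    mulOp_apply (hasTemperateGrowth_fderiv_apply hg m), diffOp_apply]
  simp [mul_comm]

/-- `γ^{1/2} (∂_m + g / 2)`. -/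
noncomputable def annihilation (γ : ℝ) (m : E) (g : E → ℝ) : Module.End ℂ 𝓢(E, ℂ) :=
  (Real.sqrt γ : ℂ) • (diffOp m + (1 / 2 : ℂ) • mulOp g)

/-- `γ^{1/2} (-∂_m + g / 2)`. -/
noncomputable def creation (γ : ℝ) (m : E) (g : E → ℝ) : Module.End ℂ 𝓢(E, ℂ) :=
  (Real.sqrt γ : ℂ) • (-diffOp m + (1 / 2 : ℂ) • mulOp g)

variable {γ : ℝ} {m m' : E} {g g' : E → ℝ} (hg : g.HasTemperateGrowth)

include hg

lemma annihilation_apply (u : 𝓢(E, ℂ)) (z : E) :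
    annihilation γ m g u z = (Real.sqrt γ : ℂ) * (fderiv ℝ u z m + (g z : ℂ) / 2 * u z) := by
  have h : annihilation γ m g u z =
      (Real.sqrt γ : ℂ) * (diffOp m u z + (1 / 2 : ℂ) * mulOp g u z) := rfl
  rw [h, mulOp_apply hg, diffOp_apply]
  ring

lemma creation_apply (u : 𝓢(E, ℂ)) (z : E) :
    creation γ m g u z = (Real.sqrt γ : ℂ) * (-fderiv ℝ u z m + (g z : ℂ) / 2 * u z) := by
  have h : creation γ m g u z =
      (Real.sqrt γ : ℂ) * (-diffOp m u z + (1 / 2 : ℂ) * mulOp g u z) := rfl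
  rw [h, mulOp_apply hg, diffOp_apply]
  ring

variable (hg' : g'.HasTemperateGrowth)

lemma creation_mulOp (f : E → ℝ) (hf : f.HasTemperateGrowth) (u : 𝓢(E, ℂ)) :
    creation γ m g (mulOp f u) = mulOp f (creation γ m g u) -
      (Real.sqrt γ : ℂ) • mulOp (fun z => fderiv ℝ f z m) u := by
  simp only [creation, LinearMap.smul_apply, LinearMap.add_apply, LinearMap.neg_apply, map_smul,
    map_add, map_neg, diffOp_mulOp hf, mulOp_comm hg hf]
  module

include hg' in
-- The only obstruction is the difference of the cross derivatives of the coefficients. It vanishes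
-- because in the application the coefficients are the components of a gradient.
lemma annihilation_comm (h : ∀ z, fderiv ℝ g' z m = fderiv ℝ g z m') (u : 𝓢(E, ℂ)) :
    annihilation γ m g (annihilation γ m' g' u) = annihilation γ m' g' (annihilation γ m g u) := by
  have h' : (fun z => fderiv ℝ g' z m) = fun z => fderiv ℝ g z m' := funext h
  simp only [annihilation, LinearMap.smul_apply, LinearMap.add_apply, map_smul,
    map_add, diffOp_mulOp hg, diffOp_mulOp hg', mulOp_comm hg hg', diffOp_comm m m', h']
  module

include hg' in
lemma creation_comm (h : ∀ z, fderiv ℝ g' z m = fderiv ℝ g z m') (u : 𝓢(E, ℂ)) :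
    creation γ m g (creation γ m' g' u) = creation γ m' g' (creation γ m g u) := by
  have h' : (fun z => fderiv ℝ g' z m) = fun z => fderiv ℝ g z m' := funext h
  simp only [creation, LinearMap.smul_apply, LinearMap.add_apply, LinearMap.neg_apply, map_smul,
    map_add, map_neg, diffOp_mulOp hg, diffOp_mulOp hg', mulOp_comm hg hg', diffOp_comm m m', h']
  module

include hg' in
lemma annihilation_creation (hγ : 0 ≤ γ) (h : ∀ z, fderiv ℝ g' z m = fderiv ℝ g z m')
    (u : 𝓢(E, ℂ)) : annihilation γ m g (creation γ m' g' u) =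
      creation γ m' g' (annihilation γ m g u) +
        (γ : ℂ) • mulOp (fun z => fderiv ℝ g' z m) u := by
  have h' : (fun z => fderiv ℝ g' z m) = fun z => fderiv ℝ g z m' := funext h
  have hs : (γ : ℂ) = (Real.sqrt γ : ℂ) * (Real.sqrt γ : ℂ) := by
    rw [← Complex.ofReal_mul, Real.mul_self_sqrt hγ]
  simp only [annihilation, creation, LinearMap.smul_apply, LinearMap.add_apply,
    LinearMap.neg_apply, map_smul, map_add, map_neg, diffOp_mulOp hg, diffOp_mulOp hg',
    mulOp_comm hg hg', diffOp_comm m m', h', hs]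
  module

end SchwartzOperators

section Inner

variable {E : Type*} [NormedAddCommGroup E] [NormedSpace ℝ E] [FiniteDimensional ℝ E]
  [MeasurableSpace E] [BorelSpace E] {μ : Measure E} [μ.IsAddHaarMeasure]

lemma inner_diffOp (m : E) (u w : 𝓢(E, ℂ)) :
    ⟪(diffOp m u).toLp 2 μ, w.toLp 2 μ⟫_ℂ = -⟪u.toLp 2 μ, (diffOp m w).toLp 2 μ⟫_ℂ := by
  rw [SchwartzMap.inner_toL2_toL2_eq _ _ μ, SchwartzMap.inner_toL2_toL2_eq _ _ μ]
  -- The sesquilinear product is rewritten as a real bilinear map, the form required for integration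
  -- by parts.
  set B := (ContinuousLinearMap.mul ℝ ℂ).comp (Complex.conjCLE : ℂ →L[ℝ] ℂ) with hB
  have e : ∀ f g : 𝓢(E, ℂ), ∫ z, ⟪f z, g z⟫_ℂ ∂μ = ∫ z, B (f z) (g z) ∂μ := by
    intro f g
    refine integral_congr_ae (Filter.Eventually.of_forall fun z => ?_)
    simp [hB, RCLike.inner_apply, mul_comm]
  rw [e, e]
  have h := SchwartzMap.integral_bilinear_lineDerivOp_right_eq_neg_left (μ := μ) u w B m
  exact neg_eq_iff_eq_neg.mp h.symm

lemma inner_mulOp {g : E → ℝ} (hg : g.HasTemperateGrowth) (u w : 𝓢(E, ℂ)) :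
    ⟪(mulOp g u).toLp 2 μ, w.toLp 2 μ⟫_ℂ = ⟪u.toLp 2 μ, (mulOp g w).toLp 2 μ⟫_ℂ := by
  rw [SchwartzMap.inner_toL2_toL2_eq _ _ μ, SchwartzMap.inner_toL2_toL2_eq _ _ μ]
  refine integral_congr_ae (Filter.Eventually.of_forall fun z => ?_)
  simp only [RCLike.inner_apply, mulOp_apply hg, map_mul, Complex.conj_ofReal]
  ring

lemma norm_mulOp_le {g : E → ℝ} (hg : g.HasTemperateGrowth) {C : ℝ}
    (h : ∀ z, |g z| ≤ C) (u : 𝓢(E, ℂ)) :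
    ‖(mulOp g u).toLp 2 μ‖ ≤ C * ‖u.toLp 2 μ‖ := by
  refine Lp.norm_le_mul_norm_of_ae_le_mul ?_
  filter_upwards [(mulOp g u).coeFn_toLp 2 μ, u.coeFn_toLp 2 μ] with z h1 h2
  rw [h1, h2, mulOp_apply hg, norm_mul, Complex.norm_real]
  gcongr
  exact h z

lemma inner_annihilation {γ : ℝ} {g : E → ℝ} (hg : g.HasTemperateGrowth) (m : E) (u w : 𝓢(E, ℂ)) :
    ⟪(annihilation γ m g u).toLp 2 μ, w.toLp 2 μ⟫_ℂ =
      ⟪u.toLp 2 μ, (creation γ m g w).toLp 2 μ⟫_ℂ := by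
  have h1 := inner_diffOp (μ := μ) m u w
  have h2 := inner_mulOp (μ := μ) hg u w
  simp only [← SchwartzMap.toLpCLM_apply (𝕜 := ℂ)] at h1 h2 ⊢
  simp only [annihilation, creation, LinearMap.smul_apply, LinearMap.add_apply,
    LinearMap.neg_apply, map_smul, map_add, map_neg, inner_smul_left, inner_smul_right,
    inner_add_left, inner_add_right, inner_neg_right, h1, h2]
  simp only [map_div₀, map_one, map_ofNat, Complex.conj_ofReal]

end Inner

section Directional

variable {E F G : Type*} [NormedAddCommGroup E] [NormedSpace ℝ E] [NormedAddCommGroup F]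
  [NormedSpace ℝ F] [NormedAddCommGroup G] [NormedSpace ℝ G]

lemma norm_iteratedFDeriv_fderiv_apply_le {f : E → F} (hf : ContDiff ℝ ∞ f) {e : E}
    (he : ‖e‖ ≤ 1) (n : ℕ) (x : E) :
    ‖iteratedFDeriv ℝ n (fun x => fderiv ℝ f x e) x‖ ≤ ‖iteratedFDeriv ℝ (n + 1) f x‖ := by
  rw [← norm_iteratedFDeriv_fderiv]
  have h1 : ContDiff ℝ ∞ (fderiv ℝ f) := hf.fderiv_right (by simp)
  have h2 := (ContinuousLinearMap.apply ℝ F e).norm_iteratedFDeriv_comp_left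
    (f := fderiv ℝ f) (n := n) (N := ∞) (x := x) h1.contDiffAt (by exact_mod_cast le_top)
  have h3 : ‖ContinuousLinearMap.apply ℝ F e‖ ≤ 1 := by
    refine ContinuousLinearMap.opNorm_le_bound _ zero_le_one fun A => ?_
    rw [ContinuousLinearMap.apply_apply, one_mul]
    exact (A.le_opNorm e).trans (mul_le_of_le_one_right (norm_nonneg _) he)
  exact h2.trans (mul_le_of_le_one_left (norm_nonneg _) h3)

lemma contDiff_fderiv_apply {f : E → F} (hf : ContDiff ℝ ∞ f) (e : E) :
    ContDiff ℝ ∞ fun x => fderiv ℝ f x e :=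
  (hf.fderiv_right (m := ∞) (by simp)).clm_apply contDiff_const

lemma fderiv_comp_fst_apply {f : E → F} (hf : Differentiable ℝ f) (z : E × G) (m : E × G) :
    fderiv ℝ (fun z : E × G => f z.1) z m = fderiv ℝ f z.1 m.1 := by
  have h : HasFDerivAt (fun z : E × G => f z.1)
      ((fderiv ℝ f z.1).comp (ContinuousLinearMap.fst ℝ E G)) z :=
    hf.differentiableAt.hasFDerivAt.comp z hasFDerivAt_fst
  rw [h.fderiv]; rfl

/-- A function whose derivatives of order at least two are bounded has a gradient of temperate
growth. -/
lemma hasTemperateGrowth_fderiv_of_bounded {f : E → F} (hf : ContDiff ℝ ∞ f)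
    (h : ∀ n : ℕ, 2 ≤ n → ∃ C : ℝ, ∀ x, ‖iteratedFDeriv ℝ n f x‖ ≤ C) :
    (fderiv ℝ f).HasTemperateGrowth := by
  have h1 : ContDiff ℝ ∞ (fderiv ℝ f) := hf.fderiv_right (by simp)
  have h2 : (fderiv ℝ (fderiv ℝ f)).HasTemperateGrowth := by
    refine hasTemperateGrowth_of_bounded (h1.fderiv_right (by simp)) fun n => ?_
    obtain ⟨C, hC⟩ := h (n + 2) (by omega)
    exact ⟨C, fun x => by rw [norm_iteratedFDeriv_fderiv, norm_iteratedFDeriv_fderiv]; exact hC x⟩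
  have hd : Differentiable ℝ (fderiv ℝ f) := h1.differentiable (by simp)
  obtain ⟨C, hC⟩ := h 2 le_rfl
  have h3 : ∀ x, ‖fderiv ℝ (fderiv ℝ f) x‖ ≤ C := fun x => by
    have := hC x
    rwa [← norm_iteratedFDeriv_fderiv, ← norm_iteratedFDeriv_fderiv, norm_iteratedFDeriv_zero]
      at this
  have hC0 : 0 ≤ C := (norm_nonneg (fderiv ℝ (fderiv ℝ f) 0)).trans (h3 0)
  -- A bounded second derivative makes the gradient grow at most linearly, hence the exponent `1`.
  refine .of_fderiv h2 hd (k := 1) (C := ‖fderiv ℝ f 0‖ + C) fun x => ?_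
  have h4 := convex_univ.norm_image_sub_le_of_norm_fderiv_le (𝕜 := ℝ)
    (fun x _ => hd.differentiableAt) (fun x _ => h3 x) (Set.mem_univ 0) (Set.mem_univ x)
  have h5 := norm_le_norm_add_norm_sub' (fderiv ℝ f x) (fderiv ℝ f 0)
  rw [sub_zero] at h4
  rw [pow_one]
  nlinarith [norm_nonneg x, norm_nonneg (fderiv ℝ f 0), mul_nonneg (norm_nonneg (fderiv ℝ f 0))
    (norm_nonneg x)]

lemma mulOp_zero : mulOp (fun _ : E => (0 : ℝ)) = 0 := by
  ext u z
  rw [mulOp_apply (by fun_prop)]; simp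

lemma mulOp_one : mulOp (fun _ : E => (1 : ℝ)) = 1 := by
  ext u z
  rw [mulOp_apply (by fun_prop)]; simp

end Directional

namespace RelaxationBoltzmann

variable {d : ℕ}

/-- The position direction `x_j` of phase space. -/
noncomputable def posDir (j : Fin d) : Phase d := (EuclideanSpace.single j 1, 0)

/-- The velocity direction `v_j` of phase space. -/
noncomputable def velDir (j : Fin d) : Phase d := (0, EuclideanSpace.single j 1)

/-- `∂_{x_j} ∂_{x_k} V`. -/
noncomputable def hessV (V : Pos d → ℝ) (j k : Fin d) (x : Pos d) : ℝ :=
  fderiv ℝ (dV V k) x (EuclideanSpace.single j 1)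

lemma norm_single_le (j : Fin d) : ‖(EuclideanSpace.single j 1 : Pos d)‖ ≤ 1 := by simp

lemma hasTemperateGrowth_fst : (Prod.fst : Phase d → Pos d).HasTemperateGrowth :=
  (ContinuousLinearMap.fst ℝ (Pos d) (Pos d)).hasTemperateGrowth

namespace IsConfining

variable {V : Pos d → ℝ} (hV : IsConfining V)
include hV

lemma contDiff_dV (j : Fin d) : ContDiff ℝ ∞ (dV V j) := contDiff_fderiv_apply hV.smooth _

lemma contDiff_hessV (j k : Fin d) : ContDiff ℝ ∞ (hessV V j k) :=
  contDiff_fderiv_apply (hV.contDiff_dV k) _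

lemma hasTemperateGrowth_dV (j : Fin d) : (dV V j).HasTemperateGrowth :=
  (ContinuousLinearMap.apply ℝ ℝ (EuclideanSpace.single j (1 : ℝ))).hasTemperateGrowth.comp
    (hasTemperateGrowth_fderiv_of_bounded hV.smooth hV.bounded_deriv)

lemma hasTemperateGrowth_hessV (j k : Fin d) : (hessV V j k).HasTemperateGrowth :=
  hasTemperateGrowth_fderiv_apply (hV.hasTemperateGrowth_dV k) _

lemma hessV_symm (j k : Fin d) (x : Pos d) : hessV V j k x = hessV V k j x := by
  have h1 : ContDiff ℝ ∞ (fderiv ℝ V) := hV.smooth.fderiv_right (by simp)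
  have h : ∀ j k, hessV V j k x =
      fderiv ℝ (fderiv ℝ V) x (EuclideanSpace.single j 1) (EuclideanSpace.single k 1) := by
    intro j k
    unfold hessV
    change fderiv ℝ (fun x => fderiv ℝ V x (EuclideanSpace.single k 1)) x _ = _
    rw [fderiv_clm_apply (h1.differentiable (by simp)).differentiableAt (differentiableAt_const _)]
    simp
  rw [h, h]
  have h2 : (2 : WithTop ℕ∞) ≤ ∞ := WithTop.coe_le_coe.mpr (le_top : (2 : ℕ∞) ≤ ⊤)
  exact (hV.smooth.contDiffAt.isSymmSndFDerivAt (by simpa using h2)).eq _ _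

lemma abs_hessV_le {M : ℝ} (hM : ∀ x, ‖iteratedFDeriv ℝ 2 V x‖ ≤ M) (j k : Fin d) (x : Pos d) :
    |hessV V j k x| ≤ M := by
  have h1 := norm_iteratedFDeriv_fderiv_apply_le (hV.contDiff_dV k) (norm_single_le j) 0 x
  have h2 := norm_iteratedFDeriv_fderiv_apply_le hV.smooth (norm_single_le k) 1 x
  rw [norm_iteratedFDeriv_zero] at h1
  exact h1.trans (h2.trans (hM x))

lemma abs_fderiv_hessV_le {M : ℝ} (hM : ∀ x, ‖iteratedFDeriv ℝ 3 V x‖ ≤ M) (l j k : Fin d)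
    (x : Pos d) : |fderiv ℝ (hessV V j k) x (EuclideanSpace.single l 1)| ≤ M := by
  have h0 := norm_iteratedFDeriv_fderiv_apply_le (hV.contDiff_hessV j k) (norm_single_le l) 0 x
  have h1 := norm_iteratedFDeriv_fderiv_apply_le (hV.contDiff_dV k) (norm_single_le j) 1 x
  have h2 := norm_iteratedFDeriv_fderiv_apply_le hV.smooth (norm_single_le k) 2 x
  rw [norm_iteratedFDeriv_zero] at h0
  exact h0.trans (h1.trans (h2.trans (hM x)))

end IsConfining

/-- The embedding of Schwartz space in `L²`. -/
noncomputable def toH (d : ℕ) : 𝓢(Phase d, ℂ) →ₗ[ℂ] H d :=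
  (SchwartzMap.toLpCLM ℂ ℂ 2 (volume : Measure (Phase d))).toLinearMap

lemma hasTemperateGrowth_vel (j : Fin d) : (fun z : Phase d => z.2 j).HasTemperateGrowth :=
  ((EuclideanSpace.proj j).comp (ContinuousLinearMap.snd ℝ (Pos d) (Pos d))).hasTemperateGrowth

lemma fderiv_vel (j : Fin d) (z m : Phase d) : fderiv ℝ (fun z : Phase d => z.2 j) z m = m.2 j := by
  have := ((EuclideanSpace.proj (𝕜 := ℝ) j).comp
    (ContinuousLinearMap.snd ℝ (Pos d) (Pos d))).hasFDerivAt (x := z)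
  exact congrArg (fun A : Phase d →L[ℝ] ℝ => A m) this.fderiv

/-- The operators `a_j`, `b_j` and their formal adjoints on Schwartz space. -/
noncomputable def kineticSystem {V : Pos d → ℝ} (hV : IsConfining V) {γ M₂ M₃ : ℝ} (hγ : 0 < γ)
    (h₂ : ∀ x, ‖iteratedFDeriv ℝ 2 V x‖ ≤ M₂) (h₃ : ∀ x, ‖iteratedFDeriv ℝ 3 V x‖ ≤ M₃) :
    KineticSystem d γ M₂ (Real.sqrt γ * M₃) (toH d) :=
  have hx : ∀ j, (fun z : Phase d => dV V j z.1).HasTemperateGrowth := fun j =>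
    (hV.hasTemperateGrowth_dV j).comp hasTemperateGrowth_fst
  have hh : ∀ j k, (fun z : Phase d => hessV V j k z.1).HasTemperateGrowth := fun j k =>
    (hV.hasTemperateGrowth_hessV j k).comp hasTemperateGrowth_fst
  have hv := hasTemperateGrowth_vel (d := d)
  have hxx : ∀ j k z, fderiv ℝ (fun z : Phase d => dV V j z.1) z (posDir k) = hessV V k j z.1 :=
    fun j k z => fderiv_comp_fst_apply ((hV.contDiff_dV j).differentiable (by simp)) z _
  have hxv : ∀ j k z, fderiv ℝ (fun z : Phase d => dV V j z.1) z (velDir k) = 0 := fun j k z => by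
    rw [fderiv_comp_fst_apply ((hV.contDiff_dV j).differentiable (by simp)) z _]; simp [velDir]
  have hvx : ∀ j k z, fderiv ℝ (fun z : Phase d => z.2 j) z (posDir k) = 0 := fun j k z => by
    rw [fderiv_vel]; simp [posDir]
  have hvv : ∀ j k z, fderiv ℝ (fun z : Phase d => z.2 j) z (velDir k) = if k = j then 1 else 0 :=
    fun j k z => by rw [fderiv_vel]; simp [velDir, eq_comm]
  have hhv : ∀ j k l z, fderiv ℝ (fun z : Phase d => hessV V j k z.1) z (velDir l) = 0 :=
    fun j k l z => by
      rw [fderiv_comp_fst_apply ((hV.contDiff_hessV j k).differentiable (by simp)) z _]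
      simp [velDir]
  have hhx : ∀ j k l z, fderiv ℝ (fun z : Phase d => hessV V j k z.1) z (posDir l) =
      fderiv ℝ (hessV V j k) z.1 (EuclideanSpace.single l 1) := fun j k l z =>
    fderiv_comp_fst_apply ((hV.contDiff_hessV j k).differentiable (by simp)) z _
  { a := fun j => annihilation γ (posDir j) fun z => dV V j z.1
    a' := fun j => creation γ (posDir j) fun z => dV V j z.1
    b := fun j => annihilation γ (velDir j) fun z => z.2 j
    b' := fun j => creation γ (velDir j) fun z => z.2 j
    V := fun j k => mulOp fun z => hessV V j k z.1
    aa := fun j k u => annihilation_comm (hx j) (hx k)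
      (fun z => by rw [hxx, hxx, hV.hessV_symm]) u
    a'a' := fun j k u => creation_comm (hx j) (hx k)
      (fun z => by rw [hxx, hxx, hV.hessV_symm]) u
    bb := fun j k u => annihilation_comm (hv j) (hv k)
      (fun z => by rw [hvv, hvv]; simp [eq_comm]) u
    b'b' := fun j k u => creation_comm (hv j) (hv k)
      (fun z => by rw [hvv, hvv]; simp [eq_comm]) u
    ab := fun j k u => annihilation_comm (hx j) (hv k) (fun z => by rw [hvx, hxv]) u
    ab' := fun j k u => by
      rw [annihilation_creation (hx j) (hv k) hγ.le fun z => by rw [hvx, hxv]]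
      simp [hvx, mulOp_zero]
    a'b := fun j k u => by
      rw [annihilation_creation (hv k) (hx j) hγ.le fun z => by rw [hvx, hxv]]
      simp [hxv, mulOp_zero]
    a'b' := fun j k u => creation_comm (hx j) (hv k) (fun z => by rw [hvx, hxv]) u
    ccrA := fun j k u => by
      rw [annihilation_creation (hx j) (hx k) hγ.le fun z => by rw [hxx, hxx, hV.hessV_symm]]
      simp only [hxx]
    ccrB := fun j k u => by
      rw [annihilation_creation (hv j) (hv k) hγ.le fun z => by rw [hvv, hvv]; simp [eq_comm]]
      simp only [hvv]
      split_ifs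
      · rw [mulOp_one]; rfl
      · rw [mulOp_zero]; simp
    b'V := fun j k l u => by
      rw [creation_mulOp (hv j) _ (hh k l)]
      simp [hhv, mulOp_zero]
    adjA := fun j u w => inner_annihilation (hx j) _ u w
    adjB := fun j u w => inner_annihilation (hv j) _ u w
    boundV := fun j k u => norm_mulOp_le (hh j k) (fun z => hV.abs_hessV_le h₂ j k z.1) u
    -- The commutator of `a' j` with a Hessian entry is multiplication by `-√γ` times a third
    -- derivative of the potential, whence the constant `√γ M₃`.
    boundComm := fun j k l u => by
      rw [creation_mulOp (hx j) _ (hh k l), map_sub, sub_sub_cancel_left, norm_neg, map_smul,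
        norm_smul, Complex.norm_real, Real.norm_of_nonneg (Real.sqrt_nonneg _), mul_assoc]
      refine mul_le_mul_of_nonneg_left ?_ (Real.sqrt_nonneg _)
      exact norm_mulOp_le (hasTemperateGrowth_fderiv_apply (hh k l) _)
        (fun z => by rw [hhx]; exact hV.abs_fderiv_hessV_le h₃ j k l z.1) u }

end RelaxationBoltzmann

/-! ### Schwartz functions `h ⊗ μ_∞^{1/2}` -/

section GaussianDecay

universe u

/-- Derivatives of `e^{-q} p` are bounded by a polynomial times `e^{-q}`. -/
lemma norm_iteratedFDeriv_exp_smul_le {E : Type u} [NormedAddCommGroup E] [NormedSpace ℝ E]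
    {q : E → ℝ} (hq : q.HasTemperateGrowth) (n : ℕ) :
    ∀ {F : Type u} [NormedAddCommGroup F] [NormedSpace ℝ F] {p : E → F},
      p.HasTemperateGrowth → ∃ (k : ℕ) (C : ℝ), 0 ≤ C ∧ ∀ z,
        ‖iteratedFDeriv ℝ n (fun z => Real.exp (-q z) • p z) z‖ ≤
          C * (1 + ‖z‖) ^ k * Real.exp (-q z) := by
  induction n with
  | zero =>
    intro F _ _ p hp
    obtain ⟨k, C, hC, h⟩ := hp.norm_iteratedFDeriv_le_uniform 0
    refine ⟨k, C, hC, fun z => ?_⟩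
    have := h 0 le_rfl z
    rw [norm_iteratedFDeriv_zero] at this ⊢
    rw [norm_smul, Real.norm_of_nonneg (Real.exp_pos _).le, mul_comm]
    gcongr
  | succ n ih =>
    intro F _ _ p hp
    -- Differentiating `e^{-q} p` gives `e^{-q}` times this function, of the same kind but valued in
    -- `E →L[ℝ] F`; hence the induction runs over all target spaces.
    have hp' : (fun z => fderiv ℝ p z - (fderiv ℝ q z).smulRight (p z)).HasTemperateGrowth :=
      (hasTemperateGrowth_fderiv hp).sub
        ((ContinuousLinearMap.smulRightL ℝ E F).bilinear_hasTemperateGrowth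
          (hasTemperateGrowth_fderiv hq) hp)
    obtain ⟨k, C, hC, h⟩ := ih hp'
    refine ⟨k, C, hC, fun z => ?_⟩
    rw [← norm_iteratedFDeriv_fderiv]
    convert h z using 4
    rename_i y
    have h1 : HasFDerivAt q (fderiv ℝ q y) y :=
      (hq.1.differentiable (by simp)).differentiableAt.hasFDerivAt
    have h2 : HasFDerivAt p (fderiv ℝ p y) y :=
      (hp.1.differentiable (by simp)).differentiableAt.hasFDerivAt
    refine ((h1.fun_neg.exp).smul h2).fderiv.trans ?_
    ext m
    simp [smul_smul, sub_eq_add_neg]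

/-- Combine `s ^ m ≤ m! e ^ s` at `s = 1 + t` with `1 + t - t² / 4 ≤ 2`, where equality holds at `t
= 2`. -/
lemma one_add_pow_mul_exp_le (m : ℕ) {t : ℝ} (ht : 0 ≤ t) :
    (1 + t) ^ m * Real.exp (-(t ^ 2 / 4)) ≤ m.factorial * Real.exp 2 := by
  have h1 := Real.pow_div_factorial_le_exp (1 + t) (by linarith) m
  rw [div_le_iff₀ (by positivity)] at h1
  calc (1 + t) ^ m * Real.exp (-(t ^ 2 / 4))
      ≤ (Real.exp (1 + t) * m.factorial) * Real.exp (-(t ^ 2 / 4)) := by gcongr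
    _ = m.factorial * Real.exp (1 + t + -(t ^ 2 / 4)) := by rw [Real.exp_add (1 + t)]; ring
    _ ≤ m.factorial * Real.exp 2 := by
      gcongr
      nlinarith [sq_nonneg (t - 2)]

/-- A function of temperate growth times a Gaussian is a Schwartz function. -/
noncomputable def gaussianSchwartz {E F : Type u} [NormedAddCommGroup E] [NormedSpace ℝ E]
    [NormedAddCommGroup F] [NormedSpace ℝ F] {q : E → ℝ} (hq : q.HasTemperateGrowth)
    (hq' : ∀ z, ‖z‖ ^ 2 / 4 ≤ q z) {p : E → F} (hp : p.HasTemperateGrowth) : 𝓢(E, F) where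
  toFun := fun z => Real.exp (-q z) • p z
  smooth' := (Real.contDiff_exp.comp hq.1.neg).smul hp.1
  decay' := fun k n => by
    obtain ⟨l, C, hC, h⟩ := norm_iteratedFDeriv_exp_smul_le hq n hp
    refine ⟨C * ((k + l).factorial * Real.exp 2), fun z => ?_⟩
    calc ‖z‖ ^ k * ‖iteratedFDeriv ℝ n (fun z => Real.exp (-q z) • p z) z‖
        ≤ (1 + ‖z‖) ^ k * (C * (1 + ‖z‖) ^ l * Real.exp (-(‖z‖ ^ 2 / 4))) := by
          gcongr
          · linarith
          · refine (h z).trans ?_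
            gcongr
            exact hq' z
      _ = C * ((1 + ‖z‖) ^ (k + l) * Real.exp (-(‖z‖ ^ 2 / 4))) := by rw [pow_add]; ring
      _ ≤ _ := mul_le_mul_of_nonneg_left (one_add_pow_mul_exp_le _ (norm_nonneg z)) hC

end GaussianDecay

namespace RelaxationBoltzmann

variable {d : ℕ}

/-- The square root of the velocity Maxwellian. -/
noncomputable def sqrtMu (v : Pos d) : ℝ := Real.sqrt (muInf v)

lemma muInf_pos (v : Pos d) : 0 < muInf v := by unfold muInf; positivity

lemma sqrtMu_pos (v : Pos d) : 0 < sqrtMu v := Real.sqrt_pos.mpr (muInf_pos v)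

lemma sqrtMu_sq (v : Pos d) : sqrtMu v ^ 2 = muInf v := Real.sq_sqrt (muInf_pos v).le

lemma sqrtMu_eq (v : Pos d) :
    sqrtMu v = Real.exp (-(‖v‖ ^ 2 / 4)) * (Real.sqrt ((2 * Real.pi) ^ ((d : ℝ) / 2)))⁻¹ := by
  unfold sqrtMu muInf
  rw [Real.sqrt_div (Real.exp_pos _).le, div_eq_mul_inv, ← Real.exp_half]
  congr 2
  ring

lemma integral_muInf : ∫ v : Pos d, muInf v = 1 := by
  unfold muInf
  rw [integral_div]
  have h := GaussianFourier.integral_rexp_neg_mul_sq_norm (V := Pos d) (b := 1 / 2) (by norm_num)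
  have h2 : ∀ v : Pos d, -‖v‖ ^ 2 / 2 = -(1 / 2) * ‖v‖ ^ 2 := fun v => by ring
  simp only [h2, h, finrank_euclideanSpace, Fintype.card_fin]
  rw [div_eq_one_iff_eq (by positivity)]
  congr 1
  ring

lemma integrable_muInf : Integrable (muInf : Pos d → ℝ) := by
  by_contra h
  have := integral_undef h
  rw [integral_muInf] at this
  exact one_ne_zero this

lemma hasFDerivAt_sqrtMu (v : Pos d) :
    HasFDerivAt (sqrtMu : Pos d → ℝ) (-(sqrtMu v / 2) • innerSL ℝ v) v := by
  have h0 : (sqrtMu : Pos d → ℝ) = fun v => Real.exp (-(1 / 4 * ‖v‖ ^ 2)) *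
      (Real.sqrt ((2 * Real.pi) ^ ((d : ℝ) / 2)))⁻¹ := by
    funext v
    rw [sqrtMu_eq]; congr 3; ring
  have h1 := (((hasStrictFDerivAt_norm_sq v).hasFDerivAt.const_mul (1 / 4 : ℝ)).fun_neg.exp).mul_const
    (Real.sqrt ((2 * Real.pi) ^ ((d : ℝ) / 2)))⁻¹
  rw [h0]
  refine h1.congr_fderiv ?_
  ext w
  simp
  ring

lemma continuous_sqrtMu : Continuous (sqrtMu : Pos d → ℝ) :=
  continuous_iff_continuousAt.mpr fun v => (hasFDerivAt_sqrtMu v).continuousAt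

/-- `k ⊗ μ_∞^{1/2}`. -/
noncomputable def tensorMu (k : Pos d → ℂ) (z : Phase d) : ℂ := k z.1 * (sqrtMu z.2 : ℂ)

/-- `h ⊗ μ_∞^{1/2}` as a Schwartz function, for a test function `h`. -/
noncomputable def tensorSchwartz {h : Pos d → ℂ} (hc : HasCompactSupport h) (hs : ContDiff ℝ ∞ h) :
    𝓢(Phase d, ℂ) :=
  have hq1 : (fun x : Pos d => ‖x‖ ^ 2 / 4).HasTemperateGrowth := by
    have := (Function.HasTemperateGrowth.const (1 / 4 : ℝ)).mul
      (Function.hasTemperateGrowth_norm_sq (Pos d))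
    have e : (fun x : Pos d => ‖x‖ ^ 2 / 4) = (fun _ => (1 / 4 : ℝ)) * fun x => ‖x‖ ^ 2 := by
      ext x; rw [Pi.mul_apply]; ring
    rw [e]; exact this
  -- The weight must decay in `x` as well, so a Gaussian in `x` is inserted and its inverse is
  -- absorbed by the compactly supported factor.
  gaussianSchwartz (q := fun z : Phase d => ‖z.1‖ ^ 2 / 4 + ‖z.2‖ ^ 2 / 4)
    (p := fun z : Phase d => ((Real.sqrt ((2 * Real.pi) ^ ((d : ℝ) / 2)))⁻¹ *
      Real.exp (‖z.1‖ ^ 2 / 4)) • h z.1)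
    ((hq1.comp (ContinuousLinearMap.fst ℝ (Pos d) (Pos d)).hasTemperateGrowth).add
      (hq1.comp (ContinuousLinearMap.snd ℝ (Pos d) (Pos d)).hasTemperateGrowth))
    (fun z => by
      rcases le_total ‖z.1‖ ‖z.2‖ with h | h
      · rw [Prod.norm_def, max_eq_right h]; nlinarith [norm_nonneg z.1]
      · rw [Prod.norm_def, max_eq_left h]; nlinarith [norm_nonneg z.2])
    (Function.HasTemperateGrowth.comp
      (g := fun x : Pos d => ((Real.sqrt ((2 * Real.pi) ^ ((d : ℝ) / 2)))⁻¹ *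
        Real.exp (‖x‖ ^ 2 / 4)) • h x)
      (hc.smul_left.hasTemperateGrowth
        ((contDiff_const.mul (Real.contDiff_exp.comp ((contDiff_norm_sq ℝ).div_const 4))).smul hs))
      (ContinuousLinearMap.fst ℝ (Pos d) (Pos d)).hasTemperateGrowth)

lemma tensorSchwartz_apply {h : Pos d → ℂ} (hc : HasCompactSupport h) (hs : ContDiff ℝ ∞ h)
    (z : Phase d) : tensorSchwartz hc hs z = tensorMu h z := by
  change Real.exp (-(‖z.1‖ ^ 2 / 4 + ‖z.2‖ ^ 2 / 4)) •
    (((Real.sqrt ((2 * Real.pi) ^ ((d : ℝ) / 2)))⁻¹ * Real.exp (‖z.1‖ ^ 2 / 4)) • h z.1) = _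
  rw [smul_smul, tensorMu, sqrtMu_eq, Complex.real_smul, mul_comm]
  congr 2
  rw [neg_add, Real.exp_add]
  calc _ = Real.exp (-(‖z.1‖ ^ 2 / 4)) * Real.exp (‖z.1‖ ^ 2 / 4) *
        (Real.exp (-(‖z.2‖ ^ 2 / 4)) * (Real.sqrt ((2 * Real.pi) ^ ((d : ℝ) / 2)))⁻¹) := by ring
    _ = _ := by rw [← Real.exp_add, neg_add_cancel, Real.exp_zero, one_mul]

lemma hasFDerivAt_tensorMu {h : Pos d → ℂ} {z : Phase d} {h' : Pos d →L[ℝ] ℂ}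
    (hh : HasFDerivAt h h' z.1) :
    HasFDerivAt (tensorMu h) ((sqrtMu z.2 : ℂ) • h'.comp (ContinuousLinearMap.fst ℝ _ _) -
      (tensorMu h z) • Complex.ofRealCLM.comp ((1 / 2 : ℝ) •
        (innerSL ℝ z.2).comp (ContinuousLinearMap.snd ℝ (Pos d) (Pos d)))) z := by
  have h1 : HasFDerivAt (fun z : Phase d => h z.1) (h'.comp (ContinuousLinearMap.fst ℝ _ _)) z :=
    hh.comp z hasFDerivAt_fst
  have h2 : HasFDerivAt (fun z : Phase d => (sqrtMu z.2 : ℂ)) _ z :=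
    Complex.ofRealCLM.hasFDerivAt.comp z ((hasFDerivAt_sqrtMu z.2).comp z hasFDerivAt_snd)
  refine (h1.mul h2).congr_fderiv ?_
  ext m
  · simp [tensorMu]
  · simp [tensorMu]; ring

/-- The factor `μ_∞^{1/2}` is the ground state of the velocity oscillator: its `v_j`-derivative is
`-v_j / 2` times itself. -/
lemma b_tensorSchwartz {h : Pos d → ℂ} (hc : HasCompactSupport h) (hs : ContDiff ℝ ∞ h) (γ : ℝ)
    (j : Fin d) :
    annihilation γ (velDir j) (fun z : Phase d => z.2 j) (tensorSchwartz hc hs) = 0 := by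
  ext z
  rw [annihilation_apply (hasTemperateGrowth_vel j),
    show (tensorSchwartz hc hs : Phase d → ℂ) = tensorMu h from
      funext (tensorSchwartz_apply hc hs),
    (hasFDerivAt_tensorMu (hs.differentiable (by simp)).differentiableAt.hasFDerivAt).fderiv]
  have e : ⟪z.2, EuclideanSpace.single j (1 : ℝ)⟫_ℝ = z.2 j := by
    rw [EuclideanSpace.inner_single_right]; simp
  simp only [velDir, sub_apply, smul_apply,
    ContinuousLinearMap.comp_apply, ContinuousLinearMap.coe_fst', ContinuousLinearMap.coe_snd',
    innerSL_apply_apply, e, map_zero, smul_eq_mul, Complex.ofRealCLM_apply]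
  push_cast
  change _ = (0 : ℂ)
  ring

end RelaxationBoltzmann

/-! ### The velocity projection `Π₁` on `L²` -/

namespace RelaxationBoltzmann

variable {d : ℕ}

/-- The complex Hilbert space `L²(ℝᵈ, dx)`. -/
abbrev HPos (d : ℕ) : Type := Lp ℂ 2 (volume : Measure (Pos d))

lemma norm_tensorMu_sq (k : Pos d → ℂ) (z : Phase d) :
    ‖tensorMu k z‖ ^ 2 = ‖k z.1‖ ^ 2 * muInf z.2 := by
  rw [tensorMu, norm_mul, mul_pow, Complex.norm_real, Real.norm_eq_abs, sq_abs, sqrtMu_sq]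

lemma aestronglyMeasurable_tensorMu {k : Pos d → ℂ} (hk : AEStronglyMeasurable k volume) :
    AEStronglyMeasurable (tensorMu k) (volume : Measure (Phase d)) :=
  hk.comp_fst.mul
    (Complex.continuous_ofReal.comp (continuous_sqrtMu.comp continuous_snd)).aestronglyMeasurable

lemma memLp_tensorMu {k : Pos d → ℂ} (hk : MemLp k 2 volume) :
    MemLp (tensorMu k) 2 (volume : Measure (Phase d)) := by
  rw [memLp_two_iff_integrable_sq_norm (aestronglyMeasurable_tensorMu hk.1)]
  simp only [norm_tensorMu_sq]
  exact ((memLp_two_iff_integrable_sq_norm hk.1).mp hk).mul_prod integrable_muInf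

lemma tensorMu_congr {k k' : Pos d → ℂ} (h : k =ᵐ[volume] k') :
    tensorMu k =ᵐ[(volume : Measure (Phase d))] tensorMu k' := by
  have := Measure.quasiMeasurePreserving_fst (μ := (volume : Measure (Pos d)))
    (ν := (volume : Measure (Pos d))) |>.ae_eq_comp h
  filter_upwards [this] with z hz
  simp only [Function.comp_apply] at hz
  rw [tensorMu, tensorMu, hz]

/-- The isometry `k ↦ k ⊗ μ_∞^{1/2}` of `L²(ℝᵈ)` into `L²(ℝ²ᵈ)`. -/
noncomputable def tensorIso (d : ℕ) : HPos d →ₗᵢ[ℂ] H d where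
  toFun k := (memLp_tensorMu (Lp.memLp k)).toLp
  map_add' k k' := by
    ext1
    filter_upwards [(memLp_tensorMu (Lp.memLp (k + k'))).coeFn_toLp,
      Lp.coeFn_add (memLp_tensorMu (Lp.memLp k)).toLp (memLp_tensorMu (Lp.memLp k')).toLp,
      (memLp_tensorMu (Lp.memLp k)).coeFn_toLp, (memLp_tensorMu (Lp.memLp k')).coeFn_toLp,
      tensorMu_congr (Lp.coeFn_add k k')] with z h1 h2 h3 h4 h5
    rw [h1, h2, Pi.add_apply, h3, h4, h5]
    simp [tensorMu, add_mul]
  map_smul' c k := by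
    ext1
    filter_upwards [(memLp_tensorMu (Lp.memLp (c • k))).coeFn_toLp,
      Lp.coeFn_smul c (memLp_tensorMu (Lp.memLp k)).toLp,
      (memLp_tensorMu (Lp.memLp k)).coeFn_toLp,
      tensorMu_congr (Lp.coeFn_smul c k)] with z h1 h2 h3 h5
    rw [RingHom.id_apply, h1, h2, Pi.smul_apply, h3, h5]
    simp [tensorMu, mul_assoc]
  norm_map' k := by
    have h : ∀ {X : Type} [MeasureSpace X] (f : Lp ℂ 2 (volume : Measure X)),
        ‖f‖ ^ 2 = ∫ x, ‖f x‖ ^ 2 := fun f => by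
      have h1 := L2.inner_def (𝕜 := ℂ) f f
      have h2 : ∀ z : ℂ, ⟪z, z⟫_ℂ = ((‖z‖ ^ 2 : ℝ) : ℂ) := fun z => by
        rw [inner_self_eq_norm_sq_to_K]; push_cast; rfl
      rw [inner_self_eq_norm_sq_to_K] at h1
      simp only [h2] at h1
      rw [integral_complex_ofReal] at h1
      refine Complex.ofReal_injective ?_
      rw [← h1]; push_cast; rfl
    rw [← sq_eq_sq₀ (norm_nonneg _) (norm_nonneg _), h, h]
    calc ∫ z, ‖(memLp_tensorMu (Lp.memLp k)).toLp (tensorMu k) z‖ ^ 2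
        = ∫ z : Phase d, ‖k z.1‖ ^ 2 * muInf z.2 := by
          refine integral_congr_ae ?_
          filter_upwards [(memLp_tensorMu (Lp.memLp k)).coeFn_toLp] with z hz
          rw [hz, norm_tensorMu_sq]
      _ = (∫ x, ‖k x‖ ^ 2) * ∫ v : Pos d, muInf v := integral_prod_mul
          (μ := (volume : Measure (Pos d))) (ν := (volume : Measure (Pos d)))
          (fun x => ‖k x‖ ^ 2) muInf
      _ = _ := by rw [integral_muInf, mul_one]

lemma tensorIso_coeFn (k : HPos d) : tensorIso d k =ᵐ[volume] tensorMu k :=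
  (memLp_tensorMu (Lp.memLp k)).coeFn_toLp

lemma tensorIso_toLp {h : Pos d → ℂ} (hh : MemLp h 2 volume) :
    tensorIso d hh.toLp =ᵐ[volume] tensorMu h :=
  (tensorIso_coeFn _).trans (tensorMu_congr hh.coeFn_toLp)

lemma toH_coeFn (u : 𝓢(Phase d, ℂ)) : toH d u =ᵐ[volume] u := u.coeFn_toLp 2 volume

lemma tensorIso_eq_toH {h : Pos d → ℂ} (hc : HasCompactSupport h) (hs : ContDiff ℝ ∞ h)
    (hh : MemLp h 2 volume) : tensorIso d hh.toLp = toH d (tensorSchwartz hc hs) := by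
  ext1
  filter_upwards [tensorIso_toLp hh, toH_coeFn (tensorSchwartz hc hs)] with z h1 h2
  rw [h1, h2, tensorSchwartz_apply]

/-- The partial integral `∫ u(x, w) μ_∞(w)^{1/2} dw`. -/
noncomputable def velocityAverage (u : Phase d → ℂ) (x : Pos d) : ℂ :=
  ∫ w : Pos d, u (x, w) * (sqrtMu w : ℂ)

lemma integrable_mul_sqrtMu (u : 𝓢(Phase d, ℂ)) :
    Integrable (fun z : Phase d => u z * (sqrtMu z.2 : ℂ)) volume := by
  have hb : ∃ C, ∀ v : Pos d, ‖(sqrtMu v : ℂ)‖ ≤ C := by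
    refine ⟨(Real.sqrt ((2 * Real.pi) ^ ((d : ℝ) / 2)))⁻¹, fun v => ?_⟩
    rw [Complex.norm_real, Real.norm_of_nonneg (sqrtMu_pos v).le, sqrtMu_eq]
    refine mul_le_of_le_one_left (by positivity) ?_
    rw [Real.exp_le_one_iff]
    nlinarith [norm_nonneg v]
  obtain ⟨C, hC⟩ := hb
  exact u.integrable.mul_bdd
    (Complex.continuous_ofReal.comp (continuous_sqrtMu.comp continuous_snd)).aestronglyMeasurable
    (Filter.Eventually.of_forall fun z => hC z.2)

lemma integrable_velocityAverage (u : 𝓢(Phase d, ℂ)) :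
    Integrable (velocityAverage u) volume :=
  (integrable_mul_sqrtMu u).integral_prod_left

/-- Testing against smooth compactly supported functions of `x` and applying Fubini identifies the
abstract adjoint with the velocity integral occurring in `Π₁`. -/
lemma adjoint_tensorIso_coeFn (u : 𝓢(Phase d, ℂ)) :
    (tensorIso d).toContinuousLinearMap.adjoint (toH d u) =ᵐ[volume] velocityAverage u := by
  refine ae_eq_of_integral_contDiff_smul_eq
    ((Lp.memLp _).locallyIntegrable (by norm_num)) (integrable_velocityAverage u).locallyIntegrable
    fun g hs hc => ?_
  set h : Pos d → ℂ := fun x => (g x : ℂ) with hdef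
  have hhc : HasCompactSupport h := hc.comp_left (g := fun x : ℝ => (x : ℂ)) Complex.ofReal_zero
  have hhs : ContDiff ℝ ∞ h := Complex.ofRealCLM.contDiff.comp hs
  have hh : MemLp h 2 volume := hhs.continuous.memLp_of_hasCompactSupport hhc
  calc ∫ x, g x • (tensorIso d).toContinuousLinearMap.adjoint (toH d u) x
      = ⟪hh.toLp, (tensorIso d).toContinuousLinearMap.adjoint (toH d u)⟫_ℂ := by
        rw [L2.inner_def]
        refine integral_congr_ae ?_
        filter_upwards [hh.coeFn_toLp] with x hx
        rw [hx]
        simp [hdef, RCLike.inner_apply, mul_comm]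
    _ = ⟪tensorIso d hh.toLp, toH d u⟫_ℂ := ContinuousLinearMap.adjoint_inner_right _ _ _
    _ = ∫ z : Phase d, (g z.1 : ℂ) * (u z * (sqrtMu z.2 : ℂ)) := by
        rw [L2.inner_def]
        refine integral_congr_ae ?_
        filter_upwards [tensorIso_toLp hh, toH_coeFn u] with z h1 h2
        rw [h1, h2]
        simp only [tensorMu, hdef, RCLike.inner_apply, map_mul, Complex.conj_ofReal]
        ring
    _ = ∫ x, ∫ w, (g x : ℂ) * (u (x, w) * (sqrtMu w : ℂ)) := by
        refine integral_prod (fun z : Phase d => (g z.1 : ℂ) * (u z * (sqrtMu z.2 : ℂ))) ?_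
        obtain ⟨C, hC⟩ := hhs.continuous.bounded_above_of_compact_support hhc
        exact (integrable_mul_sqrtMu u).bdd_mul
          (hhs.continuous.comp continuous_fst).aestronglyMeasurable
          (Filter.Eventually.of_forall fun z : Phase d => hC z.1)
    _ = ∫ x, g x • velocityAverage u x := by
        refine integral_congr_ae (Filter.Eventually.of_forall fun x => ?_)
        simp only [velocityAverage, Complex.real_smul]
        rw [integral_const_mul]

/-- The orthogonal projection `Π₁` of `L²`. -/
noncomputable def projMu (f : H d) : H d :=
  tensorIso d ((tensorIso d).toContinuousLinearMap.adjoint f)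

lemma opPi1_ae_eq (u : 𝓢(Phase d, ℂ)) : opPi1 u =ᵐ[volume] projMu (toH d u) := by
  filter_upwards [tensorIso_coeFn ((tensorIso d).toContinuousLinearMap.adjoint (toH d u)),
    tensorMu_congr (adjoint_tensorIso_coeFn u)] with z h1 h2
  rw [projMu, h1, h2]
  rfl

lemma inner_projMu_left (f : H d) (k : HPos d) :
    ⟪tensorIso d k, projMu f⟫_ℂ = ⟪tensorIso d k, f⟫_ℂ := by
  rw [projMu, LinearIsometry.inner_map_map, ContinuousLinearMap.adjoint_inner_right]
  rfl

/-- The range of `Π₁` is the closure of Schwartz functions killed by all `b_j`. -/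
lemma projMu_mem_closure (γ : ℝ) (f : H d) :
    projMu f ∈ closure {g | ∃ e : 𝓢(Phase d, ℂ),
      (∀ j, annihilation γ (velDir j) (fun z : Phase d => z.2 j) e = 0) ∧ toH d e = g} := by
  have hd := MeasureTheory.Lp.dense_hasCompactSupport_contDiff (F := ℂ) (p := 2)
    (μ := (volume : Measure (Pos d))) (by norm_num)
    ((tensorIso d).toContinuousLinearMap.adjoint f)
  refine map_mem_closure (f := tensorIso d) (tensorIso d).continuous hd ?_
  rintro k ⟨h, hk, hc, hs⟩
  have hh : MemLp h 2 volume := hs.continuous.memLp_of_hasCompactSupport hc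
  have : k = hh.toLp := by ext1; exact hk.trans hh.coeFn_toLp.symm
  refine ⟨tensorSchwartz hc hs, fun j => b_tensorSchwartz hc hs γ j, ?_⟩
  rw [this, tensorIso_eq_toH hc hs]

end RelaxationBoltzmann

/-! ### Fixed vectors of `Λ⁻²` are multiples of the ground state -/

section WeakDerivative

open ContinuousLinearMap in
/-- A locally integrable function with zero weak gradient is constant almost everywhere. -/
theorem exists_ae_eq_const_of_weak_fderiv_eq_zero {E : Type*} [NormedAddCommGroup E]
    [NormedSpace ℝ E] [FiniteDimensional ℝ E] [MeasurableSpace E] [BorelSpace E] {μ : Measure E}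
    [μ.IsAddHaarMeasure] {g : E → ℂ} (hg : LocallyIntegrable g μ)
    (h : ∀ φ : E → ℝ, ContDiff ℝ ∞ φ → HasCompactSupport φ → ∀ w,
      ∫ z, fderiv ℝ φ z w • g z ∂μ = 0) : ∃ c : ℂ, g =ᵐ[μ] fun _ => c := by
  -- The derivative of a mollification pairs `g` with the gradient of a reflected and translated
  -- test function, so every mollification is constant.
  have hconst : ∀ φ : E → ℝ, ContDiff ℝ ∞ φ → HasCompactSupport φ → ∀ x y,
      (convolution φ g (lsmul ℝ ℝ) μ) x = (convolution φ g (lsmul ℝ ℝ) μ) y := by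
    intro φ hs hc
    rw [← convolution_flip]
    have h1 := hc.hasFDerivAt_convolution_right (lsmul ℝ ℝ : ℝ →L[ℝ] ℂ →L[ℝ] ℂ).flip hg
      (hs.of_le (by norm_num))
    refine is_const_of_fderiv_eq_zero (𝕜 := ℝ) (fun x => (h1 x).differentiableAt) fun x => ?_
    rw [(h1 x).fderiv]
    ext w
    rw [convolution_precompR_apply _ hg (hc.fderiv ℝ)
      (hs.continuous_fderiv (by norm_num))]
    simp only [convolution_def, flip_apply, lsmul_apply, zero_apply]
    set ψ : E → ℝ := fun t => φ (x - t) with hψ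
    have hψs : ContDiff ℝ ∞ ψ := hs.comp (contDiff_const.sub contDiff_id)
    have hψc : HasCompactSupport ψ := by
      exact hc.comp_homeomorph (Homeomorph.subLeft x)
    have h2 : ∀ t, fderiv ℝ ψ t (-w) = fderiv ℝ φ (x - t) w := by
      intro t
      have h3 : HasFDerivAt ψ _ t := HasFDerivAt.comp t
        ((hs.differentiable (by norm_num)).differentiableAt.hasFDerivAt (x := x - t))
        ((hasFDerivAt_const x t).sub (hasFDerivAt_id t))
      rw [h3.fderiv]
      simp
    simpa only [h2] using h ψ hψs hψc (-w)
  -- Shrinking bumps whose outer radius is twice the inner one, matching `K := 2` in the almost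
  -- everywhere convergence of the mollifications.
  let φ : ℕ → ContDiffBump (0 : E) := fun n =>
    ⟨1 / ((n : ℝ) + 1), 2 * (1 / ((n : ℝ) + 1)), by positivity, by
      have : 0 < 1 / ((n : ℝ) + 1) := by positivity
      linarith⟩
  have hφ : Filter.Tendsto (fun n => (φ n).rOut) Filter.atTop (nhds 0) := by
    have := (tendsto_one_div_add_atTop_nhds_zero_nat (𝕜 := ℝ)).const_mul 2
    rw [mul_zero] at this
    exact this
  have h1 := ContDiffBump.ae_convolution_tendsto_right_of_locallyIntegrable (μ := μ) (K := 2) hφ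
    (Filter.Eventually.of_forall fun n => le_rfl) hg
  obtain ⟨x₀, hx₀⟩ := h1.exists
  refine ⟨g x₀, ?_⟩
  filter_upwards [h1] with x hx
  refine tendsto_nhds_unique hx (hx₀.congr fun n => ?_)
  exact hconst _ (φ n).contDiff_normed (φ n).hasCompactSupport_normed _ _

end WeakDerivative

section Fixed

variable {S H : Type*} [AddCommGroup S] [Module ℂ S] [NormedAddCommGroup H]
  [InnerProductSpace ℂ H]

namespace KineticSystem

variable {d : ℕ} {γ M M' : ℝ} {J : S →ₗ[ℂ] H} (T : KineticSystem d γ M M' J)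
  {R : H →L[ℂ] H}

/-- Fixed vectors of `Λ⁻²` are annihilated by all `a_j` and `b_j` in the weak sense. -/
lemma inner_eq_zero_of_fixed (hR : ∀ u, R (J (T.lam u)) = J u)
    (hd : DenseRange fun u => J (T.lam u)) {k : H} (hk : R k = k) (j : Fin d) (ψ : S) :
    ⟪k, J (T.a' j ψ)⟫_ℂ = 0 ∧ ⟪k, J (T.b' j ψ)⟫_ℂ = 0 := by
  -- At `x = Λ² φ` the bracket on the right equals `∑ ‖a φ‖² + ∑ ‖b φ‖²`. The inequality extends by
  -- density, and the bracket vanishes at a fixed vector.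
  have key : ∀ x : H, ‖⟪R x, J (T.a' j ψ)⟫_ℂ‖ ^ 2 + ‖⟪R x, J (T.b' j ψ)⟫_ℂ‖ ^ 2 ≤
      ((⟪x, R x⟫_ℂ).re - ‖R x‖ ^ 2) * ‖J ψ‖ ^ 2 := by
    intro x
    refine hd.induction_on (p := fun x => ‖⟪R x, J (T.a' j ψ)⟫_ℂ‖ ^ 2 +
      ‖⟪R x, J (T.b' j ψ)⟫_ℂ‖ ^ 2 ≤ ((⟪x, R x⟫_ℂ).re - ‖R x‖ ^ 2) * ‖J ψ‖ ^ 2) x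
      (isClosed_le (by fun_prop) (by fun_prop)) fun φ => ?_
    rw [hR, T.re_inner_lam_self, ← T.adjA, ← T.adjB]
    have i1 := norm_inner_le_norm (𝕜 := ℂ) (J (T.a j φ)) (J ψ)
    have i2 := norm_inner_le_norm (𝕜 := ℂ) (J (T.b j φ)) (J ψ)
    have i3 : ‖J (T.a j φ)‖ ^ 2 ≤ ∑ j, ‖J (T.a j φ)‖ ^ 2 :=
      Finset.single_le_sum (f := fun j => ‖J (T.a j φ)‖ ^ 2) (fun i _ => by positivity)
        (Finset.mem_univ j)
    have i4 : ‖J (T.b j φ)‖ ^ 2 ≤ ∑ j, ‖J (T.b j φ)‖ ^ 2 :=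
      Finset.single_le_sum (f := fun j => ‖J (T.b j φ)‖ ^ 2) (fun i _ => by positivity)
        (Finset.mem_univ j)
    calc _ ≤ (‖J (T.a j φ)‖ * ‖J ψ‖) ^ 2 + (‖J (T.b j φ)‖ * ‖J ψ‖) ^ 2 := by gcongr
      _ = (‖J (T.a j φ)‖ ^ 2 + ‖J (T.b j φ)‖ ^ 2) * ‖J ψ‖ ^ 2 := by ring
      _ ≤ _ := by gcongr; linarith
  have h1 := key k
  have h2 : (⟪k, k⟫_ℂ).re = ‖k‖ ^ 2 := inner_self_eq_norm_sq (𝕜 := ℂ) k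
  rw [hk, h2, sub_self, zero_mul] at h1
  constructor
  · have : ‖⟪k, J (T.a' j ψ)⟫_ℂ‖ ^ 2 = 0 := le_antisymm (by nlinarith) (by positivity)
    simpa using this
  · have : ‖⟪k, J (T.b' j ψ)⟫_ℂ‖ ^ 2 = 0 := le_antisymm (by nlinarith) (by positivity)
    simpa using this

/-- `Λ⁻²` is symmetric. -/
lemma resolvent_symm (hR : ∀ u, R (J (T.lam u)) = J u) (hd : DenseRange fun u => J (T.lam u))
    (x y : H) : ⟪R x, y⟫_ℂ = ⟪x, R y⟫_ℂ := by
  refine hd.induction_on (p := fun x => ⟪R x, y⟫_ℂ = ⟪x, R y⟫_ℂ) x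
    (isClosed_eq (by fun_prop) (by fun_prop)) fun φ => ?_
  refine hd.induction_on (p := fun y => ⟪R (J (T.lam φ)), y⟫_ℂ = ⟪J (T.lam φ), R y⟫_ℂ) y
    (isClosed_eq (by fun_prop) (by fun_prop)) fun ψ => ?_
  rw [hR, hR, T.lam_symm]

/-- `Λ⁻²` is nonnegative. -/
lemma resolvent_nonneg (hR : ∀ u, R (J (T.lam u)) = J u) (hd : DenseRange fun u => J (T.lam u))
    (x : H) : 0 ≤ (⟪x, R x⟫_ℂ).re := by
  refine hd.induction_on (p := fun x => 0 ≤ (⟪x, R x⟫_ℂ).re) x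
    (isClosed_le (by fun_prop) (by fun_prop)) fun φ => ?_
  rw [hR, T.re_inner_lam_self]
  positivity

/-- An upper bound for `Λ⁻²` at a core vector is a lower bound for `Λ²`. -/
lemma norm_sq_le_re_inner_lam (hR : ∀ u, R (J (T.lam u)) = J u)
    (hd : DenseRange fun u => J (T.lam u)) {f : S} {c : ℝ} (hc : 0 < c)
    (hf : (⟪J f, R (J f)⟫_ℂ).re ≤ c * ‖J f‖ ^ 2) :
    ‖J f‖ ^ 2 ≤ c * (⟪J (T.lam f), J f⟫_ℂ).re := by
  -- Expanding positivity at this vector gives `0 ≤ ⟪f, R f⟫ - 2 c ‖f‖² + c² ⟪Λ² f, f⟫`.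
  have h1 := T.resolvent_nonneg hR hd (J f - (c : ℂ) • J (T.lam f))
  have h2 : ⟪J f, J f⟫_ℂ = ((‖J f‖ ^ 2 : ℝ) : ℂ) := by
    rw [inner_self_eq_norm_sq_to_K]; push_cast; rfl
  have h3 : ⟪J f - (c : ℂ) • J (T.lam f), R (J f - (c : ℂ) • J (T.lam f))⟫_ℂ =
      ⟪J f, R (J f)⟫_ℂ - (2 * c * ‖J f‖ ^ 2 : ℝ) + (c ^ 2 : ℝ) * ⟪J (T.lam f), J f⟫_ℂ := by
    have h4 : ⟪J (T.lam f), R (J f)⟫_ℂ = ⟪J f, J f⟫_ℂ := by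
      rw [← T.resolvent_symm hR hd, hR]
    simp only [map_sub, map_smul, hR, inner_sub_left, inner_sub_right, inner_smul_left,
      inner_smul_right, Complex.conj_ofReal, h4, h2]
    push_cast
    ring
  rw [h3, Complex.add_re, Complex.sub_re, Complex.ofReal_re, Complex.re_ofReal_mul] at h1
  have h5 : c * ‖J f‖ ^ 2 ≤ c * (c * (⟪J (T.lam f), J f⟫_ℂ).re) := by nlinarith
  exact le_of_mul_le_mul_left h5 hc

end KineticSystem

end Fixed

section Kernel

variable {E : Type*} [NormedAddCommGroup E] [NormedSpace ℝ E]

/-- When `m` is a ground state, the creation operator is the conjugate `-√γ m⁻¹ ∂ m`, so on `φ / m`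
it only differentiates `φ`. -/
lemma creation_div_apply {g m φ : E → ℝ} (hg : g.HasTemperateGrowth) (hpos : ∀ z, 0 < m z)
    (hmd : Differentiable ℝ m) {γ : ℝ} {e : E} (he : ∀ z, fderiv ℝ m z e = -(g z / 2) * m z)
    {ψ : 𝓢(E, ℂ)} (hψ : ∀ z, ψ z = ((φ z / m z : ℝ) : ℂ)) (z : E) :
    creation γ e g ψ z = ((-(Real.sqrt γ * (fderiv ℝ φ z e / m z)) : ℝ) : ℂ) := by
  have hm0 := (hpos z).ne'
  have h1 : (fun z => (φ z : ℂ)) = fun z => (m z : ℂ) * ψ z := by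
    funext y
    rw [hψ, ← Complex.ofReal_mul, mul_div_cancel₀ _ (hpos y).ne']
  have h2 : HasFDerivAt (fun z => (m z : ℂ)) (Complex.ofRealCLM.comp (fderiv ℝ m z)) z :=
    Complex.ofRealCLM.hasFDerivAt.comp z (hmd z).hasFDerivAt
  have h3 : HasFDerivAt (fun z => (φ z : ℂ)) ((m z : ℂ) • fderiv ℝ ψ z +
      ψ z • (Complex.ofRealCLM.comp (fderiv ℝ m z))) z := by
    rw [h1]
    exact h2.mul (ψ.hasFDerivAt z)
  have h4 : HasFDerivAt φ (Complex.reCLM.comp _) z := Complex.reCLM.hasFDerivAt.comp z h3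
  have h5 : HasFDerivAt (fun z => (φ z : ℂ)) _ z := Complex.ofRealCLM.hasFDerivAt.comp z h4
  have h6 := congrArg (fun A : E →L[ℝ] ℂ => A e) (h5.unique h3)
  rw [← h4.fderiv] at h6
  simp only [ContinuousLinearMap.comp_apply, Complex.ofRealCLM_apply, add_apply, smul_apply,
    smul_eq_mul, he] at h6
  rw [creation_apply hg]
  have hm0' : (m z : ℂ) ≠ 0 := Complex.ofReal_ne_zero.mpr hm0
  push_cast at h6 ⊢
  rw [h6]
  field_simp
  ring

variable [FiniteDimensional ℝ E] [MeasurableSpace E] [BorelSpace E] {μ : Measure E}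
  [μ.IsAddHaarMeasure]

/-- A square integrable function orthogonal to the ranges of the creation operators
is a multiple of the ground state. -/
theorem exists_ae_eq_const_mul_of_inner_creation_eq_zero {ι : Type*} {e : ι → E}
    (hspan : Submodule.span ℝ (Set.range e) = ⊤) {g : ι → E → ℝ}
    (hg : ∀ i, (g i).HasTemperateGrowth) {m : E → ℝ} (hm : ContDiff ℝ ∞ m) (hpos : ∀ z, 0 < m z)
    (he : ∀ i z, fderiv ℝ m z (e i) = -(g i z / 2) * m z) {γ : ℝ} (hγ : 0 < γ) {k : Lp ℂ 2 μ}
    (hk : ∀ i ψ, ⟪k, (creation γ (e i) (g i) ψ).toLp 2 μ⟫_ℂ = 0) :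
    ∃ c : ℂ, k =ᵐ[μ] fun z => c * (m z : ℂ) := by
  have hmi : ContDiff ℝ ∞ fun z => (m z)⁻¹ := hm.inv fun z => (hpos z).ne'
  have hloc : LocallyIntegrable (fun z => (m z)⁻¹ • (starRingEnd ℂ) (k z)) μ := by
    have h0 : LocallyIntegrable (fun z => (starRingEnd ℂ) (k z)) μ :=
      ((Lp.memLp k).star).locallyIntegrable (by norm_num)
    rw [← locallyIntegrableOn_univ] at h0 ⊢
    exact h0.continuousOn_smul isOpen_univ.isLocallyClosed hmi.continuous.continuousOn
  -- Testing orthogonality with `ψ = φ / m` kills the weak derivative of `conj k / m` along each `e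
  -- i`; linearity and the spanning hypothesis give all directions.
  obtain ⟨c, hc⟩ := exists_ae_eq_const_of_weak_fderiv_eq_zero hloc fun φ hφ hφc => by
    have hi : ∀ w, Integrable (fun z => fderiv ℝ φ z w • (m z)⁻¹ • (starRingEnd ℂ) (k z)) μ := by
      intro w
      refine hloc.integrable_smul_left_of_hasCompactSupport ?_ ?_
      · exact (hφ.continuous_fderiv (by simp)).clm_apply continuous_const
      · exact hφc.fderiv_apply (𝕜 := ℝ) w
    intro w
    have hw : w ∈ Submodule.span ℝ (Set.range e) := hspan ▸ Submodule.mem_top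
    induction hw using Submodule.span_induction with
    | mem x hx =>
      obtain ⟨i, rfl⟩ := hx
      have hsc : HasCompactSupport fun z => ((φ z / m z : ℝ) : ℂ) :=
        (hφc.mul_right (f' := fun z => (m z)⁻¹)).comp_left (g := fun x : ℝ => (x : ℂ))
          Complex.ofReal_zero
      have hss : ContDiff ℝ ∞ fun z => ((φ z / m z : ℝ) : ℂ) :=
        Complex.ofRealCLM.contDiff.comp (hφ.mul hmi)
      have h1 := hk i (hsc.toSchwartzMap hss)
      have h2 := creation_div_apply (γ := γ) (φ := φ) (hg i) hpos (hm.differentiable (by simp))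
        (he i) (ψ := hsc.toSchwartzMap hss) fun z => rfl
      rw [L2.inner_def] at h1
      have h3 : ∫ z, (-(Real.sqrt γ) : ℝ) • (fderiv ℝ φ z (e i) • (m z)⁻¹ •
          (starRingEnd ℂ) (k z)) ∂μ = 0 := by
        rw [← h1]
        refine integral_congr_ae ?_
        filter_upwards [(creation γ (e i) (g i) (hsc.toSchwartzMap hss)).coeFn_toLp 2 μ] with z hz
        rw [hz, h2, RCLike.inner_apply]
        simp only [Complex.real_smul]
        push_cast
        field_simp
      rw [integral_smul, smul_eq_zero] at h3
      exact h3.resolve_left (neg_ne_zero.mpr (Real.sqrt_pos.mpr hγ).ne')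
    | zero => simp
    | add x y _ _ hx hy =>
      simp only [map_add, add_smul]
      rw [integral_add (hi x) (hi y), hx, hy, add_zero]
    | smul r x _ hx =>
      simp only [map_smul, smul_assoc]
      rw [integral_smul, hx, smul_zero]
  refine ⟨(starRingEnd ℂ) c, ?_⟩
  filter_upwards [hc] with z hz
  have hm0 : (m z : ℂ) ≠ 0 := Complex.ofReal_ne_zero.mpr (hpos z).ne'
  rw [← hz]
  simp only [Complex.real_smul, map_mul, Complex.conj_conj, Complex.ofReal_inv, map_inv₀,
    Complex.conj_ofReal]
  field_simp

end Kernel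

namespace RelaxationBoltzmann

variable {d : ℕ} {V : Pos d → ℝ}

/-- The square root of the unnormalized spatial Maxwellian. -/
noncomputable def expHalf (V : Pos d → ℝ) (x : Pos d) : ℝ := Real.exp (-(V x / 2))

lemma expHalf_pos (V : Pos d → ℝ) (x : Pos d) : 0 < expHalf V x := Real.exp_pos _

lemma expHalf_sq (V : Pos d → ℝ) (x : Pos d) : expHalf V x ^ 2 = Real.exp (-V x) := by
  rw [expHalf, sq, ← Real.exp_add]; congr 1; ring

lemma hasFDerivAt_expHalf (hV : Differentiable ℝ V) (x : Pos d) :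
    HasFDerivAt (expHalf V) (-(expHalf V x / 2) • fderiv ℝ V x) x := by
  have h := (((hV x).hasFDerivAt.mul_const (1 / 2 : ℝ)).fun_neg).exp
  have e : expHalf V = fun x => Real.exp (-(V x * (1 / 2))) := by
    funext x; rw [expHalf]; congr 2; ring
  rw [e]
  refine h.congr_fderiv ?_
  ext w
  simp
  ring

lemma contDiff_expHalf (hV : ContDiff ℝ ∞ V) : ContDiff ℝ ∞ (expHalf V) :=
  Real.contDiff_exp.comp (hV.div_const 2).neg

lemma contDiff_sqrtMu : ContDiff ℝ ∞ (sqrtMu : Pos d → ℝ) := by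
  have e : (sqrtMu : Pos d → ℝ) = fun v => Real.exp (-(‖v‖ ^ 2 / 4)) *
      (Real.sqrt ((2 * Real.pi) ^ ((d : ℝ) / 2)))⁻¹ := funext sqrtMu_eq
  rw [e]
  exact (Real.contDiff_exp.comp ((contDiff_norm_sq ℝ).div_const 4).neg).mul contDiff_const

lemma integral_exp_pos (hV : IsConfining V) : 0 < ∫ x, Real.exp (-V x) := by
  have := (integral_pos_iff_support_of_nonneg (fun x => (Real.exp_pos (-V x)).le)
    hV.integrable_exp).mpr
  refine this ?_
  have e : Function.support (fun x : Pos d => Real.exp (-V x)) = Set.univ :=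
    Set.eq_univ_of_forall fun x => (Real.exp_pos _).ne'
  rw [e]
  exact Measure.measure_univ_pos.mpr (NeZero.ne _)

/-- The ground state, up to normalization. -/
noncomputable def groundState (V : Pos d → ℝ) (z : Phase d) : ℝ := expHalf V z.1 * sqrtMu z.2

lemma sqrt_maxwellian (z : Phase d) : Real.sqrt (maxwellian V z) =
    (Real.sqrt (∫ x, Real.exp (-V x)))⁻¹ * groundState V z := by
  rw [maxwellian, rhoInf, groundState, Real.sqrt_mul (by positivity),
    Real.sqrt_div (Real.exp_pos _).le, ← expHalf_sq, Real.sqrt_sq (expHalf_pos V _).le, sqrtMu]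
  ring

lemma memLp_expHalf (hV : IsConfining V) :
    MemLp (fun x => (expHalf V x : ℂ)) 2 (volume : Measure (Pos d)) := by
  have hc : Continuous fun x => (expHalf V x : ℂ) :=
    Complex.continuous_ofReal.comp (contDiff_expHalf hV.smooth).continuous
  rw [memLp_two_iff_integrable_sq_norm hc.aestronglyMeasurable]
  simpa [Complex.norm_real, expHalf_sq] using hV.integrable_exp

lemma span_posDir_velDir : Submodule.span ℝ (Set.range (Sum.elim (posDir (d := d)) velDir)) = ⊤ := by
  rw [eq_top_iff]
  intro w _
  have h : w = ∑ j, w.1 j • posDir j + ∑ j, w.2 j • velDir j := by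
    refine Prod.ext ?_ ?_
    · ext i
      simp [posDir, velDir, Prod.fst_sum, Finset.sum_apply, Pi.single_apply]
    · ext i
      simp [posDir, velDir, Prod.snd_sum, Finset.sum_apply, Pi.single_apply]
  rw [h]
  refine add_mem (sum_mem fun j _ => Submodule.smul_mem _ _ (Submodule.subset_span ⟨Sum.inl j, rfl⟩))
    (sum_mem fun j _ => Submodule.smul_mem _ _ (Submodule.subset_span ⟨Sum.inr j, rfl⟩))

variable (hV : IsConfining V) {γ M₂ M₃ : ℝ} (hγ : 0 < γ)
    (h₂ : ∀ x, ‖iteratedFDeriv ℝ 2 V x‖ ≤ M₂) (h₃ : ∀ x, ‖iteratedFDeriv ℝ 3 V x‖ ≤ M₃)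

/-- The vectors fixed by `Λ⁻²` are multiples of the ground state. -/
theorem exists_eq_smul_groundState {R : H d →L[ℂ] H d}
    (hR : ∀ u, R (toH d ((kineticSystem hV hγ h₂ h₃).lam u)) = toH d u)
    (hd : DenseRange fun u => toH d ((kineticSystem hV hγ h₂ h₃).lam u)) {k : H d} (hk : R k = k) :
    ∃ c : ℂ, k = c • tensorIso d (memLp_expHalf hV).toLp := by
  have hVd : Differentiable ℝ V := hV.smooth.differentiable (by simp)
  have hder : ∀ z : Phase d, HasFDerivAt (groundState V)
      (expHalf V z.1 • (-(sqrtMu z.2 / 2) • innerSL ℝ z.2).comp (ContinuousLinearMap.snd ℝ _ _) +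
        sqrtMu z.2 • (-(expHalf V z.1 / 2) • fderiv ℝ V z.1).comp
          (ContinuousLinearMap.fst ℝ _ _)) z := fun z =>
    ((hasFDerivAt_expHalf hVd z.1).comp z hasFDerivAt_fst).mul
      ((hasFDerivAt_sqrtMu z.2).comp z hasFDerivAt_snd)
  obtain ⟨c, hc⟩ := exists_ae_eq_const_mul_of_inner_creation_eq_zero
    (μ := (volume : Measure (Phase d))) (span_posDir_velDir (d := d))
    (g := Sum.elim (fun j z => dV V j z.1) fun j z => z.2 j) (m := groundState V) (k := k)
    (by
      rintro (j | j)
      · exact (hV.hasTemperateGrowth_dV j).comp hasTemperateGrowth_fst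
      · exact hasTemperateGrowth_vel j)
    (((contDiff_expHalf hV.smooth).comp contDiff_fst).mul (contDiff_sqrtMu.comp contDiff_snd))
    (fun z => mul_pos (expHalf_pos V _) (sqrtMu_pos _))
    (by
      rintro (j | j) z <;> rw [(hder z).fderiv]
      · simp [posDir, groundState, dV]; ring
      · have e : ⟪z.2, EuclideanSpace.single j (1 : ℝ)⟫_ℝ = z.2 j := by
          rw [EuclideanSpace.inner_single_right]; simp
        simp only [Sum.elim_inr, velDir, add_apply, smul_apply, ContinuousLinearMap.comp_apply,
          ContinuousLinearMap.coe_fst', ContinuousLinearMap.coe_snd', innerSL_apply_apply, e,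
          map_zero, smul_eq_mul, groundState]
        ring) hγ
    (by
      rintro (j | j) ψ
      · exact ((kineticSystem hV hγ h₂ h₃).inner_eq_zero_of_fixed hR hd hk j ψ).1
      · exact ((kineticSystem hV hγ h₂ h₃).inner_eq_zero_of_fixed hR hd hk j ψ).2)
  refine ⟨c, ?_⟩
  ext1
  filter_upwards [hc, tensorIso_toLp (memLp_expHalf hV),
    Lp.coeFn_smul c (tensorIso d (memLp_expHalf hV).toLp)] with z h1 h2 h3
  rw [h1, h3, Pi.smul_apply, h2]
  simp [tensorMu, groundState]

/-- The velocity projection of a function orthogonal to the Maxwellian is orthogonal to the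
vectors fixed by `Λ⁻²`. -/
theorem inner_projMu_eq_zero_of_ortho {R : H d →L[ℂ] H d}
    (hR : ∀ u, R (toH d ((kineticSystem hV hγ h₂ h₃).lam u)) = toH d u)
    (hd : DenseRange fun u => toH d ((kineticSystem hV hγ h₂ h₃).lam u)) {u : 𝓢(Phase d, ℂ)}
    (hu : OrthoMaxwellian V u) (k : H d) (hk : R k = k) : ⟪k, projMu (toH d u)⟫_ℂ = 0 := by
  obtain ⟨c, rfl⟩ := exists_eq_smul_groundState hV hγ h₂ h₃ hR hd hk
  rw [inner_smul_left, inner_projMu_left, L2.inner_def]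
  have h1 : ∫ z, ((Real.sqrt (∫ x, Real.exp (-V x)))⁻¹ : ℂ) *
      (u z * (groundState V z : ℂ)) = 0 := by
    rw [← hu]
    refine integral_congr_ae (Filter.Eventually.of_forall fun z => ?_)
    simp only [sqrt_maxwellian]
    push_cast
    ring
  rw [integral_const_mul, mul_eq_zero] at h1
  have h2 := h1.resolve_left (inv_ne_zero (Complex.ofReal_ne_zero.mpr
    (Real.sqrt_pos.mpr (integral_exp_pos hV)).ne'))
  rw [mul_eq_zero]
  right
  rw [← h2]
  refine integral_congr_ae ?_
  filter_upwards [tensorIso_toLp (memLp_expHalf hV), toH_coeFn u] with z h3 h4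
  rw [h3, h4, RCLike.inner_apply]
  simp [tensorMu, groundState]

end RelaxationBoltzmann

/-! ### The spectral gap is at most `γ` -/

namespace KineticSystem

variable {S H : Type*} [AddCommGroup S] [Module ℂ S] [NormedAddCommGroup H]
  [InnerProductSpace ℂ H] {d : ℕ} {γ M M' : ℝ} {J : S →ₗ[ℂ] H} (T : KineticSystem d γ M M' J)
  {R : H →L[ℂ] H}

lemma norm_b'_sq {e : S} {j : Fin d} (he : T.b j e = 0) :
    ‖J (T.b' j e)‖ ^ 2 = γ * ‖J e‖ ^ 2 := by
  have h1 : (⟪J (T.b' j e), J (T.b' j e)⟫_ℂ).re = ‖J (T.b' j e)‖ ^ 2 :=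
    inner_self_eq_norm_sq (𝕜 := ℂ) _
  have h2 : (⟪J e, J e⟫_ℂ).re = ‖J e‖ ^ 2 := inner_self_eq_norm_sq (𝕜 := ℂ) _
  rw [← h1, ← T.adjB, T.ccrB, he, if_pos rfl, map_zero, zero_add, map_smul, inner_smul_left,
    Complex.conj_ofReal, Complex.re_ofReal_mul, h2]

/-- The spectral gap tested on the first excited velocity states. -/
lemma gap_mul_norm_sq_le (hγ : 0 < γ) (hR : ∀ u, R (J (T.lam u)) = J u)
    (hd : DenseRange fun u => J (T.lam u)) {α : ℝ} (hα : 0 < α)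
    (hgap : ∀ x, (∀ k, R k = k → ⟪k, x⟫_ℂ = 0) → (⟪x, R x⟫_ℂ).re ≤ (1 + α)⁻¹ * ‖x‖ ^ 2)
    (j : Fin d) {e : S} (he : ∀ k, T.b k e = 0) :
    α * ‖J e‖ ^ 2 ≤ γ * ‖J e‖ ^ 2 + ∑ k, ‖J (T.a k e)‖ ^ 2 := by
  -- The state `b' j e` is orthogonal to all fixed vectors, so the gap applies without any condition
  -- on `e`. Its squared norm is `γ ‖e‖²` and its energy `γ² ‖e‖² + γ ∑ ‖a k e‖²`; a factor `γ`
  -- cancels.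
  have h1 := T.norm_sq_le_re_inner_lam hR hd (f := T.b' j e) (by positivity)
    (hgap _ fun k hk => (T.inner_eq_zero_of_fixed hR hd hk j e).2)
  have h2 : ∀ k, ‖J (T.a k (T.b' j e))‖ ^ 2 = γ * ‖J (T.a k e)‖ ^ 2 := fun k => by
    rw [T.ab', T.norm_b'_sq]
    rw [← T.ab, he, map_zero]
  have h3 : ∑ k, ‖J (T.b k (T.b' j e))‖ ^ 2 = γ ^ 2 * ‖J e‖ ^ 2 := by
    rw [Finset.sum_eq_single j]
    · rw [T.ccrB, he, if_pos rfl, map_zero, zero_add, map_smul, norm_smul, Complex.norm_real,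
        Real.norm_of_nonneg hγ.le, mul_pow]
    · intro k _ hk
      rw [T.ccrB, he, if_neg hk, map_zero, zero_add, map_zero, norm_zero]
      norm_num
    · simp
  rw [T.re_inner_lam_self, h3, T.norm_b'_sq (he j), inv_mul_eq_div, le_div_iff₀ (by positivity)]
    at h1
  simp only [h2, ← Finset.mul_sum] at h1
  refine le_of_mul_le_mul_left ?_ hγ
  nlinarith

end KineticSystem

namespace RelaxationBoltzmann

variable {d : ℕ} {V : Pos d → ℝ}

/-- A smooth cutoff function. -/
noncomputable def cutoff (d : ℕ) : ContDiffBump (0 : Pos d) := ⟨1, 2, by norm_num, by norm_num⟩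

/-- The spatial ground state, cut off at scale `t⁻¹`. -/
noncomputable def cutoffState (V : Pos d → ℝ) (t : ℝ) (x : Pos d) : ℂ :=
  ((cutoff d (t • x) * expHalf V x : ℝ) : ℂ)

lemma contDiff_cutoffState (hV : ContDiff ℝ ∞ V) (t : ℝ) : ContDiff ℝ ∞ (cutoffState V t) :=
  Complex.ofRealCLM.contDiff.comp
    (((cutoff d).contDiff.comp (contDiff_const_smul t)).mul (contDiff_expHalf hV))

lemma hasCompactSupport_cutoffState (V : Pos d → ℝ) {t : ℝ} (ht : t ≠ 0) :
    HasCompactSupport (cutoffState V t) :=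
  (((cutoff d).hasCompactSupport.comp_smul ht).mul_right (f' := expHalf V)).comp_left
    (g := fun x : ℝ => (x : ℂ)) Complex.ofReal_zero

lemma memLp_cutoffState (hV : ContDiff ℝ ∞ V) {t : ℝ} (ht : t ≠ 0) :
    MemLp (cutoffState V t) 2 volume :=
  (contDiff_cutoffState hV t).continuous.memLp_of_hasCompactSupport
    (hasCompactSupport_cutoffState V ht)

/-- At scale parameter `2` the cutoff vanishes outside the unit ball, where the cutoffs with `t ≤ 1`
equal one. This bounds their norms below uniformly in `t`. -/
lemma norm_cutoffState_le (V : Pos d → ℝ) {t : ℝ} (ht : 0 < t) (ht1 : t ≤ 1) (x : Pos d) :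
    ‖cutoffState V 2 x‖ ≤ ‖cutoffState V t x‖ := by
  rw [cutoffState, cutoffState, Complex.norm_real, Complex.norm_real, norm_mul, norm_mul]
  refine mul_le_mul_of_nonneg_right ?_ (norm_nonneg _)
  rw [Real.norm_of_nonneg (cutoff d).nonneg, Real.norm_of_nonneg (cutoff d).nonneg]
  rcases le_or_gt ‖x‖ 1 with h | h
  · rw [(cutoff d).one_of_mem_closedBall (x := t • x)]
    · exact (cutoff d).le_one
    · rw [mem_closedBall_zero_iff, norm_smul, Real.norm_of_nonneg ht.le]
      exact mul_le_one₀ ht1 (norm_nonneg _) h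
  · rw [(cutoff d).zero_of_le_dist (x := (2 : ℝ) • x)]
    · exact (cutoff d).nonneg
    · rw [dist_zero_right, norm_smul]
      change (2 : ℝ) ≤ _
      norm_num
      exact h.le

lemma norm_toLp_cutoffState_pos (hV : ContDiff ℝ ∞ V) {t : ℝ} (ht : t ≠ 0) :
    0 < ‖(memLp_cutoffState hV ht).toLp‖ := by
  rw [norm_pos_iff]
  intro h
  have h1 : cutoffState V t =ᵐ[volume] fun _ => 0 := by
    filter_upwards [(memLp_cutoffState hV ht).coeFn_toLp, Lp.coeFn_zero ℂ 2 volume] with x h2 h3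
    rw [← h2, h, h3, Pi.zero_apply]
  have h2 := congrFun ((contDiff_cutoffState hV t).continuous.ae_eq_iff_eq volume continuous_const
    |>.mp h1) 0
  rw [cutoffState, smul_zero, (cutoff d).one_of_mem_closedBall (by simp [cutoff]), one_mul,
    Complex.ofReal_eq_zero] at h2
  exact (expHalf_pos V 0).ne' h2

lemma exists_norm_fderiv_cutoff_le (d : ℕ) :
    ∃ C, 0 ≤ C ∧ ∀ x, ‖fderiv ℝ (cutoff d) x‖ ≤ C := by
  obtain ⟨C, hC⟩ := ((cutoff d).contDiff (n := 1)).continuous_fderiv (by simp)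
    |>.bounded_above_of_compact_support ((cutoff d).hasCompactSupport.fderiv ℝ)
  exact ⟨C, (norm_nonneg _).trans (hC 0), hC⟩

/-- Since `a k` kills the uncut ground state, only the derivative of the cutoff survives, with a
factor `t`; the `a`-energy is therefore of order `t²`. -/
lemma a_cutoffState_apply (hV : IsConfining V) {t : ℝ} (ht : t ≠ 0) (γ : ℝ) (k : Fin d)
    (z : Phase d) :
    annihilation γ (posDir k) (fun z => dV V k z.1)
      (tensorSchwartz (hasCompactSupport_cutoffState V ht) (contDiff_cutoffState hV.smooth t)) z =
      (Real.sqrt γ * (t * fderiv ℝ (cutoff d) (t • z.1) (EuclideanSpace.single k 1)) : ℝ) *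
        tensorMu (fun x => (expHalf V x : ℂ)) z := by
  have hVd : Differentiable ℝ V := hV.smooth.differentiable (by simp)
  have h1 : HasFDerivAt (fun x : Pos d => cutoff d (t • x))
      ((fderiv ℝ (cutoff d) (t • z.1)).comp (t • ContinuousLinearMap.id ℝ (Pos d))) z.1 :=
    (((cutoff d).contDiff (n := 1)).differentiable (by simp) _).hasFDerivAt.comp z.1
      ((hasFDerivAt_id z.1).const_smul t)
  have h2 : HasFDerivAt (cutoffState V t) _ z.1 :=
    Complex.ofRealCLM.hasFDerivAt.comp z.1 (h1.mul (hasFDerivAt_expHalf hVd z.1))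
  rw [annihilation_apply (g := fun z : Phase d => dV V k z.1)
      ((hV.hasTemperateGrowth_dV k).comp hasTemperateGrowth_fst),
    show (tensorSchwartz (hasCompactSupport_cutoffState V ht)
      (contDiff_cutoffState hV.smooth t) : Phase d → ℂ) = tensorMu (cutoffState V t) from
      funext (tensorSchwartz_apply _ _), (hasFDerivAt_tensorMu h2).fderiv]
  simp only [posDir, sub_apply, smul_apply, add_apply,
    ContinuousLinearMap.comp_apply, ContinuousLinearMap.coe_fst', ContinuousLinearMap.coe_snd',
    ContinuousLinearMap.id_apply, map_zero, smul_eq_mul, Complex.ofRealCLM_apply, map_smul,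
    tensorMu, cutoffState, dV]
  push_cast
  ring

variable (hV : IsConfining V) {γ M₂ M₃ : ℝ} (hγ : 0 < γ)
    (h₂ : ∀ x, ‖iteratedFDeriv ℝ 2 V x‖ ≤ M₂) (h₃ : ∀ x, ‖iteratedFDeriv ℝ 3 V x‖ ≤ M₃)

/-- The spectral gap is at most `γ`, the gap of the harmonic oscillator in the velocities. -/
theorem gap_le {R : H d →L[ℂ] H d}
    (hR : ∀ u, R (toH d ((kineticSystem hV hγ h₂ h₃).lam u)) = toH d u)
    (hd : DenseRange fun u => toH d ((kineticSystem hV hγ h₂ h₃).lam u)) {α : ℝ} (hα : 0 < α)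
    (hgap : ∀ x, (∀ k, R k = k → ⟪k, x⟫_ℂ = 0) → (⟪x, R x⟫_ℂ).re ≤ (1 + α)⁻¹ * ‖x‖ ^ 2)
    (j : Fin d) : α ≤ γ := by
  obtain ⟨C, hC0, hC⟩ := exists_norm_fderiv_cutoff_le d
  set N := ‖tensorIso d (memLp_expHalf hV).toLp‖
  set c := ‖(memLp_cutoffState hV.smooth (two_ne_zero' ℝ)).toLp‖
  have hc : 0 < c := norm_toLp_cutoffState_pos hV.smooth two_ne_zero
  have key : ∀ t, 0 < t → t ≤ 1 → γ ≤ α →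
      (α - γ) * c ^ 2 ≤ d * (Real.sqrt γ * C * N) ^ 2 * t ^ 2 := by
    intro t ht ht1 hle
    have h1 := (kineticSystem hV hγ h₂ h₃).gap_mul_norm_sq_le hγ hR hd hα hgap j
      (e := tensorSchwartz (hasCompactSupport_cutoffState V ht.ne')
        (contDiff_cutoffState hV.smooth t))
      fun k => b_tensorSchwartz _ _ γ k
    have h2 : c ≤ ‖toH d (tensorSchwartz (hasCompactSupport_cutoffState V ht.ne')
        (contDiff_cutoffState hV.smooth t))‖ := by
      rw [← tensorIso_eq_toH _ _ (memLp_cutoffState hV.smooth ht.ne'), LinearIsometry.norm_map]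
      refine Lp.norm_le_norm_of_ae_le ?_
      filter_upwards [(memLp_cutoffState hV.smooth (two_ne_zero' ℝ)).coeFn_toLp,
        (memLp_cutoffState hV.smooth ht.ne').coeFn_toLp] with x h3 h4
      rw [h3, h4]
      exact norm_cutoffState_le V ht ht1 x
    have h5 : ∀ k, ‖toH d ((kineticSystem hV hγ h₂ h₃).a k
        (tensorSchwartz (hasCompactSupport_cutoffState V ht.ne')
          (contDiff_cutoffState hV.smooth t)))‖ ≤ (Real.sqrt γ * (t * C)) * N := by
      intro k
      refine Lp.norm_le_mul_norm_of_ae_le_mul ?_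
      filter_upwards [toH_coeFn ((kineticSystem hV hγ h₂ h₃).a k
        (tensorSchwartz (hasCompactSupport_cutoffState V ht.ne')
          (contDiff_cutoffState hV.smooth t))), tensorIso_toLp (memLp_expHalf hV)] with z h6 h7
      rw [h6, h7]
      refine (congrArg norm (a_cutoffState_apply hV ht.ne' γ k z)).trans_le ?_
      rw [norm_mul, Complex.norm_real, norm_mul, norm_mul,
        Real.norm_of_nonneg (Real.sqrt_nonneg γ), Real.norm_of_nonneg ht.le]
      gcongr
      refine ((fderiv ℝ (cutoff d) (t • z.1)).le_opNorm _).trans ?_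
      exact (mul_le_of_le_one_right (norm_nonneg _) (norm_single_le k)).trans (hC _)
    have h8 := Finset.sum_le_sum fun k (_ : k ∈ Finset.univ) =>
      pow_le_pow_left₀ (norm_nonneg _) (h5 k) 2
    rw [Finset.sum_const, Finset.card_univ, Fintype.card_fin, nsmul_eq_mul] at h8
    have h9 := mul_le_mul_of_nonneg_left (pow_le_pow_left₀ hc.le h2 2) (sub_nonneg.mpr hle)
    linarith
  by_contra! hlt
  set K := d * (Real.sqrt γ * C * N) ^ 2 with hK
  have hK0 : 0 ≤ K := by positivity
  have hδ : 0 < (α - γ) * c ^ 2 := mul_pos (sub_pos.mpr hlt) (by positivity)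
  -- With this `t` one has `K t² ≤ K t`, at most half of `(α - γ) c²`, contradicting `key`. The
  -- summand `1` keeps the denominator positive when `K = 0`.
  set t := min 1 ((α - γ) * c ^ 2 / (2 * (K + 1))) with ht
  have ht0 : 0 < t := lt_min one_pos (by positivity)
  have h1 := key t ht0 (min_le_left _ _) hlt.le
  have h2 : t ≤ (α - γ) * c ^ 2 / (2 * (K + 1)) := min_le_right _ _
  rw [le_div_iff₀ (by positivity)] at h2
  have h3 : t ^ 2 ≤ t := by nlinarith [min_le_left 1 ((α - γ) * c ^ 2 / (2 * (K + 1)))]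
  have h4 := mul_le_mul_of_nonneg_left h3 hK0
  nlinarith

end RelaxationBoltzmann

/-! ### Coercivity in the modified scalar product -/

lemma re_inner_le_of_gap {E : Type*} [NormedAddCommGroup E] [InnerProductSpace ℂ E]
    [CompleteSpace E] {R : E →L[ℂ] E} {α : ℝ} (hα : 0 < α)
    (hsymm : ∀ x y, ⟪R x, y⟫_ℂ = ⟪x, R y⟫_ℂ)
    (hgap : ∀ t : ℝ, t ≠ 0 → t < α → IsUnit (1 - (1 + (t : ℂ)) • R)) {f : E}
    (hf : ∀ k, R k = k → ⟪k, f⟫_ℂ = 0) : (⟪f, R f⟫_ℂ).re ≤ (1 + α)⁻¹ * ‖f‖ ^ 2 :=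
  re_inner_le_of_spectrum (ContinuousLinearMap.isSelfAdjoint_iff_isSymmetric.mpr hsymm)
    (fun _ hμ => spectrum_le_of_gap hα hgap hμ) hf

/-- The transport operator from its annihilation and creation parts. -/
lemma creation_annihilation_sub {E : Type*} [NormedAddCommGroup E] [NormedSpace ℝ E]
    {γ : ℝ} (hγ : 0 ≤ γ) {m m' : E} {g g' : E → ℝ} (hg : g.HasTemperateGrowth)
    (hg' : g'.HasTemperateGrowth) (h : ∀ z, fderiv ℝ g z m' = 0) (h' : ∀ z, fderiv ℝ g' z m = 0)
    (u : 𝓢(E, ℂ)) :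
    creation γ m' g' (annihilation γ m g u) - creation γ m g (annihilation γ m' g' u) =
      (γ : ℂ) • (mulOp g' (diffOp m u) - mulOp g (diffOp m' u)) := by
  have h1 : (fun z => fderiv ℝ g z m') = fun _ => 0 := funext h
  have h2 : (fun z => fderiv ℝ g' z m) = fun _ => 0 := funext h'
  have hs : (γ : ℂ) = (Real.sqrt γ : ℂ) * (Real.sqrt γ : ℂ) := by
    rw [← Complex.ofReal_mul, Real.mul_self_sqrt hγ]
  simp only [annihilation, creation, LinearMap.smul_apply, LinearMap.add_apply,
    LinearMap.neg_apply, map_smul, map_add, diffOp_mulOp hg, diffOp_mulOp hg',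
    mulOp_comm hg hg', diffOp_comm m m', h1, h2, hs, mulOp_zero, LinearMap.zero_apply, add_zero]
  module

namespace KineticSystem

variable {S H : Type*} [AddCommGroup S] [Module ℂ S] [NormedAddCommGroup H]
  [InnerProductSpace ℂ H] [CompleteSpace H] {d : ℕ} {γ M M' : ℝ} {J : S →ₗ[ℂ] H}
  (T : KineticSystem d γ M M' J) {R L : H →L[ℂ] H}

/-- Coercivity of `X₀ + γ (1 - Π)` in the modified scalar product, at a vector whose image `f`
under the projection `Π` satisfies the spectral gap inequality. -/
theorem hypocoercive_estimate {α r C CL : ℝ} (hγ : 0 < γ) (hα0 : 0 < α) (hαγ : α ≤ γ)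
    (hr0 : 0 < r) (hr2 : r ≤ 1 / 2) (hr4 : r * ((1 + γ) * (3 * C + 2 * γ * CL) ^ 2) ≤ γ)
    (hC0 : 0 ≤ C) (hCL0 : 0 ≤ CL) (hR : ∀ u, R (J (T.lam u)) = J u)
    (hL : ∀ u, L (J u) = R (J (T.Y u))) (hLn : ‖L‖ ≤ CL)
    (hC : ∀ u w, ‖⟪J (T.X0 u), L (J w)⟫_ℂ + ⟪L.adjoint (J u), J (T.X0 w)⟫_ℂ‖ ≤
      C * ‖J u‖ * ‖J w‖) (u : S) {f : H}
    (hf : f ∈ closure {g | ∃ e, (∀ j, T.b j e = 0) ∧ J e = g}) (hfw : ⟪f, J u - f⟫_ℂ = 0)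
    (hgap : (⟪f, R f⟫_ℂ).re ≤ (1 + α)⁻¹ * ‖f‖ ^ 2) :
    α ^ 2 / (2 * (1 + γ) / r) * ‖J u‖ ^ 2 ≤
      (⟪J (T.X0 u) + (γ : ℂ) • (J u - f),
        J u + ((r * α : ℝ) : ℂ) • (L (J u) + L.adjoint (J u))⟫_ℂ).re := by
  have hδ : 1 - (1 + α)⁻¹ = α / (1 + α) := by field_simp; ring
  have hε0 : 0 < r * α := by positivity
  have hX := T.re_inner_X0_ge hγ hR hL hC u hf
  have hu' : J u = f + (J u - f) := by abel
  set w := J u - f with hw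
  have hwf : ⟪w, f⟫_ℂ = 0 := by rw [← inner_conj_symm, hfw, map_zero]
  have hpy : ‖J u‖ ^ 2 = ‖f‖ ^ 2 + ‖w‖ ^ 2 := by
    have := norm_add_sq_eq_norm_sq_add_norm_sq_of_inner_eq_zero f w hfw
    rw [← hu'] at this
    rw [sq, sq, sq, this]
  have hww : (⟪w, J u⟫_ℂ).re = ‖w‖ ^ 2 := by
    rw [hu', inner_add_right, hwf, zero_add]
    exact inner_self_eq_norm_sq (𝕜 := ℂ) w
  have hff : (1 - (1 + α)⁻¹) * ‖f‖ ^ 2 ≤ (⟪f, f - R f⟫_ℂ).re := by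
    have h2 : (⟪f, f⟫_ℂ).re = ‖f‖ ^ 2 := inner_self_eq_norm_sq (𝕜 := ℂ) f
    rw [inner_sub_right, Complex.sub_re, h2]
    linarith
  have hY : -(2 * CL * ‖w‖ * ‖J u‖) ≤ (⟪w, L (J u) + L.adjoint (J u)⟫_ℂ).re := by
    have h1 := Complex.abs_re_le_norm ⟪w, L (J u) + L.adjoint (J u)⟫_ℂ
    have h2 := norm_inner_le_norm (𝕜 := ℂ) w (L (J u) + L.adjoint (J u))
    have h3 : ‖L (J u) + L.adjoint (J u)‖ ≤ 2 * CL * ‖J u‖ := by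
      have h4 := L.le_of_opNorm_le hLn (J u)
      have h5 := L.adjoint.le_of_opNorm_le ((LinearIsometryEquiv.norm_map _ L).trans_le hLn)
        (J u)
      have h6 := norm_add_le (L (J u)) (L.adjoint (J u))
      linarith
    have h7 := mul_le_mul_of_nonneg_left h3 (norm_nonneg w)
    have h8 := (abs_le.mp h1).1
    linarith
  have hεγ : r * α ≤ γ / 2 :=
    (mul_le_mul hr2 hαγ hα0.le (by norm_num)).trans (by linarith)
  have hX' := (sub_le_sub_right (sub_le_sub_right hff (2 * C * ‖f‖ * ‖w‖)) (C * ‖w‖ ^ 2)).trans hX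
  -- With `ε = r α` and `δ = α / (1 + α)` the gain is `ε δ / 2 = r α² / (2 (1 + α))`; then `α ≤ γ`
  -- replaces `1 + α` by `1 + γ`.
  have hcomb := hypocoercive_combination hγ (δ := 1 - (1 + α)⁻¹) (ε := r * α) (C := C) (CL := CL)
    (nu := ‖J u‖) (nf := ‖f‖) (nw := ‖w‖) (sub_le_self _ (by positivity)) hε0 hC0 hCL0
    (norm_nonneg _) (norm_nonneg _) hpy hεγ
    (by
      rw [hδ, ← mul_div_assoc, le_div_iff₀ (by positivity)]
      have h1 : r * (3 * C + 2 * γ * CL) ^ 2 * (1 + α) ≤ γ := by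
        refine le_trans ?_ hr4
        have : r * (3 * C + 2 * γ * CL) ^ 2 * (1 + α) ≤
          r * (3 * C + 2 * γ * CL) ^ 2 * (1 + γ) := by gcongr
        linarith
      have h2 := mul_le_mul_of_nonneg_right h1 hα0.le
      linarith)
    hX' hY
  have hexp : (⟪J (T.X0 u) + (γ : ℂ) • w,
      J u + ((r * α : ℝ) : ℂ) • (L (J u) + L.adjoint (J u))⟫_ℂ).re =
      γ * ‖w‖ ^ 2 + r * α * (⟪J (T.X0 u), L (J u) + L.adjoint (J u)⟫_ℂ).re +
        r * α * γ * (⟪w, L (J u) + L.adjoint (J u)⟫_ℂ).re := by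
    rw [inner_add_left, inner_add_right (J (T.X0 u)), inner_add_right ((γ : ℂ) • w),
      inner_smul_right (J (T.X0 u)), inner_smul_right ((γ : ℂ) • w), inner_smul_left,
      inner_smul_left, Complex.conj_ofReal, Complex.add_re, Complex.add_re,
      Complex.add_re, T.re_inner_X0_self, Complex.re_ofReal_mul, Complex.re_ofReal_mul,
      Complex.re_ofReal_mul, Complex.re_ofReal_mul, hww]
    ring
  rw [hexp]
  refine le_trans ?_ hcomb
  refine mul_le_mul_of_nonneg_right ?_ (by positivity)
  rw [hδ, div_div_eq_mul_div]
  have h1 : α / (1 + γ) ≤ α / (1 + α) := by gcongr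
  calc α ^ 2 * r / (2 * (1 + γ)) = r * α * (α / (1 + γ)) / 2 := by field_simp
    _ ≤ _ := by gcongr

end KineticSystem

/-! ### Identification with the differential expressions, and conclusion -/

namespace RelaxationBoltzmann

variable {d : ℕ}

lemma schwartz_sum_apply {ι : Type*} (s : Finset ι) (f : ι → 𝓢(Phase d, ℂ)) (z : Phase d) :
    (∑ i ∈ s, f i) z = ∑ i ∈ s, f i z := by
  classical
  induction s using Finset.induction_on with
  | empty => simp
  | insert i s hi ih => rw [Finset.sum_insert hi, Finset.sum_insert hi, add_apply, ih]

lemma closedGraph_eq {D : (Phase d → ℂ) → Phase d → ℂ} {N : 𝓢(Phase d, ℂ) → 𝓢(Phase d, ℂ)}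
    (h : ∀ u : 𝓢(Phase d, ℂ), D u = N u) :
    closedGraph D = closure (Set.range fun u => (toH d u, toH d (N u))) := by
  unfold closedGraph
  congr 1
  ext p
  constructor
  · rintro ⟨u, h1, h2⟩
    refine ⟨u, Prod.ext ?_ ?_⟩
    · ext1; exact (toH_coeFn u).trans h1.symm
    · ext1; rw [h] at h2; exact (toH_coeFn (N u)).trans h2.symm
  · rintro ⟨u, rfl⟩
    exact ⟨u, toH_coeFn u, by rw [h]; exact toH_coeFn (N u)⟩

lemma HasSpectralGap.exists_isResolvent {γ α : ℝ} {V : Pos d → ℝ} (h : HasSpectralGap γ V α)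
    {t : ℝ} (ht : t ≠ 0) (htα : t < α) :
    ∃ R, IsResolvent (closedGraph (lambdaSqSubOne γ V)) (t : ℂ) R := by
  by_contra hR
  exact absurd (h.2.1 ⟨hR, ht⟩) (not_le.mpr htα)

section

variable {V : Pos d → ℝ} (hV : IsConfining V) {γ M₂ M₃ : ℝ} (hγ : 0 < γ)
    (h₂ : ∀ x, ‖iteratedFDeriv ℝ 2 V x‖ ≤ M₂) (h₃ : ∀ x, ‖iteratedFDeriv ℝ 3 V x‖ ≤ M₃)

lemma opA_eq (j : Fin d) (u : 𝓢(Phase d, ℂ)) :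
    opA γ V j u = (kineticSystem hV hγ h₂ h₃).a j u :=
  funext fun z => (annihilation_apply (g := fun z : Phase d => dV V j z.1)
    ((hV.hasTemperateGrowth_dV j).comp hasTemperateGrowth_fst) u z).symm

lemma opAStar_eq (j : Fin d) (u : 𝓢(Phase d, ℂ)) :
    opAStar γ V j u = (kineticSystem hV hγ h₂ h₃).a' j u :=
  funext fun z => (creation_apply (g := fun z : Phase d => dV V j z.1)
    ((hV.hasTemperateGrowth_dV j).comp hasTemperateGrowth_fst) u z).symm

lemma opB_eq (j : Fin d) (u : 𝓢(Phase d, ℂ)) :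
    opB γ j u = (kineticSystem hV hγ h₂ h₃).b j u :=
  funext fun z => (annihilation_apply (hasTemperateGrowth_vel j) u z).symm

lemma opBStar_eq (j : Fin d) (u : 𝓢(Phase d, ℂ)) :
    opBStar γ j u = (kineticSystem hV hγ h₂ h₃).b' j u :=
  funext fun z => (creation_apply (hasTemperateGrowth_vel j) u z).symm

lemma lambdaSqSubOne_eq (u : 𝓢(Phase d, ℂ)) :
    lambdaSqSubOne γ V u = ((kineticSystem hV hγ h₂ h₃).lam u - u : 𝓢(Phase d, ℂ)) := by
  funext z
  rw [KineticSystem.lam_apply, add_sub_cancel_right, add_apply, schwartz_sum_apply,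
    schwartz_sum_apply]
  simp only [lambdaSqSubOne, opA_eq hV hγ h₂ h₃, opAStar_eq hV hγ h₂ h₃, opB_eq hV hγ h₂ h₃,
    opBStar_eq hV hγ h₂ h₃]

lemma lambdaSq_eq (u : 𝓢(Phase d, ℂ)) :
    lambdaSq γ V u = ((kineticSystem hV hγ h₂ h₃).lam u - u + u : 𝓢(Phase d, ℂ)) := by
  funext z
  rw [lambdaSq, lambdaSqSubOne_eq hV hγ h₂ h₃]
  rfl

lemma opAStarB_eq (u : 𝓢(Phase d, ℂ)) :
    opAStarB γ V u = (kineticSystem hV hγ h₂ h₃).Y u := by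
  funext z
  rw [KineticSystem.Y_apply, schwartz_sum_apply]
  simp only [opAStarB, opAStar_eq hV hγ h₂ h₃, opB_eq hV hγ h₂ h₃]

lemma opX0_eq (u : 𝓢(Phase d, ℂ)) : opX0 V u = (kineticSystem hV hγ h₂ h₃).X0 u := by
  have hγ' : (γ : ℂ) ≠ 0 := Complex.ofReal_ne_zero.mpr hγ.ne'
  have hx : ∀ j, (fun z : Phase d => dV V j z.1).HasTemperateGrowth := fun j =>
    (hV.hasTemperateGrowth_dV j).comp hasTemperateGrowth_fst
  funext z
  have h : ∀ j, (kineticSystem hV hγ h₂ h₃).b' j ((kineticSystem hV hγ h₂ h₃).a j u) -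
      (kineticSystem hV hγ h₂ h₃).a' j ((kineticSystem hV hγ h₂ h₃).b j u) =
      (γ : ℂ) • (mulOp (fun z : Phase d => z.2 j) (diffOp (posDir j) u) -
        mulOp (fun z : Phase d => dV V j z.1) (diffOp (velDir j) u)) := fun j =>
    creation_annihilation_sub hγ.le (hx j) (hasTemperateGrowth_vel j)
      (fun z => by
        rw [fderiv_comp_fst_apply ((hV.contDiff_dV j).differentiable (by simp)) z _]
        simp [velDir])
      (fun z => by rw [fderiv_vel]; simp [posDir]) u
  rw [KineticSystem.X0_apply, Finset.sum_congr rfl fun j _ => h j, ← Finset.smul_sum, smul_smul,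
    inv_mul_cancel₀ hγ', one_smul, schwartz_sum_apply]
  refine Finset.sum_congr rfl fun j _ => ?_
  rw [sub_apply, mulOp_apply (hasTemperateGrowth_vel j), mulOp_apply (hx j)]
  rfl

include hV hγ h₂ h₃ in
/-- A spectral gap forces positive dimension. -/
lemma HasSpectralGap.ne_zero {α : ℝ} (h : HasSpectralGap γ V α) : d ≠ 0 := by
  rintro rfl
  -- In dimension zero `Λ² - 1` vanishes, so no real `t ≠ 0` lies in its spectrum. Every real number
  -- is then a lower bound of the empty set, which has no greatest one.
  have hlam : ∀ u, (kineticSystem hV hγ h₂ h₃).lam u = u := fun u => by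
    rw [KineticSystem.lam_apply]; simp
  have hG := closedGraph_eq (lambdaSqSubOne_eq hV hγ h₂ h₃)
  obtain ⟨R, hR⟩ := h.exists_isResolvent (t := -1) (by norm_num) (by linarith [h.1])
  push_cast at hR
  have hcore := resolvent_core (hG ▸ hR)
  simp only [hlam, sub_self, zero_add] at hcore
  have hR1 : ∀ f, R f = f := fun f =>
    hcore.2.induction_on (p := fun f => R f = f) f (isClosed_eq (by fun_prop) (by fun_prop)) hcore.1
  have hmem : ∀ t : ℝ, t ≠ 0 → ∃ R, IsResolvent (closedGraph (lambdaSqSubOne γ V)) (t : ℂ) R := by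
    intro t ht
    have ht' : (t : ℂ) ≠ 0 := Complex.ofReal_ne_zero.mpr ht
    refine ⟨-(t : ℂ)⁻¹ • ContinuousLinearMap.id ℂ (H 0), fun f g => ?_⟩
    rw [hR f g, hR1]
    have e : (-(t : ℂ)⁻¹ • ContinuousLinearMap.id ℂ (H 0)) (g - (t : ℂ) • f) =
        f - (t : ℂ)⁻¹ • g := by
      change -(t : ℂ)⁻¹ • (g - (t : ℂ) • f) = _
      rw [smul_sub, smul_smul, neg_mul, inv_mul_cancel₀ ht']
      module
    rw [e, sub_eq_self, smul_eq_zero_iff_right (inv_ne_zero ht')]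
    constructor <;> intro h <;> simpa using h
  have := h.2.2 (show α + 1 ∈ lowerBounds _ from fun t ht => absurd (hmem t ht.2) ht.1)
  linarith

end

/-- The rate constant. -/
noncomputable def rate (d : ℕ) (γ M₂ M₃ : ℝ) : ℝ :=
  (2 + γ * (d * ellipticConst d γ M₂) + (1 + γ) * (3 * commConst d γ M₂ (Real.sqrt γ * M₃) +
    2 * γ * (d * ellipticConst d γ M₂)) ^ 2 / γ)⁻¹

theorem hypocoercivity (d : ℕ) {γ : ℝ} (hγ : 0 < γ) {M₂ M₃ : ℝ} (hM₂ : 0 ≤ M₂) (hM₃ : 0 ≤ M₃)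
    {V : Pos d → ℝ} (hV : IsConfining V) (h₂ : ∀ x, ‖iteratedFDeriv ℝ 2 V x‖ ≤ M₂)
    (h₃ : ∀ x, ‖iteratedFDeriv ℝ 3 V x‖ ≤ M₃) {α : ℝ} (hα : HasSpectralGap γ V α) :
    ∃ L : H d →L[ℂ] H d, IsAuxiliaryOperator γ V L ∧
      ∃ ε : ℝ, 0 < ε ∧ ‖(ε : ℂ) • L‖ ≤ 1 ∧
        ∀ u : 𝓢(Phase d, ℂ), OrthoMaxwellian V u →
          ∃ hK : MemLp (opK γ V u) 2 (volume : Measure (Phase d)),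
            α ^ 2 / (2 * (1 + γ) / rate d γ M₂ M₃) * ‖toH d u‖ ^ 2 ≤
              Complex.re ⟪hK.toLp (opK γ V u),
                toH d u + (ε : ℂ) • (L (toH d u) + L.adjoint (toH d u))⟫_ℂ := by
  have hα0 := hα.1
  set T := kineticSystem hV hγ h₂ h₃ with hT
  have hM' : 0 ≤ Real.sqrt γ * M₃ := by positivity
  have hG := closedGraph_eq (lambdaSqSubOne_eq hV hγ h₂ h₃)
  -- The point `-1` lies below the gap, so the hypothesis itself supplies `Λ⁻²`, and with it the
  -- density of `Λ² 𝓢`.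
  obtain ⟨R, hR⟩ := hα.exists_isResolvent (t := -1) (by norm_num) (by linarith)
  push_cast at hR
  obtain ⟨hRJ, hd⟩ := resolvent_core (hG ▸ hR)
  simp only [sub_add_cancel] at hRJ hd
  obtain ⟨L, hLn, hL, hC⟩ := T.exists_auxiliary hγ hM₂ hM' hRJ hd
  have hgap : ∀ f, (∀ k, R k = k → ⟪k, f⟫_ℂ = 0) → (⟪f, R f⟫_ℂ).re ≤ (1 + α)⁻¹ * ‖f‖ ^ 2 := by
    intro f hf
    refine re_inner_le_of_gap hα0 (T.resolvent_symm hRJ hd) (fun t ht htα => ?_) hf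
    obtain ⟨Rt, hRt⟩ := hα.exists_isResolvent ht htα
    exact isUnit_one_sub_of_isResolvent hR hRt
  have hαγ : α ≤ γ := gap_le hV hγ h₂ h₃ hRJ hd hα0 hgap
    ⟨0, Nat.pos_of_ne_zero (hα.ne_zero hV hγ h₂ h₃)⟩
  set CL := d * ellipticConst d γ M₂ with hCL
  have hCL0 : 0 ≤ CL := mul_nonneg (Nat.cast_nonneg _) (ellipticConst_nonneg d hγ hM₂)
  set C := commConst d γ M₂ (Real.sqrt γ * M₃) with hCdef
  have hC0 : 0 ≤ C := commConst_nonneg d hγ hM₂ hM'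
  set D := 3 * C + 2 * γ * CL with hD
  set r := rate d γ M₂ M₃ with hr
  -- The three summands serve in turn `ε ≤ γ / 2`, `‖ε L‖ ≤ 1` and the absorption of the cross
  -- terms.
  have hr' : r = (2 + γ * CL + (1 + γ) * D ^ 2 / γ)⁻¹ := rfl
  have hs1 : 0 ≤ γ * CL := by positivity
  have hs2 : 0 ≤ (1 + γ) * D ^ 2 / γ := by positivity
  have hr0 : 0 < r := by rw [hr']; positivity
  have hr1 : r * (2 + γ * CL + (1 + γ) * D ^ 2 / γ) = 1 := by
    rw [hr']; exact inv_mul_cancel₀ (by positivity)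
  have hrs1 := mul_nonneg hr0.le hs1
  have hrs2 := mul_nonneg hr0.le hs2
  have hr2 : r ≤ 1 / 2 := by nlinarith
  have hr3 : r * (γ * CL) ≤ 1 := by nlinarith
  have hr4 : r * ((1 + γ) * D ^ 2) ≤ γ := by
    have : r * ((1 + γ) * D ^ 2 / γ) ≤ 1 := by nlinarith
    rwa [← mul_div_assoc, div_le_one hγ] at this
  have hδ : 1 - (1 + α)⁻¹ = α / (1 + α) := by field_simp; ring
  have hε0 : 0 < r * α := by positivity
  refine ⟨L, ⟨R, fun f g => ?_, fun u => ⟨toH d (T.Y u), ?_, hL u⟩⟩, r * α, hε0, ?_, fun u hu => ?_⟩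
  · rw [closedGraph_eq (lambdaSq_eq hV hγ h₂ h₃),
      closure_graph_add_one (toH d) (fun u => (kineticSystem hV hγ h₂ h₃).lam u - u), ← hG, hR]
    simp
  · rw [opAStarB_eq hV hγ h₂ h₃]
    exact toH_coeFn _
  · rw [norm_smul, Complex.norm_real, Real.norm_of_nonneg hε0.le]
    calc r * α * ‖L‖ ≤ r * γ * CL := by gcongr
      _ ≤ 1 := by linarith
  set f := projMu (toH d u) with hf
  set w := toH d u - f with hw
  have hKae : opK γ V u =ᵐ[volume] (toH d (T.X0 u) + (γ : ℂ) • w : H d) := by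
    filter_upwards [Lp.coeFn_add (toH d (T.X0 u)) ((γ : ℂ) • w), Lp.coeFn_smul (γ : ℂ) w,
      Lp.coeFn_sub (toH d u) f, toH_coeFn (T.X0 u), toH_coeFn u, opPi1_ae_eq u]
      with z h1 h2 h3 h4 h5 h6
    rw [h1, Pi.add_apply, h2, Pi.smul_apply, h3, Pi.sub_apply, h4, h5, opK, h6,
      opX0_eq hV hγ h₂ h₃, smul_eq_mul]
  have hK : MemLp (opK γ V u) 2 (volume : Measure (Phase d)) :=
    (memLp_congr_ae hKae).mpr (Lp.memLp _)
  refine ⟨hK, ?_⟩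
  have hKeq : hK.toLp (opK γ V u) = toH d (T.X0 u) + (γ : ℂ) • w := by
    ext1
    exact hK.coeFn_toLp.trans hKae
  have hfw : ⟪f, w⟫_ℂ = 0 := by
    rw [hw, inner_sub_right, sub_eq_zero]
    exact (inner_projMu_left (toH d u) _).symm
  have h1 := T.hypocoercive_estimate hγ hα0 hαγ hr0 hr2 hr4 hC0 hCL0 hRJ hL hLn hC u
    (projMu_mem_closure γ (toH d u)) hfw
    (hgap f (inner_projMu_eq_zero_of_ortho hV hγ h₂ h₃ hRJ hd hu))
  rw [hKeq]
  exact h1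

end RelaxationBoltzmann

theorem proposition3p1 (d : ℕ) (γ : ℝ) (hγ : 0 < γ) (M₂ M₃ : ℝ) :
    ∃ A : ℝ, 0 < A ∧
      ∀ V : Pos d → ℝ, IsConfining V →
        (∀ x, ‖iteratedFDeriv ℝ 2 V x‖ ≤ M₂) → (∀ x, ‖iteratedFDeriv ℝ 3 V x‖ ≤ M₃) →
        ∀ α : ℝ, HasSpectralGap γ V α →
          ∃ L : H d →L[ℂ] H d, IsAuxiliaryOperator γ V L ∧
            ∃ ε : ℝ, 0 < ε ∧ ‖(ε : ℂ) • L‖ ≤ 1 ∧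
              ∀ u : 𝓢(Phase d, ℂ), OrthoMaxwellian V u →
                ∃ hK : MemLp (opK γ V u) 2 (volume : Measure (Phase d)),
                  α ^ 2 / A * ‖u.toLp 2 (volume : Measure (Phase d))‖ ^ 2 ≤
                    Complex.re ⟪hK.toLp (opK γ V u),
                      u.toLp 2 (volume : Measure (Phase d)) +
                        (ε : ℂ) • (L (u.toLp 2) + L.adjoint (u.toLp 2))⟫_ℂ := by
  -- The given bounds are arbitrary reals; truncation at `0` makes the constant positive before any
  -- potential is chosen.
  have hM₂ : 0 ≤ max M₂ 0 := le_max_right _ _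
  have hM₃ : 0 ≤ max M₃ 0 := le_max_right _ _
  have hrate : 0 < rate d γ (max M₂ 0) (max M₃ 0) := by
    have h1 := ellipticConst_nonneg d hγ hM₂
    unfold rate
    positivity
  refine ⟨2 * (1 + γ) / rate d γ (max M₂ 0) (max M₃ 0), by positivity,
    fun V hV h₂ h₃ α hα => ?_⟩
  exact hypocoercivity d hγ hM₂ hM₃ hV (fun x => (h₂ x).trans (le_max_left _ _))
    (fun x => (h₃ x).trans (le_max_left _ _)) hα
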